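/- Let $G$ be a connected reductive algebraic group over an algebraically closed field $\mathbb K$ of characteristic $p>0$, with maximal torus $T$ of rank $d$, Borel subgroup $B\supseteq T$, character group $X=X(T)$, Lie algebras $\mathfrak g=\mathrm{Lie}(G)$, $\mathfrak h=\mathrm{Lie}(T)$, $\mathfrak b=\mathrm{Lie}(B)$, $p$-th power map $x\mapsto x^{[p]}$, roots $R\subset X$, and positive roots $R^+$ and simple roots $\Pi$ corresponding to $B$. Assume that $p$ is good for $G$. Fix a basis $\{e_\alpha,h_i\mid\alpha\in R,\ 1\le i\le d\}$ of $\mathfrak g$ with $e_\alpha\in\mathfrak g_\alpha$, $h_i\in\mathfrak h$, $h_i^{[p]}=h_i$. Let $I\subseteq\Pi$ and let $\chi\in\mathfrak g^*$ be in standard Levi form with associated set $I$: $\chi(\mathfrak b)=0$ and, for $\alpha\in R^+$, $\chi(e_{-\alpha})=1$ if $\alpha\in I$ and $\chi(e_{-\alpha})=0$ otherwise. Put $$U_\chi=U(\mathfrak g)/\langle e_\alpha^p-\chi(e_\alpha)^p\mid\alpha\in R\rangle,\qquad U^0=U(\mathfrak h),$$ and let $U^0U^+\subseteq U_\chi$ be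 the subalgebra generated by $\mathfrak h$ and the $e_\alpha$ with $\alpha\in R^+$. The algebra $U_\chi$ is $X/\mathbb ZI$-graded with $e_\alpha$ in degree $\alpha+\mathbb ZI$ and $\mathfrak h$ in degree $0$. For $\mu\in X$ let $d\mu\in\mathfrak h^*$ be its differential and $\widetilde\mu$ the algebra endomorphism of $U^0$ with $\widetilde\mu(h)=h+d\mu(h)$ for $h\in\mathfrak h$. Let $F$ be a field which is a $U^0$-algebra, with structure map $\pi:U^0\to F$. Let $\mathcal C_F$ be the category whose objects are the $U_\chi\otimes F$-modules $M$ (left $U_\chi$-action, right $F$-action) with a decomposition $M=\bigoplus_{\sigma\in X/\mathbb ZI}M_\sigma$ such that: (A) $M_\sigma F\subseteq M_\sigma$; (B) only finitely many $M_\sigma$ are non-zero, and each is finite-dimensional over $F$; (C) $(U_\chi)_\sigma M_\tau\subseteq M_{\sigma+\tau}$; (D) $M_\sigma=\bigoplus_{d\mu,\ \mu\in\sigma+pX}M_\sigma^{d\mu}$ with $sm=m\,\pi(\widetilde\mu(s))$ for $s\in U^0$, $m\in M_\sigma^{d\mu}$, with $e_\alpha M_\sigma^{d\mu}\subseteq M_{\sigma+\alpha}^{d(\mu+\alpha)}$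 for $\alpha\in R$, and with $M_\sigma^{d\mu}F\subseteq M_\sigma^{d\mu}$. Morphisms are the $U_\chi\otimes F$-linear maps sending each $M_\sigma^{d\mu}$ into $N_\sigma^{d\mu}$. For $\lambda\in X$ let $F^\lambda$ be $F$ with $U^0$ acting by $sa=a\,\pi(\widetilde\lambda(s))$ and with $e_\alpha$ acting by $0$ for $\alpha\in R^+$, and let $Z_{F,\chi}(\lambda)=U_\chi\otimes_{U^0U^+}F^\lambda$, where $Z_{F,\chi}(\lambda)_\sigma$ and $Z_{F,\chi}(\lambda)_\sigma^{d\mu}$ are the images of $(U_\chi)_{\sigma-\lambda}\otimes F$ and of the part of $(U_\chi)_{\sigma-\lambda}\otimes F$ of weight $d(\mu-\lambda)$ for the adjoint action of $\mathfrak h$. Then $Z_{F,\chi}(\lambda)$ is an object of $\mathcal C_F$, and it has a unique irreducible quotient in $\mathcal C_F$: there are an irreducible object $L_{F,\chi}(\lambda)$ and a surjective morphism $q:Z_{F,\chi}(\lambda)\to L_{F,\chi}(\lambda)$ in $\mathcal C_F$ such that for every surjective morphism $q':Z_{F,\chi}(\lambda)\to L'$ onto an irreducible object $L'$ of $\mathcal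 C_F$ there is an isomorphism $\varphi:L_{F,\chi}(\lambda)\to L'$ in $\mathcal C_F$ with $\varphi\circ q=q'$. -/

import Mathlib

open scoped TensorProduct
open WithConv

attribute [local instance 100] LieRing.ofAssociativeRing

noncomputable section

namespace BabyVerma

universe u v w x

/-! ### Linear algebraic groups

An affine algebraic group `G` over `K` is given by its coordinate ring `O = K[G]`, a commutative Hopf
algebra. Its group of `K`-points is the group of algebra homomorphisms `O → K` under convolution, and
all functionals `O → K` form an associative algebra under convolution, which contains both the points
of `G` and the Lie algebra of `G`. -/

section Groups

variable (K : Type u) [Field K] (O : Type v) [CommRing O] [HopfAlgebra K O]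

/-- The group `G(K)`. -/
abbrev Points : Type (max u v) := WithConv (O →ₐ[K] K)

/-- The full dual of `K[G]` with the convolution product. -/
abbrev ConvDual : Type (max u v) := WithConv (O →ₗ[K] K)

variable {K O}

/-- A point of `G` as a functional on `K[G]`. -/
def Points.toDual (g : Points K O) : ConvDual K O := toConv g.ofConv.toLinearMap

/-- The closed connected subgroups of `G`: over an algebraically closed field they are the subgroups
of `G(K)` which are the zero locus of a prime ideal of `K[G]` (irreducible closed subsets). -/
def IsClosedConnected (H : Subgroup (Points K O)) : Prop :=
  ∃ J : Ideal O, J.IsPrime ∧ ∀ g : Points K O, g ∈ H ↔ ∀ f ∈ J, g.ofConv f = 0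

/-- Right translation of functions, `(translate g f)(x) = f(xg)`. -/
def translate (g : Points K O) : O →ₗ[K] O :=
  (TensorProduct.rid K O).toLinearMap ∘ₗ
    (LinearMap.lTensor O g.ofConv.toLinearMap) ∘ₗ Coalgebra.comul

/-- `g` is unipotent: right translation by `g` is a locally unipotent operator on `K[G]`. -/
def IsUnipotent (g : Points K O) : Prop :=
  ∀ f : O, ∃ k : ℕ, ((translate g - 1 : Module.End K O) ^ k) f = 0

variable (K O) in
/-- `G` is a connected reductive algebraic group: its coordinate ring is a finitely generated
domain, and every closed connected normal unipotent subgroup is trivial. -/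
structure IsConnectedReductive : Prop where
  finiteType : Algebra.FiniteType K O
  isDomain : IsDomain O
  unipotentRadical_trivial : ∀ N : Subgroup (Points K O), IsClosedConnected N → N.Normal →
    (∀ g ∈ N, IsUnipotent g) → N = ⊥

/-- Borel subgroups: maximal closed connected solvable subgroups. -/
def IsBorel (B : Subgroup (Points K O)) : Prop :=
  Maximal (fun H : Subgroup (Points K O) => IsClosedConnected H ∧ Group.IsSolvable H) B

/-- The product rule for a convolution product of two point derivations. -/
lemma convMul_mul_apply (a b : ConvDual K O)
    (ha : ∀ f g : O, a.ofConv (f * g) =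
      Coalgebra.counit (R := K) f * a.ofConv g + a.ofConv f * Coalgebra.counit (R := K) g)
    (hb : ∀ f g : O, b.ofConv (f * g) =
      Coalgebra.counit (R := K) f * b.ofConv g + b.ofConv f * Coalgebra.counit (R := K) g)
    (f g : O) :
    (a * b).ofConv (f * g) =
      Coalgebra.counit (R := K) f * (a * b).ofConv g + b.ofConv f * a.ofConv g
        + a.ofConv f * b.ofConv g + (a * b).ofConv f * Coalgebra.counit (R := K) g := by
  have e1 : ∀ y : O, (1 : ConvDual K O).ofConv y = Coalgebra.counit (R := K) y := fun y => rfl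
  let rf := Coalgebra.Repr.arbitrary K f
  let rg := Coalgebra.Repr.arbitrary K g
  have h0 : (a * b).ofConv (f * g) = ∑ i ∈ rf.index, ∑ j ∈ rg.index,
      a.ofConv (rf.left i * rg.left j) * b.ofConv (rf.right i * rg.right j) := by
    rw [LinearMap.convMul_apply, Bialgebra.comul_mul, ← rf.eq, ← rg.eq, Finset.sum_mul_sum]
    simp [Algebra.TensorProduct.tmul_mul_tmul]
  have h1 : Coalgebra.counit (R := K) f * (a * b).ofConv g =
      (1 * 1 : ConvDual K O).ofConv f * (a * b).ofConv g := by rw [mul_one, e1]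
  have h2 : b.ofConv f * a.ofConv g = (1 * b).ofConv f * (a * 1).ofConv g := by
    rw [mul_one, one_mul]
  have h3 : a.ofConv f * b.ofConv g = (a * 1).ofConv f * (1 * b).ofConv g := by
    rw [mul_one, one_mul]
  have h4 : (a * b).ofConv f * Coalgebra.counit (R := K) g =
      (a * b).ofConv f * (1 * 1 : ConvDual K O).ofConv g := by rw [mul_one, e1]
  rw [h0, h1, h2, h3, h4]
  simp only [rf.convMul_apply, rg.convMul_apply, Finset.sum_mul_sum, ← Finset.sum_add_distrib]
  refine Finset.sum_congr rfl fun i _ => Finset.sum_congr rfl fun j _ => ?_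
  rw [ha, hb, e1, e1, e1, e1]
  ring

variable (K O) in
/-- The Lie algebra `Lie(G)`: point derivations of `K[G]` at the identity, with the bracket
`[x, y] = x * y - y * x` of the convolution algebra. The `p`-th power map `x ↦ x^{[p]}` is the `p`-th
power in the convolution algebra. -/
def lieAlg : LieSubalgebra K (ConvDual K O) where
  carrier := {D | ∀ f g : O, D.ofConv (f * g) =
    Coalgebra.counit (R := K) f * D.ofConv g + D.ofConv f * Coalgebra.counit (R := K) g}
  add_mem' := by
    intro a b ha hb f g
    simp only [ofConv_add, LinearMap.add_apply, ha f g, hb f g]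
    ring
  zero_mem' := by
    intro f g
    simp
  smul_mem' := by
    intro c a ha f g
    simp only [ofConv_smul, LinearMap.smul_apply, ha f g, smul_eq_mul]
    ring
  lie_mem' := by
    intro a b ha hb f g
    rw [LieRing.of_associative_ring_bracket, ofConv_sub, LinearMap.sub_apply, LinearMap.sub_apply,
      LinearMap.sub_apply, convMul_mul_apply a b ha hb, convMul_mul_apply b a hb ha]
    ring

/-- The differential `Lie(H) → Lie(G)` of a homomorphism `H → G` given by `φ : K[G] → K[H]`. -/
def lieMap {O' : Type w} [CommRing O'] [HopfAlgebra K O'] (φ : O →ₐc[K] O') :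
    lieAlg K O' →ₗ⁅K⁆ lieAlg K O where
  toFun D := ⟨toConv (D.1.ofConv ∘ₗ (φ : O →ₗc[K] O').toLinearMap), by
    intro f g
    have h := D.2 (φ f) (φ g)
    have hc : ∀ y : O, Coalgebra.counit (R := K) (φ y) = Coalgebra.counit (R := K) y :=
      fun y => CoalgHomClass.counit_comp_apply φ y
    rw [hc, hc, ← map_mul] at h
    exact h⟩
  map_add' _ _ := rfl
  map_smul' _ _ := rfl
  map_lie' := by
    intro D E
    apply Subtype.ext
    apply ofConv_injective
    have h1 := LinearMap.convMul_comp_coalgHom_distrib D.1 E.1 (φ : O →ₗc[K] O')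
    have h2 := LinearMap.convMul_comp_coalgHom_distrib E.1 D.1 (φ : O →ₗc[K] O')
    change (D.1 * E.1 - E.1 * D.1).ofConv ∘ₗ _ = (_ * _ - _ * _ : ConvDual K O).ofConv
    rw [ofConv_sub, ofConv_sub, LinearMap.sub_comp, h1, h2]

/-- The Lie algebra of a subgroup of `G(K)`, as a subspace of `Lie(G)`: the point derivations which
kill every function vanishing on the subgroup. -/
def lieOf (H : Subgroup (Points K O)) : Submodule K (lieAlg K O) where
  carrier := {D | ∀ f : O, (∀ g ∈ H, g.ofConv f = 0) → D.1.ofConv f = 0}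
  add_mem' := by
    intro a b ha hb f hf
    simp [ha f hf, hb f hf]
  zero_mem' := by
    intro f _
    simp
  smul_mem' := by
    intro c a ha f hf
    simp [ha f hf]

end Groups

/-! ### Maximal torus, roots

A torus with character group `X` (a lattice) is `T = Spec K[X]`; an embedding `T ≤ G` is a
surjective Hopf algebra map `K[G] → K[X]`. -/

section Torus

variable {K : Type u} [Field K] {O : Type v} [CommRing O] [HopfAlgebra K O]
variable {X : Type w} [AddCommGroup X]

/-- The inclusion `T(K) → G(K)`. -/
def torPoint (r : O →ₐc[K] AddMonoidAlgebra K X) (t : Points K (AddMonoidAlgebra K X)) :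
    Points K O :=
  toConv (t.ofConv.comp (r : O →ₐ[K] AddMonoidAlgebra K X))

/-- The value `lam(t)` of a character at a point of the torus. -/
def charValue (lam : X) (t : Points K (AddMonoidAlgebra K X)) : K :=
  t.ofConv (AddMonoidAlgebra.single lam 1)

/-- The weight space of weight `lam` in `Lie(G)` for the adjoint action `Ad(t) x = t x t⁻¹`. -/
def weightSpace (r : O →ₐc[K] AddMonoidAlgebra K X) (lam : X) : Submodule K (lieAlg K O) where
  carrier := {D | ∀ t : Points K (AddMonoidAlgebra K X),
    (torPoint r t).toDual * D.1 * ((torPoint r t)⁻¹).toDual = charValue lam t • D.1}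
  add_mem' := by
    intro a b ha hb t
    have h1 := ha t
    have h2 := hb t
    change _ * (a.1 + b.1) * _ = _ • (a.1 + b.1)
    rw [mul_add, add_mul, smul_add, h1, h2]
  zero_mem' := by
    intro t
    simp
  smul_mem' := by
    intro c a ha t
    have h1 := ha t
    change _ * (c • a.1) * _ = _ • (c • a.1)
    rw [mul_smul_comm, smul_mul_assoc, h1, smul_comm]

/-- The roots: non-zero weights of `T` on `Lie(G)`. -/
def roots (r : O →ₐc[K] AddMonoidAlgebra K X) : Set X :=
  {α | α ≠ 0 ∧ weightSpace r α ≠ ⊥}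

/-- The roots of `T` on the Lie algebra of a subgroup `B`. -/
def rootsOf (r : O →ₐc[K] AddMonoidAlgebra K X) (B : Subgroup (Points K O)) : Set X :=
  {α | α ≠ 0 ∧ weightSpace r α ⊓ lieOf B ≠ ⊥}

/-- `T` is a maximal torus of `G`: it is closed in `G` and is not properly contained in a larger
torus. -/
def IsMaximalTorus (r : O →ₐc[K] AddMonoidAlgebra K X) : Prop :=
  Function.Surjective r ∧
    ∀ (n : ℕ) (r' : O →ₐc[K] AddMonoidAlgebra K (Fin n → ℤ)), Function.Surjective r' →
      (∀ f : O, r' f = 0 → r f = 0) → ∀ f : O, r f = 0 → r' f = 0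

variable (K X) in
/-- `𝔥 = Lie(T)`. -/
abbrev Cartan : Type (max u w) := lieAlg K (AddMonoidAlgebra K X)

/-- The differential `d lam ∈ 𝔥*` of a character. -/
def dchar (lam : X) : Module.Dual K (Cartan K X) where
  toFun h := h.1.ofConv (AddMonoidAlgebra.single lam 1)
  map_add' _ _ := rfl
  map_smul' _ _ := rfl

variable (K X) in
/-- `U⁰ = U(𝔥)`. -/
abbrev U0 : Type (max u w) := UniversalEnvelopingAlgebra K (Cartan K X)

lemma dchar_lie (lam : X) (h h' : Cartan K X) : dchar lam ⁅h, h'⁆ = 0 := by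
  change (h.1 * h'.1 - h'.1 * h.1).ofConv (AddMonoidAlgebra.single lam 1) = 0
  rw [ofConv_sub, LinearMap.sub_apply, LinearMap.convMul_apply, LinearMap.convMul_apply]
  simp [mul_comm]

/-- The algebra endomorphism of `U⁰` with `h ↦ h + d lam(h)` for `h ∈ 𝔥`. -/
def tilde (lam : X) : U0 K X →ₐ[K] U0 K X :=
  UniversalEnvelopingAlgebra.lift K
    { ((UniversalEnvelopingAlgebra.ι K : Cartan K X →ₗ⁅K⁆ U0 K X) : Cartan K X →ₗ[K] U0 K X) +
        Algebra.linearMap K (U0 K X) ∘ₗ dchar lam with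
      map_lie' := by
        intro a b
        change UniversalEnvelopingAlgebra.ι K ⁅a, b⁆ + algebraMap K (U0 K X) (dchar lam ⁅a, b⁆) =
          (UniversalEnvelopingAlgebra.ι K a + algebraMap K (U0 K X) (dchar lam a)) *
            (UniversalEnvelopingAlgebra.ι K b + algebraMap K (U0 K X) (dchar lam b)) -
          (UniversalEnvelopingAlgebra.ι K b + algebraMap K (U0 K X) (dchar lam b)) *
            (UniversalEnvelopingAlgebra.ι K a + algebraMap K (U0 K X) (dchar lam a))
        rw [dchar_lie, map_zero, add_zero, LieHom.map_lie, LieRing.of_associative_ring_bracket]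
        rw [mul_add, mul_add, add_mul, add_mul, add_mul, add_mul,
          Algebra.commutes (dchar lam a) (UniversalEnvelopingAlgebra.ι K b),
          Algebra.commutes (dchar lam b) (UniversalEnvelopingAlgebra.ι K a),
          Algebra.commutes (dchar lam a) (algebraMap K (U0 K X) (dchar lam b))]
        abel }

end Torus

/-! ### The group-theoretic set-up -/

/-- The choices attached to a connected reductive group `G` with coordinate ring `O`: a maximal torus
`T` with character group `X`, a Borel subgroup `B` containing `T`, a basis
`{e_α, h_i | α ∈ R, 1 ≤ i ≤ d}` of `𝔤 = Lie(G)` with `e_α ∈ 𝔤_α`, `h_i ∈ 𝔥` and `h_i^{[p]} = h_i`, and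
the set `Π` of simple roots of the positive system `R⁺` given by `B`. -/
structure Setting (K : Type u) [Field K] (p : ℕ) (O : Type v) [CommRing O] [HopfAlgebra K O]
    (X : Type w) [AddCommGroup X] where
  torus : O →ₐc[K] AddMonoidAlgebra K X
  torus_max : IsMaximalTorus torus
  borel : Subgroup (Points K O)
  borel_isBorel : IsBorel borel
  torus_le_borel : ∀ t, torPoint torus t ∈ borel
  basis : Module.Basis (roots torus ⊕ Fin (Module.finrank ℤ X)) K (lieAlg K O)
  basis_root : ∀ α : roots torus, basis (Sum.inl α) ∈ weightSpace torus α.1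
  basis_cartan : ∀ i, ∃ h : Cartan K X, basis (Sum.inr i) = lieMap torus h
  basis_cartan_pow : ∀ i, (basis (Sum.inr i)).1 ^ p = (basis (Sum.inr i)).1
  simple : Set X
  simple_pos : simple ⊆ rootsOf torus borel
  simple_indep : LinearIndepOn ℤ id simple
  pos_sum : ∀ α ∈ rootsOf torus borel, α ∈ AddSubmonoid.closure simple
  pos_or_neg : ∀ α ∈ roots torus, α ∈ rootsOf torus borel ∨ -α ∈ rootsOf torus borel

namespace Setting

variable {K : Type u} [Field K] {p : ℕ} {O : Type v} [CommRing O] [HopfAlgebra K O]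
variable {X : Type w} [AddCommGroup X] (S : Setting K p O X)

/-- The set `R` of roots. -/
abbrev R : Set X := roots S.torus

/-- The set `R⁺` of positive roots. -/
abbrev pos : Set X := rootsOf S.torus S.borel

/-- The root vector `e_α`. -/
def e (α : S.R) : lieAlg K O := S.basis (Sum.inl α)

/-- `p` is good for `G`: it divides no non-zero coefficient of a positive root written as a
combination of simple roots. (This excludes `2` for components of type `B`, `C`, `D`; `2, 3` for
`E₆, E₇, F₄, G₂`; `2, 3, 5` for `E₈`; and no prime in type `A`.) -/
def IsGood : Prop :=
  ∀ c : S.simple →₀ ℕ, (c.sum fun β n => n • β.1) ∈ S.pos → ∀ β, p ∣ c β → c β = 0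

/-- `χ` is in standard Levi form with associated set `I` of simple roots. -/
structure IsStandardLevi (χ : Module.Dual K (lieAlg K O)) (I : Set X) : Prop where
  subset : I ⊆ S.simple
  borel : ∀ x ∈ lieOf S.borel, χ x = 0
  mem : ∀ α : S.R, -α.1 ∈ S.pos → -α.1 ∈ I → χ (S.e α) = 1
  not_mem : ∀ α : S.R, -α.1 ∈ S.pos → -α.1 ∉ I → χ (S.e α) = 0

/-- `X / ℤI`. -/
abbrev XI (_S : Setting K p O X) (I : Set X) : Type w := X ⧸ AddSubgroup.closure I

/-- The class `μ + ℤI`. -/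
abbrev cls (I : Set X) (μ : X) : S.XI I := QuotientAddGroup.mk μ

/-- The set of all `dμ ∈ 𝔥*` with `μ ∈ σ + pX`, for a coset `σ` of `ℤI`. -/
def weights (I : Set X) (σ : S.XI I) : Set (Module.Dual K (Cartan K X)) :=
  {ξ | ∃ μ τ : X, S.cls I (μ - p • τ) = σ ∧ dchar μ = ξ}

/-! ### The algebra `U_χ` -/

variable (χ : Module.Dual K (lieAlg K O)) (I : Set X)

/-- The relations `e_α ^ p = χ(e_α) ^ p` for `α ∈ R`. -/
def uRel (a b : UniversalEnvelopingAlgebra K (lieAlg K O)) : Prop :=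
  ∃ α : S.R, a = UniversalEnvelopingAlgebra.ι K (S.e α) ^ p ∧ b = algebraMap K _ (χ (S.e α) ^ p)

/-- `U_χ = U(𝔤) / ⟨e_α ^ p - χ(e_α) ^ p | α ∈ R⟩`. -/
def U : Type (max u v) := RingQuot (S.uRel χ)

instance : Ring (S.U χ) := inferInstanceAs (Ring (RingQuot (S.uRel χ)))

instance : Algebra K (S.U χ) := inferInstanceAs (Algebra K (RingQuot (S.uRel χ)))

/-- The quotient map `U(𝔤) → U_χ`. -/
def toU : UniversalEnvelopingAlgebra K (lieAlg K O) →ₐ[K] S.U χ := RingQuot.mkAlgHom K (S.uRel χ)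

/-- The image of `e_α` in `U_χ`. -/
def ue (α : S.R) : S.U χ := S.toU χ (UniversalEnvelopingAlgebra.ι K (S.e α))

/-- The map `U⁰ = U(𝔥) → U_χ`. -/
def u0 : U0 K X →ₐ[K] S.U χ :=
  (S.toU χ).comp (UniversalEnvelopingAlgebra.lift K
    ((UniversalEnvelopingAlgebra.ι K).comp (lieMap S.torus)))

/-- The image of `h ∈ 𝔥` in `U_χ`. -/
def uh (h : Cartan K X) : S.U χ := S.u0 χ (UniversalEnvelopingAlgebra.ι K h)

/-- The generators `e_α` and `h` of `U_χ`. -/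
def gen : S.R ⊕ Cartan K X → S.U χ := Sum.elim (S.ue χ) (S.uh χ)

/-- Their degrees: `α + ℤI` and `0 + ℤI`. -/
def genDeg : S.R ⊕ Cartan K X → S.XI I := Sum.elim (fun α => S.cls I α.1) fun _ => 0

/-- The `X/ℤI`-grading of `U_χ`: the component of degree `σ` is spanned by the monomials in the
generators whose degrees add up to `σ`. -/
def uGr (σ : S.XI I) : Submodule K (S.U χ) :=
  Submodule.span K {y | ∃ l : List (S.R ⊕ Cartan K X),
    (l.map (S.genDeg I)).sum = σ ∧ (l.map (S.gen χ)).prod = y}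

/-- The subspace of weight `ξ ∈ 𝔥*` in the component of degree `σ` of `U_χ`, for the adjoint
action of `𝔥`. -/
def uWt (σ : S.XI I) (ξ : Module.Dual K (Cartan K X)) : Set (S.U χ) :=
  {y | y ∈ S.uGr χ I σ ∧ ∀ h : Cartan K X, S.uh χ h * y - y * S.uh χ h = ξ h • y}

/-! ### The category `𝒞_A` -/

variable (A : Type x) [CommRing A] [Algebra K A] (π : U0 K X →ₐ[K] A)

/-- A `U_χ ⊗ A`-module with subspaces `M_σ` (`σ ∈ X/ℤI`) and `M_σ^ξ` (`ξ ∈ 𝔥*`). -/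
structure GrMod where
  carrier : Type (max u v x)
  [addCommGroup : AddCommGroup carrier]
  [module : Module (S.U χ ⊗[K] A) carrier]
  gr : S.XI I → AddSubgroup carrier
  wt : S.XI I → Module.Dual K (Cartan K X) → AddSubgroup carrier

attribute [instance] GrMod.addCommGroup GrMod.module

variable {S χ I A}

/-- The conditions (A), (B), (C), (D) for an object of `𝒞_A`. -/
structure GrMod.IsObject (M : S.GrMod χ I A) : Prop where
  /-- `M = ⨁ M_σ`. -/
  gr_indep : iSupIndep M.gr
  gr_top : ⨆ σ, M.gr σ = ⊤
  /-- (A) -/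
  gr_smul : ∀ (σ) (a : A), ∀ m ∈ M.gr σ, ((1 : S.U χ) ⊗ₜ[K] a) • m ∈ M.gr σ
  /-- (B) -/
  gr_finite : {σ | M.gr σ ≠ ⊥}.Finite
  gr_fg : ∀ σ, ∃ s : Finset M.carrier,
    M.gr σ = AddSubgroup.closure {m | ∃ a : A, ∃ y ∈ s, m = ((1 : S.U χ) ⊗ₜ[K] a) • y}
  /-- (C) -/
  gr_mul : ∀ σ τ, ∀ y ∈ S.uGr χ I σ, ∀ m ∈ M.gr τ, (y ⊗ₜ[K] (1 : A)) • m ∈ M.gr (σ + τ)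
  /-- (D): `M_σ` is the direct sum of the `M_σ^{dμ}` with `μ ∈ σ + pX` (there is no summand for
  other elements of `𝔥*`) -/
  wt_indep : ∀ σ, iSupIndep (M.wt σ)
  wt_sum : ∀ σ, ⨆ ξ, M.wt σ ξ = M.gr σ
  wt_bot : ∀ σ, ∀ ξ ∉ S.weights I σ, M.wt σ ξ = ⊥
  wt_act : ∀ (σ) (μ : X), dchar μ ∈ S.weights I σ → ∀ (s : U0 K X), ∀ m ∈ M.wt σ (dchar μ),
    (S.u0 χ s ⊗ₜ[K] (1 : A)) • m = ((1 : S.U χ) ⊗ₜ[K] π (tilde μ s)) • m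
  wt_root : ∀ (σ) (μ : X) (α : S.R), dchar μ ∈ S.weights I σ → ∀ m ∈ M.wt σ (dchar μ),
    (S.ue χ α ⊗ₜ[K] (1 : A)) • m ∈ M.wt (S.cls I α.1 + σ) (dchar (μ + α.1))
  wt_smul : ∀ (σ ξ) (a : A), ∀ m ∈ M.wt σ ξ, ((1 : S.U χ) ⊗ₜ[K] a) • m ∈ M.wt σ ξ

variable (S χ I A)

/-- Objects of `𝒞_A`, where `A` is a commutative algebra over `U⁰` with structure map `π`. -/
structure Cat where
  obj : S.GrMod χ I A
  isObject : obj.IsObject π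

variable {S χ I A π}

/-- Morphisms of `𝒞_A`: `U_χ ⊗ A`-linear maps which send `M_σ^ξ` to `N_σ^ξ`. -/
@[ext]
structure Cat.Hom (M N : S.Cat χ I A π) where
  map : M.obj.carrier →ₗ[S.U χ ⊗[K] A] N.obj.carrier
  map_wt : ∀ σ, ∀ ξ ∈ S.weights I σ, ∀ m ∈ M.obj.wt σ ξ, map m ∈ N.obj.wt σ ξ

instance : CategoryTheory.Category (S.Cat χ I A π) where
  Hom := Cat.Hom
  id M := ⟨LinearMap.id, fun _ _ _ _ hm => hm⟩
  comp f g := ⟨g.map ∘ₗ f.map, fun σ ξ hξ m hm => g.map_wt σ ξ hξ _ (f.map_wt σ ξ hξ m hm)⟩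

/-- A submodule is a subobject in the category if it is the sum of its intersections with the
components `M_σ^ξ`. -/
def Cat.IsSubobject (M : S.Cat χ I A π) (N : Submodule (S.U χ ⊗[K] A) M.obj.carrier) : Prop :=
  N.toAddSubgroup ≤ ⨆ (σ) (ξ), N.toAddSubgroup ⊓ M.obj.wt σ ξ

/-- Irreducible objects: non-zero, without subobjects other than `0` and the whole object. -/
def Cat.IsIrreducible (M : S.Cat χ I A π) : Prop :=
  Nontrivial M.obj.carrier ∧ ∀ N, M.IsSubobject N → N = ⊥ ∨ N = ⊤

/-! ### Baby Verma modules -/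

variable (S χ A π)

/-- The relations defining `U_χ ⊗_{U⁰U⁺} A^lam` as a quotient of `U_χ ⊗ A`. On `A^lam` the algebra
`U⁰` acts by `s a = a π(tilde lam s)` and `e_α` acts as `0` for `α ∈ R⁺`; as `U⁰` and these `e_α`
generate the algebra `U⁰U⁺`, the tensor product has to be balanced over these elements. -/
def verRel (lam : X) : Submodule (S.U χ ⊗[K] A) (S.U χ ⊗[K] A) :=
  Submodule.span _
    ({z | ∃ (y : S.U χ) (α : S.R) (a : A), α.1 ∈ S.pos ∧ z = (y * S.ue χ α) ⊗ₜ[K] a} ∪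
     {z | ∃ (y : S.U χ) (s : U0 K X) (a : A),
        z = (y * S.u0 χ s) ⊗ₜ[K] a - y ⊗ₜ[K] (a * π (tilde lam s))})

variable (I)

/-- The baby Verma module `Z_{A,χ}(lam) = U_χ ⊗_{U⁰U⁺} A^lam` with its graded components, the images
of `(U_χ)_{σ - lam} ⊗ A` and of `(U_χ)_{σ - lam}^{ξ - d lam} ⊗ A`. -/
def babyVerma (lam : X) : S.GrMod χ I A where
  carrier := (S.U χ ⊗[K] A) ⧸ S.verRel χ A π lam
  gr σ := AddSubgroup.closure
    {z | ∃ y ∈ S.uGr χ I (σ - S.cls I lam), ∃ a : A, z = Submodule.Quotient.mk (y ⊗ₜ[K] a)}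
  wt σ ξ := AddSubgroup.closure
    {z | ∃ y ∈ S.uWt χ I (σ - S.cls I lam) (ξ - dchar lam), ∃ a : A,
      z = Submodule.Quotient.mk (y ⊗ₜ[K] a)}

end Setting

end BabyVerma

namespace BabyVerma

universe u v w x

section

/-! ### Points of a torus, differentials of characters, weight spaces of the Lie algebra. -/

section TorusLemmas

variable {K : Type u} [Field K] {O : Type v} [CommRing O] [HopfAlgebra K O]
variable {X : Type w} [AddCommGroup X]

/-! Write `Z` for the baby Verma module and `v` for its canonical generator. The theorem follows
from two facts about the shifted negative root vectors `y_α = e_α - χ(e_α)`: they generate a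
nilpotent algebra, and `v` is non-zero.

Nilpotency (`exists_word_eq_zero`). In `U_χ` one has `y_α^p = 0`. As `χ` vanishes on root vectors of
height below `-1`, the commutator of two `y`'s is zero or a multiple of a third, whose height is the
sum of the two. A long word can thus be reordered, modulo shorter words of the same total height,
until some letter stands `p` times in a row. Since words applied to `v` span `Z`
(`closure_word_eq_top`), this also gives the finiteness needed for `Z` to be an object. The grading
of `U_χ` comes from a coaction of `X/ℤI`: each defining relation is homogeneous, because `χ(e_α) =
0` unless `α ∈ ℤI`.

Unique maximal subobject. Let `J` be the sum of the images `y_α Z` (`verRad`). Then `Z = vF + J`,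
and nilpotency gives Nakayama's lemma: a submodule `N` with `N + J = Z` is all of `Z`. As `F` is a
field, a submodule not inside `J` contains a vector `va + j` with `a` invertible, so it is all of
`Z` (`le_verRad`). If `v ≠ 0` then `J ≠ Z`, again by Nakayama. The sum of all proper subobjects
therefore stays in `J` and is the largest proper subobject; every morphism onto an irreducible
object has it as kernel.

Non-vanishing of `v` (`verMk_one_ne_zero`). It suffices to have a functional `θ` on `U(𝔤)` with
`θ(1) = 1` on which `𝔫⁻` acts from the left by `χ` and `𝔟` from the right by the character of
`F^lam`. Instead of invoking the Poincaré-Birkhoff-Witt theorem, the action of `𝔤` on the induced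
module is built by hand on `F ⊗ U(𝔫⁻)` (`exists_whittaker_functional`); `θ` applies an element to `1
⊗ 1` and then evaluates by `χ`. It descends to `U_χ` because the `e_α^p` are central in `U(𝔤)`: for
good `p`, `pα` is neither zero nor a root, so `e_α^{[p]} = 0` and `ad(e_α)^p = 0`. -/

lemma toDual_mul (g h : Points K O) : (g * h).toDual = g.toDual * h.toDual := rfl

lemma toDual_one : (1 : Points K O).toDual = 1 := rfl

lemma toDual_inv_mul (g : Points K O) : (g⁻¹).toDual * g.toDual = 1 := by
  rw [← toDual_mul, inv_mul_cancel, toDual_one]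

lemma toDual_mul_inv (g : Points K O) : g.toDual * (g⁻¹).toDual = 1 := by
  rw [← toDual_mul, mul_inv_cancel, toDual_one]

lemma toDual_apply (g : Points K O) (f : O) : g.toDual.ofConv f = g.ofConv f := rfl

lemma charValue_add (a b : X) (t : Points K (AddMonoidAlgebra K X)) :
    charValue (a + b) t = charValue a t * charValue b t := by
  unfold charValue
  rw [← map_mul, AddMonoidAlgebra.single_mul_single, one_mul]

lemma charValue_zero (t : Points K (AddMonoidAlgebra K X)) : charValue 0 t = 1 :=
  map_one t.ofConv

lemma charValue_mul (a : X) (s t : Points K (AddMonoidAlgebra K X)) :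
    charValue a (s * t) = charValue a s * charValue a t := by
  unfold charValue
  have h := congrArg (fun z : ConvDual K (AddMonoidAlgebra K X) =>
    z.ofConv (AddMonoidAlgebra.single a 1)) (toDual_mul s t)
  rw [toDual_apply] at h
  rw [h, LinearMap.convMul_apply]
  simp [toDual_apply]

variable (K) in
/-- A character of the torus as a homomorphism on its points. -/
def charHom (a : X) : Points K (AddMonoidAlgebra K X) →* K where
  toFun t := charValue a t
  map_one' := by
    change (1 : Points K (AddMonoidAlgebra K X)).toDual.ofConv _ = _
    rw [toDual_one]
    simp
  map_mul' := charValue_mul a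

/-- The point of the torus given by a homomorphism `X → Kˣ`. -/
def pointOfHom (ψ : Multiplicative X →* K) : Points K (AddMonoidAlgebra K X) :=
  toConv (AddMonoidAlgebra.lift K K X ψ)

lemma charValue_pointOfHom (ψ : Multiplicative X →* K) (a : X) :
    charValue a (pointOfHom ψ) = ψ (Multiplicative.ofAdd a) := by
  simp [charValue, pointOfHom]

/-- Otherwise the non-zero polynomial `X^(|n|+1) - X`, whose extra factor `X` takes care of the
element `0`, would vanish on the whole infinite field. -/
lemma exists_pow_ne_one [Infinite K] {n : ℤ} (hn : n ≠ 0) : ∃ c : Kˣ, c ^ n ≠ 1 := by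
  by_contra! h
  have hm : 0 < n.natAbs := Int.natAbs_pos.mpr hn
  have hp : (Polynomial.X ^ (n.natAbs + 1) - Polynomial.X : Polynomial K) = 0 := by
    apply Polynomial.funext
    intro c
    by_cases hc : c = 0
    · simp [hc]
    · have h1 := h (Units.mk0 c hc)
      have h2 : (Units.mk0 c hc) ^ n.natAbs = 1 := by
        rcases Int.natAbs_eq n with h3 | h3
        · rw [h3] at h1; simpa using h1
        · rw [h3] at h1; simpa using h1
      have h3 : c ^ n.natAbs = 1 := by
        simpa using congrArg Units.val h2
      simp [pow_succ, h3]
  have := congrArg (fun q => Polynomial.coeff q 1) hp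
  have h1 : n.natAbs ≠ 0 := hm.ne'
  simp [Polynomial.coeff_X_pow, eq_comm, hn] at this

/-- Take a coordinate of the lattice in which `a` and `b` differ; raising a suitable unit `c` to
that coordinate is a point of the torus which separates the two characters. -/
lemma charHom_injective [Infinite K] [Module.Free ℤ X] :
    Function.Injective (charHom K (X := X)) := by
  intro a b hab
  by_contra hne
  have hν : a - b ≠ 0 := sub_ne_zero.mpr hne
  let B := Module.Free.chooseBasis ℤ X
  have : ∃ i, B.repr (a - b) i ≠ 0 := by
    by_contra! h
    apply hν
    apply B.repr.injective
    ext i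
    simpa using h i
  obtain ⟨i, hi⟩ := this
  obtain ⟨c, hc⟩ := exists_pow_ne_one (K := K) hi
  let ψ : Multiplicative X →* K := (Units.coeHom K).comp
    { toFun := fun x => c ^ (B.repr x.toAdd i)
      map_one' := by simp
      map_mul' := fun x y => by simp [zpow_add] }
  have h1 : charValue a (pointOfHom ψ) = charValue b (pointOfHom ψ) :=
    DFunLike.congr_fun hab (pointOfHom ψ)
  rw [charValue_pointOfHom, charValue_pointOfHom] at h1
  apply hc
  have h2 : c ^ (B.repr a i) = c ^ (B.repr b i) := Units.ext h1
  rw [map_sub, Finsupp.sub_apply, zpow_sub, h2, mul_inv_cancel]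

lemma exists_charValue_ne [Infinite K] [Module.Free ℤ X] {a b : X} (hab : a ≠ b) :
    ∃ t : Points K (AddMonoidAlgebra K X), charValue a t ≠ charValue b t := by
  by_contra! h
  exact hab (charHom_injective (K := K) (MonoidHom.ext h))

/-- The points of a torus separate its regular functions. -/
lemma eq_of_forall_point [Infinite K] [Module.Free ℤ X] {f g : AddMonoidAlgebra K X}
    (h : ∀ t : Points K (AddMonoidAlgebra K X), t.ofConv f = t.ofConv g) : f = g := by
  rw [← sub_eq_zero]
  -- Dedekind's independence of characters: a function on the torus is a combination of distinct
  -- characters, so its values at points determine its coefficients.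
  have hli := (linearIndependent_monoidHom (Points K (AddMonoidAlgebra K X)) K).comp _
    (charHom_injective (K := K) (X := X))
  rw [linearIndependent_iff] at hli
  have key : ∀ (q : AddMonoidAlgebra K X) (t : Points K (AddMonoidAlgebra K X)),
      t.ofConv q = Finsupp.linearCombination K
        ((fun f => f : (Points K (AddMonoidAlgebra K X) →* K) →
          Points K (AddMonoidAlgebra K X) → K) ∘ charHom K) q.coeff t := by
    intro q t
    induction q using AddMonoidAlgebra.induction_linear with
    | zero => simp
    | add a b ha hb => simp only [map_add, AddMonoidAlgebra.coeff_add, Pi.add_apply, ha, hb]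
    | single m c =>
      have h1 : AddMonoidAlgebra.single m c = c • AddMonoidAlgebra.single (R := K) m 1 := by simp
      rw [h1, map_smul, ← h1]
      simp [charHom, charValue]
  apply AddMonoidAlgebra.coeff_injective
  apply hli
  ext t
  rw [← key, map_sub, h t, sub_self]
  rfl

lemma dchar_apply (a : X) (h : Cartan K X) :
    dchar a h = h.1.ofConv (AddMonoidAlgebra.single a 1) := rfl

lemma dchar_add (a b : X) : dchar (K := K) (a + b) = dchar a + dchar b := by
  ext h
  have h1 := h.2 (AddMonoidAlgebra.single a 1) (AddMonoidAlgebra.single b 1)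
  rw [AddMonoidAlgebra.single_mul_single, one_mul] at h1
  rw [LinearMap.add_apply, dchar_apply, dchar_apply, dchar_apply, h1]
  simp [add_comm]

variable (K X) in
/-- The differential of characters as a homomorphism `X → 𝔥*`. -/
def dcharHom : X →+ Module.Dual K (Cartan K X) := AddMonoidHom.mk' dchar dchar_add

lemma dchar_zero : dchar (K := K) (0 : X) = 0 := map_zero (dcharHom K X)

lemma dchar_sub (a b : X) : dchar (K := K) (a - b) = dchar a - dchar b :=
  map_sub (dcharHom K X) a b

/-- An element of `𝔥` is determined by the differentials of all characters. -/
lemma cartan_ext {h h' : Cartan K X} (H : ∀ a, dchar a h = dchar a h') : h = h' := by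
  apply Subtype.ext
  apply ofConv_injective
  ext a
  exact H a

lemma cartan_lie (h h' : Cartan K X) : ⁅h, h'⁆ = 0 :=
  cartan_ext fun a => by rw [dchar_lie, map_zero]

variable (r : O →ₐc[K] AddMonoidAlgebra K X)

/-- Clearing the inverse of the torus point gives a relation that passes directly to convolution
products, hence to brackets and `p`-th powers. -/
lemma mem_weightSpace_iff {a : X} {D : lieAlg K O} : D ∈ weightSpace r a ↔
    ∀ t : Points K (AddMonoidAlgebra K X),
      (torPoint r t).toDual * D.1 = charValue a t • (D.1 * (torPoint r t).toDual) := by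
  constructor
  · intro h t
    rw [← smul_mul_assoc, ← h t, mul_assoc, toDual_inv_mul, mul_one]
  · intro h t
    rw [h t, smul_mul_assoc, mul_assoc, toDual_mul_inv, mul_one]

lemma lie_mem_weightSpace {a b : X} {x y : lieAlg K O} (hx : x ∈ weightSpace r a)
    (hy : y ∈ weightSpace r b) : ⁅x, y⁆ ∈ weightSpace r (a + b) := by
  rw [mem_weightSpace_iff] at hx hy ⊢
  have mul : ∀ {a b : X} {x y : ConvDual K O} (t : Points K (AddMonoidAlgebra K X)),
      (torPoint r t).toDual * x = charValue a t • (x * (torPoint r t).toDual) →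
      (torPoint r t).toDual * y = charValue b t • (y * (torPoint r t).toDual) →
      (torPoint r t).toDual * (x * y) =
        charValue (a + b) t • (x * y * (torPoint r t).toDual) := by
    intro a b x y t h1 h2
    rw [← mul_assoc, h1, smul_mul_assoc, mul_assoc, h2, mul_smul_comm, smul_smul, charValue_add,
      mul_assoc]
  intro t
  change _ * (x.1 * y.1 - y.1 * x.1) = _ • ((x.1 * y.1 - y.1 * x.1) * _)
  rw [mul_sub, sub_mul, smul_sub, mul t (hx t) (hy t), mul t (hy t) (hx t), add_comm b a]

/-- The convolution algebra of the torus is commutative, and pulling functionals back along `r`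
respects convolution. -/
lemma lieMap_mem_weightSpace (h : Cartan K X) : lieMap r h ∈ weightSpace r 0 := by
  rw [mem_weightSpace_iff]
  intro t
  rw [charValue_zero, one_smul]
  have h1 := LinearMap.convMul_comp_coalgHom_distrib t.toDual h.1
    (r : O →ₗc[K] AddMonoidAlgebra K X)
  have h2 := LinearMap.convMul_comp_coalgHom_distrib h.1 t.toDual
    (r : O →ₗc[K] AddMonoidAlgebra K X)
  rw [mul_comm] at h1
  apply ofConv_injective
  exact h1.symm.trans h2

/-- The differential of the adjoint action of `T` on a weight space. -/
lemma lie_weightSpace [Infinite K] [Module.Free ℤ X] {a : X} {D : lieAlg K O}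
    (hD : D ∈ weightSpace r a) (h : Cartan K X) : ⁅lieMap r h, D⁆ = dchar a h • D := by
  rw [mem_weightSpace_iff] at hD
  apply Subtype.ext
  apply ofConv_injective
  ext f
  let rf := Coalgebra.Repr.arbitrary K f
  -- The weight condition evaluated at `f` compares the values at `t` of two functions on the torus.
  -- Since points separate functions, it is an identity in `K[X]`, which can be differentiated.
  have e : ∑ i ∈ rf.index, D.1.ofConv (rf.right i) • r (rf.left i) =
      AddMonoidAlgebra.single a 1 *
        ∑ i ∈ rf.index, D.1.ofConv (rf.left i) • r (rf.right i) := by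
    apply eq_of_forall_point
    intro t
    have ht := congrArg (fun z : ConvDual K O => z.ofConv f) (hD t)
    simp only [ofConv_smul, LinearMap.smul_apply, rf.convMul_apply] at ht
    rw [map_mul, map_sum, map_sum]
    simp only [map_smul, smul_eq_mul]
    simp only [smul_eq_mul] at ht
    rw [show (∑ i ∈ rf.index, D.1.ofConv (rf.right i) * t.ofConv (r (rf.left i))) =
      ∑ i ∈ rf.index, (torPoint r t).toDual.ofConv (rf.left i) * D.1.ofConv (rf.right i) from
      Finset.sum_congr rfl fun i _ => mul_comm _ _, ht]
    rfl
  -- Differentiation at the identity: in the product rule the character contributes its value `1` to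
  -- one term and `dchar a h` to the other.
  have e' := congrArg h.1.ofConv e
  rw [h.2, map_sum, map_sum, map_sum] at e'
  simp only [map_smul, smul_eq_mul] at e'
  have hc : ∀ y : O, Coalgebra.counit (R := K) (r y) = Coalgebra.counit (R := K) y :=
    fun y => CoalgHomClass.counit_comp_apply r y
  have c1 : ((lieMap r h).1 * D.1).ofConv f =
      ∑ i ∈ rf.index, D.1.ofConv (rf.right i) * h.1.ofConv (r (rf.left i)) := by
    rw [rf.convMul_apply]
    exact Finset.sum_congr rfl fun i _ => mul_comm _ _
  have c2 : (D.1 * (lieMap r h).1).ofConv f =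
      ∑ i ∈ rf.index, D.1.ofConv (rf.left i) * h.1.ofConv (r (rf.right i)) := by
    rw [rf.convMul_apply]
    rfl
  have c3 : D.1.ofConv f = ∑ i ∈ rf.index,
      D.1.ofConv (rf.left i) * Coalgebra.counit (R := K) (r (rf.right i)) := by
    conv_lhs => rw [← mul_one D.1, rf.convMul_apply]
    exact Finset.sum_congr rfl fun i _ => by rw [hc]; rfl
  rw [← c1, ← c2, ← c3] at e'
  change ((lieMap r h).1 * D.1).ofConv f - (D.1 * (lieMap r h).1).ofConv f = _
  rw [e']
  simp [dchar_apply]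

/-- The Leibniz rule for powers of a point derivation. -/
lemma pow_mul_apply (D : lieAlg K O) (n : ℕ) (f g : O) :
    (D.1 ^ n).ofConv (f * g) = ∑ ij ∈ Finset.HasAntidiagonal.antidiagonal n,
      (n.choose ij.1) • ((D.1 ^ ij.1).ofConv f * (D.1 ^ ij.2).ofConv g) := by
  have e1 : ∀ y : O, (1 : ConvDual K O).ofConv y = Coalgebra.counit (R := K) y := fun y => rfl
  induction n generalizing f g with
  | zero => simp [e1]
  | succ n ih =>
    rw [Finset.sum_antidiagonal_choose_succ_nsmul
      (fun i j => (D.1 ^ i).ofConv f * (D.1 ^ j).ofConv g)]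
    let rf := Coalgebra.Repr.arbitrary K f
    let rg := Coalgebra.Repr.arbitrary K g
    have h0 : (D.1 ^ (n + 1)).ofConv (f * g) = ∑ i ∈ rf.index, ∑ j ∈ rg.index,
        D.1.ofConv (rf.left i * rg.left j) * (D.1 ^ n).ofConv (rf.right i * rg.right j) := by
      rw [pow_succ', LinearMap.convMul_apply, Bialgebra.comul_mul, ← rf.eq, ← rg.eq,
        Finset.sum_mul_sum]
      simp [Algebra.TensorProduct.tmul_mul_tmul]
    have hl : ∀ k, (D.1 ^ (k + 1)).ofConv f = ∑ i ∈ rf.index,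
        D.1.ofConv (rf.left i) * (D.1 ^ k).ofConv (rf.right i) := fun k => by
      rw [pow_succ', rf.convMul_apply]
    have hl' : ∀ k, (D.1 ^ (k + 1)).ofConv g = ∑ i ∈ rg.index,
        D.1.ofConv (rg.left i) * (D.1 ^ k).ofConv (rg.right i) := fun k => by
      rw [pow_succ', rg.convMul_apply]
    have hr : ∀ k, (D.1 ^ k).ofConv f = ∑ i ∈ rf.index,
        Coalgebra.counit (R := K) (rf.left i) * (D.1 ^ k).ofConv (rf.right i) := fun k => by
      conv_lhs => rw [← one_mul (D.1 ^ k), rf.convMul_apply]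
      simp only [e1]
    have hr' : ∀ k, (D.1 ^ k).ofConv g = ∑ i ∈ rg.index,
        Coalgebra.counit (R := K) (rg.left i) * (D.1 ^ k).ofConv (rg.right i) := fun k => by
      conv_lhs => rw [← one_mul (D.1 ^ k), rg.convMul_apply]
      simp only [e1]
    -- `A` and `B` are the two halves of the product rule for the factor `D` split off on the left;
    -- Pascal's identity distributes the binomial coefficients over them.
    have A : ∀ k l, (D.1 ^ k).ofConv f * (D.1 ^ (l + 1)).ofConv g =
        ∑ i ∈ rf.index, ∑ j ∈ rg.index, Coalgebra.counit (R := K) (rf.left i) *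
          D.1.ofConv (rg.left j) * ((D.1 ^ k).ofConv (rf.right i) *
            (D.1 ^ l).ofConv (rg.right j)) := fun k l => by
      rw [hr k, hl' l, Finset.sum_mul_sum]
      refine Finset.sum_congr rfl fun i _ => Finset.sum_congr rfl fun j _ => by ring
    have B : ∀ k l, (D.1 ^ (k + 1)).ofConv f * (D.1 ^ l).ofConv g =
        ∑ i ∈ rf.index, ∑ j ∈ rg.index, D.1.ofConv (rf.left i) *
          Coalgebra.counit (R := K) (rg.left j) * ((D.1 ^ k).ofConv (rf.right i) *
            (D.1 ^ l).ofConv (rg.right j)) := fun k l => by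
      rw [hl k, hr' l, Finset.sum_mul_sum]
      refine Finset.sum_congr rfl fun i _ => Finset.sum_congr rfl fun j _ => by ring
    simp only [A, B, Finset.smul_sum]
    rw [Finset.sum_comm (s := Finset.HasAntidiagonal.antidiagonal n),
      Finset.sum_comm (s := Finset.HasAntidiagonal.antidiagonal n),
      ← Finset.sum_add_distrib, h0]
    refine Finset.sum_congr rfl fun i _ => ?_
    rw [Finset.sum_comm (s := Finset.HasAntidiagonal.antidiagonal n),
      Finset.sum_comm (s := Finset.HasAntidiagonal.antidiagonal n),
      ← Finset.sum_add_distrib]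
    refine Finset.sum_congr rfl fun j _ => ?_
    rw [D.2, ih, add_mul, Finset.mul_sum, Finset.mul_sum]
    congr 1
    · refine Finset.sum_congr rfl fun q hq => ?_
      rw [mul_smul_comm]
    · refine Finset.sum_congr rfl fun q hq => ?_
      rw [mul_smul_comm,
        Nat.choose_symm_of_eq_add (Finset.HasAntidiagonal.mem_antidiagonal.mp hq).symm]

/-- `Lie(G)` is closed under the `p`-th power map. -/
lemma pow_mem_lieAlg (p : ℕ) [Fact p.Prime] [CharP K p] (D : lieAlg K O) :
    D.1 ^ p ∈ lieAlg K O := by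
  intro f g
  have hp : p.Prime := Fact.out
  rw [pow_mul_apply, Finset.Nat.sum_antidiagonal_eq_sum_range_succ_mk, Finset.sum_range_succ,
    Finset.sum_range_eq_add_Ico _ hp.pos, Finset.sum_eq_zero]
  · simp
  · intro i hi
    rw [Finset.mem_Ico] at hi
    have : ((p.choose i : ℕ) : K) = 0 := by
      rw [CharP.cast_eq_zero_iff K p]
      exact hp.dvd_choose_self (by omega) hi.2
    rw [nsmul_eq_mul, this, zero_mul]

lemma pow_mem_weightSpace (p : ℕ) [Fact p.Prime] [CharP K p] {a : X} {D : lieAlg K O}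
    (hD : D ∈ weightSpace r a) :
    (⟨D.1 ^ p, pow_mem_lieAlg p D⟩ : lieAlg K O) ∈ weightSpace r (p • a) := by
  rw [mem_weightSpace_iff] at hD ⊢
  intro t
  change _ * D.1 ^ p = charValue (p • a) t • (D.1 ^ p * _)
  generalize p = n
  induction n with
  | zero => simp [charValue_zero]
  | succ n ih =>
    rw [pow_succ, ← mul_assoc, ih, succ_nsmul, charValue_add, smul_mul_assoc, mul_assoc, hD t,
      mul_smul_comm, smul_smul, mul_assoc]

/-- A point derivation is determined by its values on finitely many algebra generators. This is what
makes the set of roots finite. -/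
lemma finite_lieAlg [Algebra.FiniteType K O] : Module.Finite K (lieAlg K O) := by
  obtain ⟨s, hs⟩ := (inferInstance : Algebra.FiniteType K O).out
  let φ : lieAlg K O →ₗ[K] (s → K) :=
    { toFun := fun D f => D.1.ofConv f.1
      map_add' := fun _ _ => rfl
      map_smul' := fun _ _ => rfl }
  apply Module.Finite.of_injective φ
  rw [← LinearMap.ker_eq_bot, LinearMap.ker_eq_bot']
  intro D hD
  apply Subtype.ext
  apply ofConv_injective
  ext f
  have h1 : D.1.ofConv 1 = 0 := by
    have := D.2 1 1
    simpa using this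
  have hf : f ∈ Algebra.adjoin K (s : Set O) := by rw [hs]; trivial
  change D.1.ofConv f = 0
  induction hf using Algebra.adjoin_induction with
  | mem x hx => exact congrFun hD ⟨x, hx⟩
  | algebraMap c => rw [Algebra.algebraMap_eq_smul_one, map_smul, h1, smul_zero]
  | add x y _ _ hx hy => rw [map_add, hx, hy, add_zero]
  | mul x y _ _ hx hy => rw [D.2, hx, hy, mul_zero, zero_mul, add_zero]

lemma lieMap_injective (hr : Function.Surjective r) : Function.Injective (lieMap r) := by
  intro h h' e
  apply Subtype.ext
  apply ofConv_injective
  ext a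
  obtain ⟨f, hf⟩ := hr (AddMonoidAlgebra.single a 1)
  have := congrArg (fun D : lieAlg K O => D.1.ofConv f) e
  change h.1.ofConv (r f) = h'.1.ofConv (r f) at this
  rw [hf] at this
  exact this

end TorusLemmas

end

/-! ### Identities in characteristic `p` and generation of enveloping algebras. -/

section

lemma sub_pow_char_of_algebra (K : Type u) [Field K] (p : ℕ) [Fact p.Prime] [CharP K p]
    {A : Type v} [Ring A] [Algebra K A] {a b : A} (h : Commute a b) :
    (a - b) ^ p = a ^ p - b ^ p := by
  rcases subsingleton_or_nontrivial A with _ | _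
  · exact Subsingleton.elim _ _
  · have : CharP A p := charP_of_injective_algebraMap (algebraMap K A).injective p
    exact sub_pow_char_of_commute p h

/-- Left and right multiplication by `a` commute, so in characteristic `p` the `p`-th power of `ad
a` is `ad (a ^ p)`. -/
lemma mulLeft_sub_mulRight_pow_char (K : Type u) [Field K] (p : ℕ) [Fact p.Prime] [CharP K p]
    {A : Type v} [Ring A] [Algebra K A] (a b : A) :
    ((LinearMap.mulLeft K a - LinearMap.mulRight K a : Module.End K A) ^ p) b =
      a ^ p * b - b * a ^ p := by
  rw [sub_pow_char_of_algebra K p (LinearMap.commute_mulLeft_right a a),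
    LinearMap.pow_mulLeft, LinearMap.pow_mulRight]
  rfl

/-- `U(L)` is generated by `L`. -/
lemma subalgebra_eq_top_of_ι_mem {K : Type u} [CommRing K] {L : Type v} [LieRing L] [LieAlgebra K L]
    (B : Subalgebra K (UniversalEnvelopingAlgebra K L))
    (hB : ∀ x, UniversalEnvelopingAlgebra.ι K x ∈ B) : B = ⊤ := by
  let f : L →ₗ⁅K⁆ B :=
    { toFun := fun x => ⟨UniversalEnvelopingAlgebra.ι K x, hB x⟩
      map_add' := fun x y => Subtype.ext (map_add _ x y)
      map_smul' := fun c x => Subtype.ext (map_smul _ c x)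
      map_lie' := fun {x y} => Subtype.ext (LieHom.map_lie _ x y) }
  have h : B.val.comp (UniversalEnvelopingAlgebra.lift K f) = AlgHom.id K _ := by
    apply UniversalEnvelopingAlgebra.hom_ext
    ext x
    simp [f]
  rw [eq_top_iff]
  intro y _
  have := AlgHom.congr_fun h y
  rw [AlgHom.comp_apply] at this
  change _ = y at this
  rw [← this]
  exact (UniversalEnvelopingAlgebra.lift K f y).2

/-! ### Root spaces, heights, and centrality of the `p`-th powers of root vectors. -/

namespace Setting

variable {K : Type u} [Field K] {p : ℕ} {O : Type v} [CommRing O] [HopfAlgebra K O]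
variable {X : Type w} [AddCommGroup X] (S : Setting K p O X)

/-- The weight of an element of the basis of `𝔤`. -/
def idxWt : S.R ⊕ Fin (Module.finrank ℤ X) → X := Sum.elim Subtype.val fun _ => 0

lemma basis_mem (b) : S.basis b ∈ weightSpace S.torus (S.idxWt b) := by
  rcases b with α | i
  · exact S.basis_root α
  · obtain ⟨h, hh⟩ := S.basis_cartan i
    rw [hh]
    exact lieMap_mem_weightSpace _ h

lemma e_mem (α : S.R) : S.e α ∈ weightSpace S.torus α.1 := S.basis_root α

/-- Choose a torus point `t` separating the two weights. `Ad(t)` is diagonal in the basis, and `x`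
is an eigenvector for a different eigenvalue than the one at `b`. -/
lemma repr_eq_zero [Infinite K] [Module.Free ℤ X] {γ : X} {x : lieAlg K O}
    (hx : x ∈ weightSpace S.torus γ) {b} (hb : S.idxWt b ≠ γ) : S.basis.repr x b = 0 := by
  obtain ⟨t, ht⟩ := exists_charValue_ne (K := K) hb
  let T : lieAlg K O →ₗ[K] lieAlg K O :=
    S.basis.constr K fun b => charValue (S.idxWt b) t • S.basis b
  have h1 : (LinearMap.mulRight K ((torPoint S.torus t)⁻¹).toDual ∘ₗ
      LinearMap.mulLeft K (torPoint S.torus t).toDual) ∘ₗ (lieAlg K O).toSubmodule.subtype =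
      (lieAlg K O).toSubmodule.subtype ∘ₗ T := by
    apply S.basis.ext
    intro b
    change (torPoint S.torus t).toDual * (S.basis b).1 * ((torPoint S.torus t)⁻¹).toDual =
      (T (S.basis b)).1
    rw [S.basis_mem b t, Module.Basis.constr_basis]
    rfl
  have h2 : T x = charValue γ t • x := by
    apply Subtype.ext
    have := LinearMap.congr_fun h1 x
    exact this.symm.trans (hx t)
  have h3 : (Finsupp.lapply b ∘ₗ S.basis.repr.toLinearMap) ∘ₗ T =
      charValue (S.idxWt b) t • (Finsupp.lapply b ∘ₗ S.basis.repr.toLinearMap) := by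
    apply S.basis.ext
    intro b'
    by_cases hbb : b' = b
    · subst hbb; simp [T]
    · simp [T, hbb]
  have h4 := LinearMap.congr_fun h3 x
  simp only [LinearMap.comp_apply, h2, map_smul, LinearMap.smul_apply, smul_eq_mul] at h4
  by_contra hne
  exact ht (mul_right_cancel₀ hne h4).symm

/-- Root spaces are lines, because the basis contains exactly one vector for each root and the
remaining ones have weight `0`. -/
lemma eq_smul_e [Infinite K] [Module.Free ℤ X] {α : S.R} {x : lieAlg K O}
    (hx : x ∈ weightSpace S.torus α.1) : x = S.basis.repr x (Sum.inl α) • S.e α := by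
  apply S.basis.repr.injective
  ext b
  by_cases hb : b = Sum.inl α
  · subst hb; simp [e]
  · rw [S.repr_eq_zero hx]
    · simp [e, Ne.symm hb]
    · rcases b with β | i
      · exact fun h => hb (congrArg _ (Subtype.ext h))
      · exact fun h => α.2.1 h.symm

lemma eq_zero_of_not_root {γ : X} (h0 : γ ≠ 0) (hγ : γ ∉ S.R) {x : lieAlg K O}
    (hx : x ∈ weightSpace S.torus γ) : x = 0 := by
  by_contra hne
  exact hγ ⟨h0, fun h => hne (by rw [h] at hx; exact hx)⟩

/-- `Lie(B)` meets the line `𝔤_α` non-trivially, hence contains it. -/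
lemma e_mem_borel [Infinite K] [Module.Free ℤ X] {α : S.R} (hα : α.1 ∈ S.pos) :
    S.e α ∈ lieOf S.borel := by
  obtain ⟨x, hx, hne⟩ := Submodule.exists_mem_ne_zero_of_ne_bot hα.2
  have h1 := S.eq_smul_e hx.1
  have hc : S.basis.repr x (Sum.inl α) ≠ 0 := fun h => hne (by rw [h1, h, zero_smul])
  have h2 : S.e α = (S.basis.repr x (Sum.inl α))⁻¹ • x := by
    conv_rhs => rw [h1]
    rw [map_smul, Finsupp.smul_apply, smul_smul]
    simp [e, hc]
  rw [h2]
  exact Submodule.smul_mem _ _ hx.2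

/-- Prescribe the value `1` on the independent set of simple roots. Their span need not be a direct
summand of `X`, so the extension uses that `ℚ` is divisible. -/
lemma exists_height : ∃ f : X →ₗ[ℤ] ℚ, ∀ s ∈ S.simple, f s = 1 := by
  let b := Module.Basis.span S.simple_indep
  let g : Submodule.span ℤ (Set.range fun s : S.simple => id s.1) →ₗ[ℤ] ℚ :=
    b.constr ℤ fun _ => 1
  obtain ⟨f, hf⟩ := (Module.Baer.of_divisible ℚ).extension_property
    (Submodule.subtype _) Subtype.val_injective g
  refine ⟨f, fun s hs => ?_⟩
  have h1 : (b ⟨s, hs⟩ : X) = s :=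
    congrArg Subtype.val (Module.Basis.span_apply S.simple_indep ⟨s, hs⟩)
  have h2 := LinearMap.congr_fun hf (b ⟨s, hs⟩)
  simp only [LinearMap.comp_apply, Submodule.subtype_apply, h1] at h2
  rw [h2]
  simp [g]

/-- The height, a linear function with value `1` on all simple roots. -/
def ht : X →ₗ[ℤ] ℚ := S.exists_height.choose

lemma ht_simple {s : X} (hs : s ∈ S.simple) : S.ht s = 1 := S.exists_height.choose_spec s hs

lemma one_le_ht {α : X} (hα : α ∈ S.pos) : 1 ≤ S.ht α := by
  have : ∀ a ∈ AddSubmonoid.closure S.simple, a = 0 ∨ 1 ≤ S.ht a := by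
    intro a ha
    induction ha using AddSubmonoid.closure_induction with
    | mem s hs => exact Or.inr (S.ht_simple hs).ge
    | zero => exact Or.inl rfl
    | add a b _ _ iha ihb =>
      rcases iha with rfl | iha
      · rwa [zero_add]
      · rcases ihb with rfl | ihb
        · rw [add_zero]; exact Or.inr iha
        · right; rw [map_add]; linarith
  exact (this α (S.pos_sum α hα)).resolve_left hα.1

lemma ht_le_neg_one {α : X} (hα : α ∈ S.R) (h : α ∉ S.pos) : S.ht α ≤ -1 := by
  have := S.one_le_ht ((S.pos_or_neg α hα).resolve_left h)
  rw [map_neg] at this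
  linarith

lemma mem_pos_iff {α : X} (hα : α ∈ S.R) : α ∈ S.pos ↔ 0 < S.ht α := by
  constructor
  · intro h
    linarith [S.one_le_ht h]
  · intro h
    by_contra hn
    linarith [S.ht_le_neg_one hα hn]

lemma exists_finsupp_of_mem_closure {α : X} (hα : α ∈ AddSubmonoid.closure S.simple) :
    ∃ c : S.simple →₀ ℕ, (c.sum fun β n => n • β.1) = α := by
  induction hα using AddSubmonoid.closure_induction with
  | mem s hs => exact ⟨Finsupp.single ⟨s, hs⟩ 1, by simp⟩
  | zero => exact ⟨0, by simp⟩
  | add a b _ _ iha ihb =>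
    obtain ⟨c, hc⟩ := iha
    obtain ⟨d, hd⟩ := ihb
    refine ⟨c + d, ?_⟩
    rw [Finsupp.sum_add_index' (by simp) (by intros; rw [add_smul]), hc, hd]

/-- All coefficients of `p • α` in the simple roots are divisible by `p`; goodness makes them
vanish, and `0` is not a root. -/
lemma IsGood.nsmul_not_pos {S : Setting K p O X} (hp : S.IsGood) {α : X} (hα : α ∈ S.pos) :
    p • α ∉ S.pos := by
  intro h
  obtain ⟨c, hc⟩ := S.exists_finsupp_of_mem_closure (S.pos_sum α hα)
  have hs : ((p • c).sum fun β n => n • β.1) = p • α := by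
    rw [Finsupp.sum_smul_index' (by simp), ← hc, Finsupp.smul_sum]
    exact Finsupp.sum_congr fun _ _ => by rw [smul_assoc]
  have h1 := hp (p • c) (by rw [hs]; exact h)
  have h2 : p • c = 0 := Finsupp.ext fun β => h1 β ⟨c β, by simp⟩
  rw [h2, Finsupp.sum_zero_index] at hs
  exact h.1 hs.symm

lemma IsGood.nsmul_not_root {S : Setting K p O X} (hp : S.IsGood) (hp0 : 0 < p) {α : X}
    (hα : α ∈ S.R) : p • α ∉ S.R := by
  intro h
  have hp0' : (0 : ℚ) < p := by exact_mod_cast hp0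
  rcases S.pos_or_neg _ hα with h1 | h1
  · refine hp.nsmul_not_pos h1 ((S.mem_pos_iff h).mpr ?_)
    rw [map_nsmul, nsmul_eq_mul]
    have := S.one_le_ht h1
    positivity
  · refine hp.nsmul_not_pos h1 ?_
    rw [smul_neg]
    refine (S.pos_or_neg _ h).resolve_left fun h2 => ?_
    have h3 := S.one_le_ht h2
    have h4 := S.one_le_ht h1
    rw [map_nsmul, nsmul_eq_mul] at h3
    rw [map_neg] at h4
    nlinarith

/-- The `p`-th power has weight `p • α`, which is non-zero by its height and not a root by goodness.
This is the sole purpose of goodness in the proof. -/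
lemma e_pow_eq_zero [Infinite K] [Fact p.Prime] [CharP K p] (hp : S.IsGood) (α : S.R) :
    (S.e α).1 ^ p = 0 := by
  have hp0 := (Fact.out : p.Prime).pos
  have h1 := pow_mem_weightSpace S.torus p (S.e_mem α)
  have hne : p • α.1 ≠ 0 := by
    intro h
    have := congrArg S.ht h
    rw [map_nsmul, nsmul_eq_mul, map_zero, mul_eq_zero] at this
    rcases this with h | h
    · exact hp0.ne' (by exact_mod_cast h)
    · rcases S.pos_or_neg _ α.2 with h2 | h2
      · linarith [S.one_le_ht h2]
      · have := S.one_le_ht h2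
        rw [map_neg] at this
        linarith
  exact congrArg Subtype.val (S.eq_zero_of_not_root hne (hp.nsmul_not_root hp0 α.2) h1)

lemma ad_e_pow [Infinite K] [Fact p.Prime] [CharP K p] (hp : S.IsGood) (α : S.R)
    (x : lieAlg K O) : ((LieAlgebra.ad K (lieAlg K O) (S.e α)) ^ p) x = 0 := by
  have h : ∀ n, (((LieAlgebra.ad K (lieAlg K O) (S.e α)) ^ n) x).1 =
      ((LinearMap.mulLeft K (S.e α).1 - LinearMap.mulRight K (S.e α).1 :
        Module.End K (ConvDual K O)) ^ n) x.1 := by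
    intro n
    induction n with
    | zero => rfl
    | succ n ih =>
      rw [pow_succ', pow_succ', Module.End.mul_apply, Module.End.mul_apply, ← ih]
      rfl
  apply Subtype.ext
  rw [h, mulLeft_sub_mulRight_pow_char K, S.e_pow_eq_zero hp, zero_mul, mul_zero, sub_zero]
  rfl

/-- The elements `e_α ^ p` are central in `U(𝔤)`. -/
lemma commute_ι_e_pow [Infinite K] [Fact p.Prime] [CharP K p] (hp : S.IsGood) (α : S.R)
    (y : UniversalEnvelopingAlgebra K (lieAlg K O)) :
    Commute (UniversalEnvelopingAlgebra.ι K (S.e α) ^ p) y := by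
  have h : ∀ (x : lieAlg K O) (n),
      UniversalEnvelopingAlgebra.ι K (((LieAlgebra.ad K (lieAlg K O) (S.e α)) ^ n) x) =
      ((LinearMap.mulLeft K (UniversalEnvelopingAlgebra.ι K (S.e α)) -
        LinearMap.mulRight K (UniversalEnvelopingAlgebra.ι K (S.e α)) :
        Module.End K (UniversalEnvelopingAlgebra K (lieAlg K O))) ^ n)
          (UniversalEnvelopingAlgebra.ι K x) := by
    intro x n
    induction n with
    | zero => rfl
    | succ n ih =>
      rw [pow_succ', pow_succ', Module.End.mul_apply, Module.End.mul_apply, ← ih,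
        LieAlgebra.ad_apply, LieHom.map_lie]
      rfl
  -- It suffices to commute with `ι x`; that commutator is the image of `ad(e_α)^p x`, which is
  -- zero.
  have htop := subalgebra_eq_top_of_ι_mem
    (Subalgebra.centralizer K {UniversalEnvelopingAlgebra.ι K (S.e α) ^ p}) fun x => by
      rw [Subalgebra.mem_centralizer_iff]
      rintro _ rfl
      rw [← sub_eq_zero, ← mulLeft_sub_mulRight_pow_char K, ← h, S.ad_e_pow hp, map_zero]
  have hy : y ∈ Subalgebra.centralizer K {UniversalEnvelopingAlgebra.ι K (S.e α) ^ p} := by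
    rw [htop]; trivial
  exact Subalgebra.mem_centralizer_iff K |>.mp hy _ rfl

end Setting

end

section

/-! ### Lie algebras which are the sum of two subalgebras -/

section Whittaker

open UniversalEnvelopingAlgebra

variable {K : Type u} [Field K] {L : Type v} [LieRing L] [LieAlgebra K L]

/-- A subspace of `U(L)` which contains `1` and is stable under left multiplication by `L` is
everything. -/
lemma submodule_eq_top_of_ι_mul_mem (N : Submodule K (UniversalEnvelopingAlgebra K L)) (h1 : 1 ∈ N)
    (hN : ∀ x, ∀ u ∈ N, ι K x * u ∈ N) : N = ⊤ := by
  let B : Subalgebra K (UniversalEnvelopingAlgebra K L) :=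
    { carrier := {a | ∀ u ∈ N, a * u ∈ N}
      mul_mem' := fun {a b} ha hb u hu => by rw [mul_assoc]; exact ha _ (hb _ hu)
      add_mem' := fun {a b} ha hb u hu => by rw [add_mul]; exact N.add_mem (ha _ hu) (hb _ hu)
      algebraMap_mem' := fun c u hu => by
        rw [← Algebra.smul_def]; exact N.smul_mem _ hu }
  have hB := subalgebra_eq_top_of_ι_mem B hN
  rw [eq_top_iff]
  intro y _
  have hy : y ∈ B := by rw [hB]; trivial
  simpa using hy 1 h1

variable (n : LieSubalgebra K L) (pn : L →ₗ[K] n) (F : Type w) [Field F] [Algebra K F]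

/-- The complementary projection. -/
def coproj : L →ₗ[K] L := LinearMap.id - n.toSubmodule.subtype ∘ₗ pn

lemma coproj_apply (x : L) : coproj n pn x = x - pn x := rfl

/-- Left multiplication on `F ⊗ U(𝔫)`. -/
def lmulBase : UniversalEnvelopingAlgebra K n →ₐ[K]
    Module.End F (F ⊗[K] UniversalEnvelopingAlgebra K n) :=
  (Module.End.baseChangeHom K F (UniversalEnvelopingAlgebra K n)).comp
    (Algebra.lmul K (UniversalEnvelopingAlgebra K n))

lemma lmulBase_tmul (u : UniversalEnvelopingAlgebra K n) (a : F)
    (v : UniversalEnvelopingAlgebra K n) :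
    lmulBase n F u (a ⊗ₜ v) = a ⊗ₜ (u * v) := rfl

/-- The action of `x ∈ 𝔫` on `(F ⊗ U(𝔫)) × Hom(L, F ⊗ U(𝔫))` which prolongs left multiplication. -/
def prolong (x : n) : Module.End K ((F ⊗[K] UniversalEnvelopingAlgebra K n) ×
    (L →ₗ[K] F ⊗[K] UniversalEnvelopingAlgebra K n)) where
  toFun z := (lmulBase n F (ι K x) z.1,
    -- In an induced module `y(xu) = x(yu) + [y,x]u`, and `[y,x]` splits into a part in `𝔫` and a
    -- part in the complement. The second component stores `yu` for all `y` at once, because the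
    -- rule for one `y` calls for the values at others.
    { toFun := fun y => lmulBase n F (ι K x) (z.2 y) +
        lmulBase n F (ι K (pn ⁅coproj n pn y, (x : L)⁆)) z.1 +
        z.2 (coproj n pn ⁅coproj n pn y, (x : L)⁆)
      map_add' := fun y y' => by simp only [map_add, add_lie, LinearMap.add_apply]; abel
      map_smul' := fun c y => by simp [smul_add] })
  map_add' z z' := by
    ext y
    · simp
    · simp only [Prod.fst_add, Prod.snd_add, LinearMap.add_apply, map_add, LinearMap.coe_mk,
        AddHom.coe_mk]
      abel
  map_smul' c z := by
    ext y
    · simp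
    · simp [smul_add]

lemma prolong_fst (x : n) (z) : (prolong n pn F x z).1 = lmulBase n F (ι K x) z.1 := rfl

lemma prolong_snd (x : n) (z) (y : L) : (prolong n pn F x z).2 y =
    lmulBase n F (ι K x) (z.2 y) + lmulBase n F (ι K (pn ⁅coproj n pn y, (x : L)⁆)) z.1 +
        z.2 (coproj n pn ⁅coproj n pn y, (x : L)⁆) := rfl

variable {pn}

lemma coproj_coe (hn : ∀ x : n, pn x = x) (x : n) : coproj n pn x = 0 := by
  rw [coproj_apply, hn, sub_self]

lemma pn_coproj (hn : ∀ x : n, pn x = x) (x : L) : pn (coproj n pn x) = 0 := by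
  rw [coproj_apply, map_sub, hn, sub_self]

lemma coproj_coproj (hn : ∀ x : n, pn x = x) (x : L) :
    coproj n pn (coproj n pn x) = coproj n pn x := by
  rw [coproj_apply n pn (coproj n pn x), pn_coproj n hn]
  simp

lemma decomp (x : L) : x = pn x + coproj n pn x := by
  rw [coproj_apply]; abel

/-- The prolonged action is an action of the Lie algebra `𝔫`. -/
def prolongHom (hn : ∀ x : n, pn x = x) : n →ₗ⁅K⁆ Module.End K
    ((F ⊗[K] UniversalEnvelopingAlgebra K n) ×
      (L →ₗ[K] F ⊗[K] UniversalEnvelopingAlgebra K n)) where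
  toFun := prolong n pn F
  map_add' x y := by
    refine LinearMap.ext fun z => Prod.ext ?_ (LinearMap.ext fun q => ?_)
    · simp [prolong_fst]
    · simp only [LinearMap.add_apply, Prod.snd_add, prolong_snd, map_add,
        AddMemClass.coe_add, lie_add]
      abel
  map_smul' c x := by
    refine LinearMap.ext fun z => Prod.ext ?_ (LinearMap.ext fun q => ?_)
    · simp [prolong_fst]
    · simp [prolong_snd, smul_add]
  map_lie' := by
    intro x x'
    refine LinearMap.ext fun z => ?_
    rw [LieRing.of_associative_ring_bracket, LinearMap.sub_apply, Module.End.mul_apply,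
      Module.End.mul_apply]
    refine Prod.ext ?_ (LinearMap.ext fun y => ?_)
    · rw [Prod.fst_sub]
      simp only [prolong_fst]
      rw [LieHom.map_lie, LieRing.of_associative_ring_bracket, map_sub, map_mul, map_mul]
      rfl
    · rw [Prod.snd_sub, LinearMap.sub_apply]
      simp only [prolong_snd, prolong_fst, coproj_coproj n hn]
      set q := coproj n pn y
      -- The compatibility with brackets is the Jacobi identity for `q, x, x'`, projected to `𝔫` in
      -- `h1` and to the complement in `h2`.
      have hJ : ⁅q, ((⁅x, x'⁆ : n) : L)⁆ = ⁅⁅q, (x : L)⁆, (x' : L)⁆ - ⁅⁅q, (x' : L)⁆, (x : L)⁆ := by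
        rw [LieSubalgebra.coe_bracket, leibniz_lie q, ← lie_skew (x : L) ⁅q, (x' : L)⁆]
        abel
      have hd : ∀ (x x' : n), ⁅⁅q, (x : L)⁆, (x' : L)⁆ =
          ((⁅pn ⁅q, (x : L)⁆, x'⁆ : n) : L) + ⁅coproj n pn ⁅q, (x : L)⁆, (x' : L)⁆ := by
        intro x x'
        conv_lhs => rw [decomp n (pn := pn) ⁅q, (x : L)⁆, add_lie]
        rfl
      have h1 : pn ⁅q, ((⁅x, x'⁆ : n) : L)⁆ = ⁅pn ⁅q, (x : L)⁆, x'⁆ - ⁅pn ⁅q, (x' : L)⁆, x⁆ +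
          pn ⁅coproj n pn ⁅q, (x : L)⁆, (x' : L)⁆ - pn ⁅coproj n pn ⁅q, (x' : L)⁆, (x : L)⁆ := by
        rw [hJ, hd, hd, map_sub, map_add, map_add, hn, hn]
        abel
      have h2 : coproj n pn ⁅q, ((⁅x, x'⁆ : n) : L)⁆ =
          coproj n pn ⁅coproj n pn ⁅q, (x : L)⁆, (x' : L)⁆ -
            coproj n pn ⁅coproj n pn ⁅q, (x' : L)⁆, (x : L)⁆ := by
        rw [hJ, hd, hd, map_sub, map_add, map_add, coproj_coe n hn, coproj_coe n hn]
        abel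
      rw [h1, h2]
      simp only [map_add, map_sub, LieHom.map_lie, LieRing.of_associative_ring_bracket, map_mul,
        LinearMap.add_apply, LinearMap.sub_apply, Module.End.mul_apply]
      abel

variable {F}
variable (hn : ∀ x : n, pn x = x) (lam : L →ₗ[K] F)

/-- The orbit map of the vector `(1, lam)` under the prolonged action. -/
def orbitMap : UniversalEnvelopingAlgebra K n →ₗ[K] ((F ⊗[K] UniversalEnvelopingAlgebra K n) ×
    (L →ₗ[K] F ⊗[K] UniversalEnvelopingAlgebra K n)) :=
  LinearMap.applyₗ
    ((1 ⊗ₜ 1, (TensorProduct.mk K F (UniversalEnvelopingAlgebra K n)).flip 1 ∘ₗ lam) :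
    (F ⊗[K] UniversalEnvelopingAlgebra K n) × (L →ₗ[K] F ⊗[K] UniversalEnvelopingAlgebra K n)) ∘ₗ
    (lift K (prolongHom n F hn)).toLinearMap

lemma orbitMap_one : orbitMap n hn lam 1 =
    (1 ⊗ₜ 1, (TensorProduct.mk K F (UniversalEnvelopingAlgebra K n)).flip 1 ∘ₗ lam) := by
  simp [orbitMap]

lemma orbitMap_mul (x : n) (u : UniversalEnvelopingAlgebra K n) :
    orbitMap n hn lam (ι K x * u) = prolong n pn F x (orbitMap n hn lam u) := by
  simp [orbitMap]
  rfl

/-- The first component moves by left multiplication and starts at `1 ⊗ 1`. Hence the second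
component at `u` may be read as the map `y ↦ y(1 ⊗ u)`. -/
lemma orbitMap_fst (u : UniversalEnvelopingAlgebra K n) :
    (orbitMap n hn lam u).1 = (1 : F) ⊗ₜ u := by
  have h := submodule_eq_top_of_ι_mul_mem
    (LinearMap.eqLocus (LinearMap.fst K _ _ ∘ₗ orbitMap n hn lam)
      (TensorProduct.mk K F (UniversalEnvelopingAlgebra K n) 1)) (by
        change (orbitMap n hn lam 1).1 = _
        rw [orbitMap_one]; rfl)
    (fun x u hu => by
      change (orbitMap n hn lam u).1 = _ at hu
      change (orbitMap n hn lam (ι K x * u)).1 = _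
      rw [orbitMap_mul, prolong_fst, hu]
      rfl)
  have hu : u ∈ (⊤ : Submodule K (UniversalEnvelopingAlgebra K n)) := trivial
  rw [← h] at hu
  exact hu

/-- The action of a complement of `𝔫` on `F ⊗ U(𝔫)`. -/
def complAct : L →ₗ[K] Module.End F (F ⊗[K] UniversalEnvelopingAlgebra K n) where
  toFun y := LinearMap.liftBaseChange F
    (LinearMap.applyₗ y ∘ₗ LinearMap.snd K _ _ ∘ₗ orbitMap n hn lam)
  map_add' y y' := by
    ext u
    simp
  map_smul' c y := by
    ext u
    simp

lemma complAct_tmul (y : L) (a : F) (u : UniversalEnvelopingAlgebra K n) :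
    complAct n hn lam y (a ⊗ₜ u) = a • (orbitMap n hn lam u).2 y := by
  simp [complAct]

lemma complAct_one (y : L) : complAct n hn lam y (1 ⊗ₜ 1) = lam y ⊗ₜ 1 := by
  rw [complAct_tmul, one_smul, orbitMap_one]
  rfl

/-- The action of `L` on `F ⊗ U(𝔫)`. -/
def indAct : L →ₗ[K] Module.End F (F ⊗[K] UniversalEnvelopingAlgebra K n) :=
  (lmulBase n F).toLinearMap ∘ₗ (ι K : n →ₗ⁅K⁆ _).toLinearMap ∘ₗ pn +
    complAct n hn lam ∘ₗ coproj n pn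

lemma indAct_apply (z : L) : indAct n hn lam z =
    lmulBase n F (ι K (pn z)) + complAct n hn lam (coproj n pn z) := rfl

/-- True by construction: `prolong` was defined by exactly this commutation rule. -/
lemma complAct_lie_lmul (y : L) (x : n) :
    ⁅complAct n hn lam y, lmulBase n F (ι K x)⁆ = indAct n hn lam ⁅coproj n pn y, (x : L)⁆ := by
  rw [LieRing.of_associative_ring_bracket, sub_eq_iff_eq_add]
  ext u
  simp only [TensorProduct.AlgebraTensorModule.curry_apply, TensorProduct.curry_apply,
    LinearMap.coe_restrictScalars]
  rw [LinearMap.add_apply, indAct_apply, LinearMap.add_apply, Module.End.mul_apply,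
    Module.End.mul_apply, lmulBase_tmul, complAct_tmul, complAct_tmul, complAct_tmul, orbitMap_mul,
    prolong_snd, orbitMap_fst, one_smul, one_smul, one_smul]
  abel

lemma coproj_lie_coproj (hb : ∀ x y : L, pn ⁅coproj n pn x, coproj n pn y⁆ = 0) (x y : L) :
    coproj n pn ⁅coproj n pn x, coproj n pn y⁆ = ⁅coproj n pn x, coproj n pn y⁆ := by
  rw [coproj_apply n pn ⁅_, _⁆, hb]
  simp

/-- Let `E` be the defect of the relation. It kills `1 ⊗ 1`, because `lam` vanishes on brackets of
the complement and `F` is commutative. Its commutator with `𝔫` is expressed by values of `E` at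
other arguments (`hmul`), so the vanishing spreads along words in `𝔫`, for all arguments
simultaneously. -/
lemma complAct_lie_complAct (hb : ∀ x y : L, pn ⁅coproj n pn x, coproj n pn y⁆ = 0)
    (hlam : ∀ x y : L, lam ⁅coproj n pn x, coproj n pn y⁆ = 0) (y y' : L) :
    ⁅complAct n hn lam (coproj n pn y), complAct n hn lam (coproj n pn y')⁆ =
      indAct n hn lam ⁅coproj n pn y, coproj n pn y'⁆ := by
  let E : L → L → Module.End F (F ⊗[K] UniversalEnvelopingAlgebra K n) := fun y y' =>
    ⁅complAct n hn lam (coproj n pn y), complAct n hn lam (coproj n pn y')⁆ -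
      indAct n hn lam ⁅coproj n pn y, coproj n pn y'⁆
  have hone : ∀ y y', E y y' (1 ⊗ₜ 1) = 0 := by
    intro y y'
    have hs : ∀ (a : F) (z : L), complAct n hn lam z (a ⊗ₜ 1) = (a * lam z) ⊗ₜ 1 := by
      intro a z
      rw [complAct_tmul, orbitMap_one]
      simp [TensorProduct.smul_tmul']
    simp only [E, LieRing.of_associative_ring_bracket, LinearMap.sub_apply, Module.End.mul_apply,
      indAct_apply, hb, coproj_lie_coproj n hb, map_zero, zero_add, hs, hlam, mul_zero,
      TensorProduct.zero_tmul, sub_zero]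
    rw [mul_right_comm, sub_self]
  have hmul : ∀ y y' (x : n), E y y' * lmulBase n F (ι K x) =
      lmulBase n F (ι K x) * E y y' + E y ⁅coproj n pn y', (x : L)⁆ -
        E y' ⁅coproj n pn y, (x : L)⁆ := by
    intro y y' x
    -- The bracket relation is known against `𝔫`; against the complement it holds up to the defect.
    have hR : ∀ a z : L, ⁅complAct n hn lam (coproj n pn a), indAct n hn lam z⁆ =
        indAct n hn lam ⁅coproj n pn a, z⁆ + E a z := by
      intro a z
      rw [indAct_apply n hn lam z, lie_add, complAct_lie_lmul, coproj_coproj n hn]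
      conv_rhs => rw [decomp n (pn := pn) z, lie_add, map_add]
      simp only [E, ← decomp n (pn := pn) z]
      abel
    have h1 : ⁅E y y', lmulBase n F (ι K x)⁆ =
        E y ⁅coproj n pn y', (x : L)⁆ - E y' ⁅coproj n pn y, (x : L)⁆ := by
      have hw : indAct n hn lam ⁅coproj n pn y, coproj n pn y'⁆ =
          complAct n hn lam ⁅coproj n pn y, coproj n pn y'⁆ := by
        rw [indAct_apply, hb, coproj_lie_coproj n hb, map_zero, map_zero, zero_add]
      rw [show E y y' = ⁅complAct n hn lam (coproj n pn y), complAct n hn lam (coproj n pn y')⁆ -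
        indAct n hn lam ⁅coproj n pn y, coproj n pn y'⁆ from rfl, sub_lie, hw, complAct_lie_lmul,
        coproj_lie_coproj n hb, lie_lie, complAct_lie_lmul, complAct_lie_lmul, coproj_coproj n hn,
        coproj_coproj n hn, hR, hR, lie_lie, map_sub]
      abel
    rw [LieRing.of_associative_ring_bracket, sub_eq_iff_eq_add] at h1
    rw [h1]
    abel
  have hall : ∀ u : UniversalEnvelopingAlgebra K n, ∀ y y', E y y' (1 ⊗ₜ u) = 0 := by
    have h := submodule_eq_top_of_ι_mul_mem
      (⨅ y, ⨅ y', LinearMap.ker ((E y y').restrictScalars K ∘ₗ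
        TensorProduct.mk K F (UniversalEnvelopingAlgebra K n) 1)) (by
          simp only [Submodule.mem_iInf]
          exact hone)
      (fun x u hu => by
        simp only [Submodule.mem_iInf] at hu ⊢
        intro y y'
        have hu' : ∀ y y', E y y' (1 ⊗ₜ u) = 0 := hu
        change (E y y' * lmulBase n F (ι K x)) (1 ⊗ₜ u) = 0
        rw [hmul, LinearMap.sub_apply, LinearMap.add_apply, Module.End.mul_apply, hu', hu', hu',
          map_zero, add_zero, sub_zero])
    intro u
    have hu : u ∈ (⊤ : Submodule K (UniversalEnvelopingAlgebra K n)) := trivial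
    rw [← h] at hu
    simp only [Submodule.mem_iInf] at hu
    exact hu
  rw [← sub_eq_zero]
  change E y y' = 0
  ext u
  exact hall u y y'

/-- The action of `L` on `F ⊗ U(𝔫)`, as a homomorphism of Lie algebras. -/
def indHom (hb : ∀ x y : L, pn ⁅coproj n pn x, coproj n pn y⁆ = 0)
    (hlam : ∀ x y : L, lam ⁅coproj n pn x, coproj n pn y⁆ = 0) :
    L →ₗ⁅K⁆ Module.End F (F ⊗[K] UniversalEnvelopingAlgebra K n) :=
  { indAct n hn lam with
    map_lie' := by
      intro z z'
      change indAct n hn lam ⁅z, z'⁆ = ⁅indAct n hn lam z, indAct n hn lam z'⁆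
      have hnn : ∀ x x' : n, ⁅lmulBase n F (ι K x), lmulBase n F (ι K x')⁆ =
          indAct n hn lam ⁅(x : L), (x' : L)⁆ := by
        intro x x'
        rw [← LieSubalgebra.coe_bracket, indAct_apply, hn, coproj_coe n hn, map_zero, add_zero,
          LieHom.map_lie, LieRing.of_associative_ring_bracket, LieRing.of_associative_ring_bracket,
          map_sub, map_mul, map_mul]
      conv_lhs => rw [decomp n (pn := pn) z, decomp n (pn := pn) z']
      rw [indAct_apply n hn lam z, indAct_apply n hn lam z']
      simp only [add_lie, lie_add, map_add]
      rw [hnn, complAct_lie_lmul, complAct_lie_complAct n hn lam hb hlam,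
        ← lie_skew (lmulBase n F (ι K (pn z))), complAct_lie_lmul, coproj_coproj n hn,
        coproj_coproj n hn, ← map_neg, lie_skew] }

/-- A Lie algebra `L = 𝔫 + 𝔟` with characters `chi` of `𝔫` and `lam` of `𝔟` has a functional on
`U(L)` on which `𝔫` acts from the left by `chi` and `𝔟` acts from the right by `lam`. -/
theorem exists_whittaker_functional (hn : ∀ x : n, pn x = x) (lam : L →ₗ[K] F)
    (hb : ∀ x y : L, pn ⁅coproj n pn x, coproj n pn y⁆ = 0)
    (hlam : ∀ x y : L, lam ⁅coproj n pn x, coproj n pn y⁆ = 0)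
    (chi : n →ₗ[K] K) (hchi : ∀ x y : n, chi ⁅x, y⁆ = 0) :
    ∃ θ : UniversalEnvelopingAlgebra K L →ₗ[K] F, θ 1 = 1 ∧
      (∀ (x : n) u, θ (ι K (x : L) * u) = algebraMap K F (chi x) * θ u) ∧
      ∀ u y, pn y = 0 → θ (u * ι K y) = θ u * lam y := by
  let c : UniversalEnvelopingAlgebra K n →ₐ[K] K := lift K
    { chi with
      map_lie' := fun {x y} => by
        change chi ⁅x, y⁆ = ⁅chi x, chi y⁆
        rw [hchi, LieRing.of_associative_ring_bracket, mul_comm, sub_self] }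
  have hc : ∀ x, c (ι K x) = chi x := fun x => by simp [c]; rfl
  let φ : F ⊗[K] UniversalEnvelopingAlgebra K n →ₗ[F] F :=
    LinearMap.liftBaseChange F (Algebra.linearMap K F ∘ₗ c.toLinearMap)
  let R : UniversalEnvelopingAlgebra K L →ₐ[K]
      Module.End F (F ⊗[K] UniversalEnvelopingAlgebra K n) :=
    lift K (indHom n hn lam hb hlam)
  have hR : ∀ z, R (ι K z) = indAct n hn lam z := fun z => by simp [R]; rfl
  have hφ : ∀ (x : n) m, φ (lmulBase n F (ι K x) m) = algebraMap K F (chi x) * φ m := by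
    intro x m
    induction m using TensorProduct.induction_on with
    | zero => simp
    | tmul a u =>
      rw [lmulBase_tmul]
      simp only [φ, LinearMap.liftBaseChange_tmul, LinearMap.comp_apply, AlgHom.toLinearMap_apply,
        map_mul, hc, Algebra.linearMap_apply, smul_eq_mul]
      ring
    | add a b ha hb => rw [map_add, map_add, ha, hb, map_add, mul_add]
  -- The functional lets `u` act on the cyclic vector `1 ⊗ 1` and then evaluates `U(𝔫)` through
  -- `chi`. Left equivariance comes from `φ`, right equivariance from `1 ⊗ 1` being an eigenvector
  -- of the complement.
  refine ⟨(φ.restrictScalars K) ∘ₗ (LinearMap.applyₗ (1 ⊗ₜ 1)) ∘ₗ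
    (LinearMap.restrictScalarsₗ K F _ _ K) ∘ₗ R.toLinearMap, ?_, ?_, ?_⟩
  · simp [φ]
  · intro x u
    change φ (R _ _) = _ * φ (R _ _)
    rw [map_mul, hR, Module.End.mul_apply, indAct_apply, hn, coproj_coe n hn, map_zero,
      add_zero, hφ]
  · intro u y hy
    change φ (R _ _) = φ (R _ _) * _
    rw [map_mul, hR, Module.End.mul_apply, indAct_apply, hy, map_zero, map_zero, zero_add,
      show coproj n pn y = y by rw [coproj_apply, hy]; simp, complAct_one,
      show lam y ⊗ₜ[K] (1 : UniversalEnvelopingAlgebra K n) = lam y • (1 : F) ⊗ₜ 1 by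
        rw [TensorProduct.smul_tmul', smul_eq_mul, mul_one], map_smul, map_smul, smul_eq_mul,
      mul_comm]

end Whittaker

end

section

namespace Setting

variable {K : Type u} [Field K] {p : ℕ} {O : Type v} [CommRing O] [HopfAlgebra K O]
variable {X : Type w} [AddCommGroup X] (S : Setting K p O X)
variable (χ : Module.Dual K (lieAlg K O)) (I : Set X)

/-! ### The algebra `U_χ` -/

/-- The map `𝔤 → U_χ`. -/
def toUι : lieAlg K O →ₗ[K] S.U χ :=
  (S.toU χ).toLinearMap ∘ₗ (UniversalEnvelopingAlgebra.ι K : lieAlg K O →ₗ⁅K⁆ _).toLinearMap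

lemma toUι_apply (x : lieAlg K O) :
    S.toUι χ x = S.toU χ (UniversalEnvelopingAlgebra.ι K x) := rfl

lemma toUι_e (α : S.R) : S.toUι χ (S.e α) = S.ue χ α := rfl

lemma toUι_lieMap (h : Cartan K X) : S.toUι χ (lieMap S.torus h) = S.uh χ h := by
  simp [uh, u0, toUι_apply]

lemma toUι_lie (x y : lieAlg K O) :
    S.toUι χ ⁅x, y⁆ = S.toUι χ x * S.toUι χ y - S.toUι χ y * S.toUι χ x := by
  rw [toUι_apply, LieHom.map_lie, LieRing.of_associative_ring_bracket, map_sub, map_mul, map_mul]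
  rfl

lemma ue_pow (α : S.R) : S.ue χ α ^ p = algebraMap K _ (χ (S.e α) ^ p) := by
  rw [ue, ← map_pow]
  have := RingQuot.mkAlgHom_rel K (s := S.uRel χ) ⟨α, rfl, rfl⟩
  exact this.trans (AlgHom.commutes _ _)

lemma toU_surjective : Function.Surjective (S.toU χ) := RingQuot.mkAlgHom_surjective K _

lemma span_gen_list : Submodule.span K (Set.range fun l : List (S.R ⊕ Cartan K X) =>
    (l.map (S.gen χ)).prod) = ⊤ := by
  have h1 : (Algebra.adjoin K (Set.range (S.gen χ))).comap (S.toU χ) = ⊤ := by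
    apply subalgebra_eq_top_of_ι_mem
    intro x
    change S.toUι χ x ∈ Subalgebra.toSubmodule (Algebra.adjoin K (Set.range (S.gen χ)))
    rw [← S.basis.linearCombination_repr x, Finsupp.linearCombination_apply, map_finsuppSum]
    refine Submodule.sum_mem _ fun b _ => ?_
    change S.toUι χ (_ • _) ∈ _
    rw [map_smul]
    refine Submodule.smul_mem _ _ (Algebra.subset_adjoin ?_)
    rcases b with α | i
    · exact ⟨Sum.inl α, rfl⟩
    · obtain ⟨h, hh⟩ := S.basis_cartan i
      exact ⟨Sum.inr h, by rw [hh, toUι_lieMap]; rfl⟩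
  have h2 : Algebra.adjoin K (Set.range (S.gen χ)) = ⊤ := by
    rw [eq_top_iff]
    intro y _
    obtain ⟨z, rfl⟩ := S.toU_surjective χ y
    have hz : z ∈ (Algebra.adjoin K (Set.range (S.gen χ))).comap (S.toU χ) := by rw [h1]; trivial
    exact hz
  have h3 := Algebra.adjoin_eq_span K (Set.range (S.gen χ))
  rw [h2, Algebra.top_toSubmodule] at h3
  rw [h3]
  congr 1
  ext y
  constructor
  · rintro ⟨l, rfl⟩
    refine Submonoid.list_prod_mem _ fun z hz => ?_
    obtain ⟨i, -, rfl⟩ := List.mem_map.mp hz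
    exact Submonoid.subset_closure ⟨i, rfl⟩
  · intro hy
    obtain ⟨l, hl, rfl⟩ := Submonoid.exists_list_of_mem_closure hy
    clear hy
    induction l with
    | nil => exact ⟨[], rfl⟩
    | cons a l ih =>
      obtain ⟨m, hm⟩ := ih fun z hz => hl z (List.mem_cons_of_mem _ hz)
      obtain ⟨i, hi⟩ := hl a List.mem_cons_self
      refine ⟨i :: m, ?_⟩
      simp only [List.map_cons, List.prod_cons] at hm ⊢
      rw [hm, hi]

lemma cls_add (a b : X) : S.cls I (a + b) = S.cls I a + S.cls I b := rfl

lemma list_prod_mem_uGr (l : List (S.R ⊕ Cartan K X)) :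
    (l.map (S.gen χ)).prod ∈ S.uGr χ I (l.map (S.genDeg I)).sum :=
  Submodule.subset_span ⟨l, rfl, rfl⟩

lemma iSup_uGr : ⨆ σ, S.uGr χ I σ = ⊤ := by
  rw [eq_top_iff, ← S.span_gen_list χ, Submodule.span_le]
  rintro _ ⟨l, rfl⟩
  exact Submodule.mem_iSup_of_mem _ (S.list_prod_mem_uGr χ I l)

lemma gen_mem_uGr (i) : S.gen χ i ∈ S.uGr χ I (S.genDeg I i) := by
  simpa using S.list_prod_mem_uGr χ I [i]

lemma ue_mem_uGr (α : S.R) : S.ue χ α ∈ S.uGr χ I (S.cls I α.1) := S.gen_mem_uGr χ I (Sum.inl α)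

lemma one_mem_uGr : 1 ∈ S.uGr χ I 0 := by
  simpa using S.list_prod_mem_uGr χ I []

lemma mul_mem_uGr {σ τ : S.XI I} {y z : S.U χ} (hy : y ∈ S.uGr χ I σ) (hz : z ∈ S.uGr χ I τ) :
    y * z ∈ S.uGr χ I (σ + τ) := by
  have h : S.uGr χ I σ * S.uGr χ I τ ≤ S.uGr χ I (σ + τ) := by
    rw [uGr, uGr, Submodule.span_mul_span, Submodule.span_le]
    rintro _ ⟨_, ⟨l, rfl, rfl⟩, _, ⟨m, rfl, rfl⟩, rfl⟩
    have := S.list_prod_mem_uGr χ I (l ++ m)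
    simpa using this
  exact h (Submodule.mul_mem_mul hy hz)

variable {χ I}

lemma chi_e_eq_zero [Infinite K] [Module.Free ℤ X] (hχ : S.IsStandardLevi χ I) {α : S.R}
    (h : -α.1 ∉ I) : χ (S.e α) = 0 := by
  by_cases hα : α.1 ∈ S.pos
  · exact hχ.borel _ (S.e_mem_borel hα)
  · exact hχ.not_mem α ((S.pos_or_neg _ α.2).resolve_left hα) h

/-- This dichotomy makes the relations `e_α ^ p = χ(e_α) ^ p` homogeneous for the grading by `X/ℤI`.
-/
lemma chi_e_eq_zero_or_cls [Infinite K] [Module.Free ℤ X] (hχ : S.IsStandardLevi χ I) (α : S.R) :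
    χ (S.e α) = 0 ∨ S.cls I α.1 = 0 := by
  by_cases h : -α.1 ∈ I
  · right
    rw [QuotientAddGroup.eq_zero_iff, ← neg_mem_iff]
    exact AddSubgroup.subset_closure h
  · exact Or.inl (S.chi_e_eq_zero hχ h)

variable (χ I)

/-- The linear map `𝔤 → U_χ[X/ℤI]` recording the degree. -/
def degLin : lieAlg K O →ₗ[K] AddMonoidAlgebra (S.U χ) (S.XI I) :=
  S.basis.constr K fun b => AddMonoidAlgebra.single (S.cls I (S.idxWt b)) (S.toUι χ (S.basis b))

/-- A weight vector only involves basis vectors of its own weight, so the degree recorded through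
the basis depends on the weight alone. -/
lemma degLin_apply [Infinite K] [Module.Free ℤ X] {γ : X} {x : lieAlg K O}
    (hx : x ∈ weightSpace S.torus γ) :
    S.degLin χ I x = AddMonoidAlgebra.single (S.cls I γ) (S.toUι χ x) := by
  have h1 : S.degLin χ I x = (S.basis.repr x).sum fun b c =>
      AddMonoidAlgebra.single (S.cls I (S.idxWt b)) (S.toUι χ (c • S.basis b)) := by
    rw [degLin, Module.Basis.constr_apply]
    refine Finsupp.sum_congr fun b _ => ?_
    rw [map_smul, AddMonoidAlgebra.smul_single]
  have h2 : AddMonoidAlgebra.single (S.cls I γ) (S.toUι χ x) = (S.basis.repr x).sum fun b c =>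
      AddMonoidAlgebra.single (S.cls I γ) (S.toUι χ (c • S.basis b)) := by
    conv_lhs => rw [← S.basis.linearCombination_repr x, Finsupp.linearCombination_apply]
    rw [map_finsuppSum]
    exact map_finsuppSum (AddMonoidAlgebra.singleAddHom (S.cls I γ)) _ _
  rw [h1, h2]
  refine Finsupp.sum_congr fun b _ => ?_
  by_cases hb : S.idxWt b = γ
  · rw [hb]
  · rw [S.repr_eq_zero hx hb, zero_smul, map_zero, AddMonoidAlgebra.single_zero,
      AddMonoidAlgebra.single_zero]

/-- The homomorphism of Lie algebras underlying the grading of `U_χ`. -/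
def degLie [Infinite K] [Module.Free ℤ X] :
    lieAlg K O →ₗ⁅K⁆ AddMonoidAlgebra (S.U χ) (S.XI I) :=
  { S.degLin χ I with
    map_lie' := by
      intro x y
      change S.degLin χ I ⁅x, y⁆ = ⁅S.degLin χ I x, S.degLin χ I y⁆
      have h : (LieModule.toEnd K (lieAlg K O) (lieAlg K O)).toLinearMap.compr₂ (S.degLin χ I) =
          (LieModule.toEnd K (AddMonoidAlgebra (S.U χ) (S.XI I))
            (AddMonoidAlgebra (S.U χ) (S.XI I))).toLinearMap.compl₁₂
              (S.degLin χ I) (S.degLin χ I) := by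
        refine S.basis.ext fun b => S.basis.ext fun b' => ?_
        change S.degLin χ I ⁅S.basis b, S.basis b'⁆ =
          ⁅S.degLin χ I (S.basis b), S.degLin χ I (S.basis b')⁆
        rw [S.degLin_apply χ I (S.basis_mem b), S.degLin_apply χ I (S.basis_mem b'),
          S.degLin_apply χ I (lie_mem_weightSpace _ (S.basis_mem b) (S.basis_mem b')),
          LieRing.of_associative_ring_bracket, AddMonoidAlgebra.single_mul_single,
          AddMonoidAlgebra.single_mul_single, toUι_lie]
        rw [add_comm (S.cls I (S.idxWt b')), ← QuotientAddGroup.mk_add]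
        exact map_sub (AddMonoidAlgebra.singleAddHom _) _ _
      exact LinearMap.congr_fun₂ h x y }

variable {χ I}

/-- The grading of `U_χ` as a coaction of `X/ℤI`. -/
def coact [Infinite K] [Module.Free ℤ X] (hχ : S.IsStandardLevi χ I) :
    S.U χ →ₐ[K] AddMonoidAlgebra (S.U χ) (S.XI I) :=
  RingQuot.liftAlgHom K ⟨UniversalEnvelopingAlgebra.lift K (S.degLie χ I), by
    rintro _ _ ⟨α, rfl, rfl⟩
    rw [map_pow, UniversalEnvelopingAlgebra.lift_ι_apply, AlgHom.commutes]
    change S.degLin χ I (S.e α) ^ p = _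
    rw [S.degLin_apply χ I (S.e_mem α), AddMonoidAlgebra.single_pow, toUι_e, ue_pow]
    rcases S.chi_e_eq_zero_or_cls hχ α with h | h
    · have h0 : (0 : K) ^ p = 0 ∨ p • S.cls I α.1 = 0 := by
        rcases eq_or_ne p 0 with h0 | h0
        · exact Or.inr ((congrArg (· • S.cls I α.1) h0).trans (zero_smul ℕ _))
        · exact Or.inl (zero_pow h0)
      rw [h]
      rcases h0 with h0 | h0
      · rw [h0, map_zero, map_zero, AddMonoidAlgebra.single_zero]
      · rw [h0]
        rfl
    · rw [h, smul_zero]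
      rfl⟩

lemma coact_toUι [Infinite K] [Module.Free ℤ X] (hχ : S.IsStandardLevi χ I) {γ : X}
    {x : lieAlg K O} (hx : x ∈ weightSpace S.torus γ) :
    S.coact hχ (S.toUι χ x) = AddMonoidAlgebra.single (S.cls I γ) (S.toUι χ x) := by
  rw [← S.degLin_apply χ I hx]
  refine (RingQuot.liftAlgHom_mkAlgHom_apply ..).trans ?_
  exact UniversalEnvelopingAlgebra.lift_ι_apply K (S.degLie χ I) x

lemma coact_gen [Infinite K] [Module.Free ℤ X] (hχ : S.IsStandardLevi χ I) (i) :
    S.coact hχ (S.gen χ i) = AddMonoidAlgebra.single (S.genDeg I i) (S.gen χ i) := by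
  rcases i with α | h
  · exact S.coact_toUι hχ (S.e_mem α)
  · have := S.coact_toUι hχ (lieMap_mem_weightSpace S.torus h)
    rw [toUι_lieMap] at this
    exact this

/-- Components of `U_χ` are only defined as spans of monomials; reading coefficients of the coaction
shows that they are independent. -/
lemma coact_apply [Infinite K] [Module.Free ℤ X] (hχ : S.IsStandardLevi χ I) {σ : S.XI I}
    {y : S.U χ} (hy : y ∈ S.uGr χ I σ) : S.coact hχ y = AddMonoidAlgebra.single σ y := by
  revert y
  have : S.uGr χ I σ ≤ LinearMap.eqLocus (S.coact hχ).toLinearMap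
      (AddMonoidAlgebra.lsingle (R := K) (S := S.U χ) σ) := by
    rw [uGr, Submodule.span_le]
    rintro _ ⟨l, rfl, rfl⟩
    change S.coact hχ _ = AddMonoidAlgebra.single _ _
    induction l with
    | nil => simp; rfl
    | cons i l ih =>
      simp only [List.map_cons, List.prod_cons, List.sum_cons, map_mul, ih, coact_gen,
        AddMonoidAlgebra.single_mul_single]
  exact fun y hy => this hy

lemma coact_u0 [Infinite K] [Module.Free ℤ X] (hχ : S.IsStandardLevi χ I) (s : U0 K X) :
    S.coact hχ (S.u0 χ s) = AddMonoidAlgebra.single 0 (S.u0 χ s) := by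
  have h : (S.coact hχ).comp (S.u0 χ) =
      (AddMonoidAlgebra.singleZeroAlgHom (R := K) (A := S.U χ) (M := S.XI I)).comp (S.u0 χ) := by
    apply UniversalEnvelopingAlgebra.hom_ext
    refine LieHom.ext fun h => ?_
    exact S.coact_gen hχ (Sum.inr h)
  exact AlgHom.congr_fun h s

/-- The projection of `U_χ` onto its component of degree `σ`. -/
def uProj [Infinite K] [Module.Free ℤ X] (hχ : S.IsStandardLevi χ I) (σ : S.XI I) :
    S.U χ →ₗ[K] S.U χ where
  toFun y := (S.coact hχ y).coeff σ
  map_add' y z := by simp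
  map_smul' c y := by simp

lemma uProj_of_mem [Infinite K] [Module.Free ℤ X] (hχ : S.IsStandardLevi χ I) {σ : S.XI I}
    {y : S.U χ} (hy : y ∈ S.uGr χ I σ) : S.uProj hχ σ y = y := by
  change (S.coact hχ y).coeff σ = y
  rw [S.coact_apply hχ hy]
  simp

lemma uProj_of_mem_of_ne [Infinite K] [Module.Free ℤ X] (hχ : S.IsStandardLevi χ I)
    {σ τ : S.XI I} (h : τ ≠ σ) {y : S.U χ} (hy : y ∈ S.uGr χ I τ) : S.uProj hχ σ y = 0 := by
  change (S.coact hχ y).coeff σ = 0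
  rw [S.coact_apply hχ hy]
  simp [h]

/-- Homogeneity of the first type of relations of a baby Verma module, needed for `verProj`; the
second type is covered by `uProj_mul_u0`. -/
lemma uProj_mul_ue [Infinite K] [Module.Free ℤ X] (hχ : S.IsStandardLevi χ I) (σ : S.XI I)
    (y : S.U χ) (α : S.R) :
    S.uProj hχ σ (y * S.ue χ α) = S.uProj hχ (σ - S.cls I α.1) y * S.ue χ α := by
  change (S.coact hχ _).coeff σ = (S.coact hχ _).coeff _ * _
  rw [map_mul, S.coact_apply hχ (S.ue_mem_uGr χ I α), AddMonoidAlgebra.coeff_mul_single_apply,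
    sub_eq_add_neg]

lemma uProj_mul_u0 [Infinite K] [Module.Free ℤ X] (hχ : S.IsStandardLevi χ I) (σ : S.XI I)
    (y : S.U χ) (s : U0 K X) :
    S.uProj hχ σ (y * S.u0 χ s) = S.uProj hχ σ y * S.u0 χ s := by
  change (S.coact hχ _).coeff σ = (S.coact hχ _).coeff _ * _
  rw [map_mul, S.coact_u0 hχ, AddMonoidAlgebra.coeff_mul_single_apply]
  simp

/-! ### Weights of `U_χ` -/

variable (χ I)

/-- The adjoint action of `h ∈ 𝔥` on `U_χ`. -/
def uAd (h : Cartan K X) : Module.End K (S.U χ) :=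
  LinearMap.mulLeft K (S.uh χ h) - LinearMap.mulRight K (S.uh χ h)

lemma mul_mem_uWt {σ τ : S.XI I} {ξ η : Module.Dual K (Cartan K X)} {y z : S.U χ}
    (hy : y ∈ S.uWt χ I σ ξ) (hz : z ∈ S.uWt χ I τ η) : y * z ∈ S.uWt χ I (σ + τ) (ξ + η) := by
  refine ⟨S.mul_mem_uGr χ I hy.1 hz.1, fun h => ?_⟩
  have h1 : S.uh χ h * y = ξ h • y + y * S.uh χ h := sub_eq_iff_eq_add.mp (hy.2 h)
  have h2 : S.uh χ h * z = η h • z + z * S.uh χ h := sub_eq_iff_eq_add.mp (hz.2 h)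
  rw [← mul_assoc, h1, add_mul, mul_assoc, h2, mul_add, LinearMap.add_apply, add_smul,
    smul_mul_assoc, mul_smul_comm, mul_assoc]
  abel

lemma one_mem_uWt : (1 : S.U χ) ∈ S.uWt χ I 0 0 :=
  ⟨S.one_mem_uGr χ I, fun h => by simp⟩

lemma ue_mem_uWt [Infinite K] [Module.Free ℤ X] (α : S.R) :
    S.ue χ α ∈ S.uWt χ I (S.cls I α.1) (dchar α.1) := by
  refine ⟨S.ue_mem_uGr χ I α, fun h => ?_⟩
  rw [← toUι_e, ← toUι_lieMap, ← toUι_lie, lie_weightSpace _ (S.e_mem α), map_smul]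

lemma uh_commute (h h' : Cartan K X) : S.uh χ h * S.uh χ h' = S.uh χ h' * S.uh χ h := by
  rw [← sub_eq_zero, ← toUι_lieMap, ← toUι_lieMap, ← toUι_lie, ← LieHom.map_lie, cartan_lie,
    map_zero (lieMap S.torus), map_zero]

lemma uh_mem_uWt (h : Cartan K X) : S.uh χ h ∈ S.uWt χ I 0 0 := by
  refine ⟨S.gen_mem_uGr χ I (Sum.inr h), fun h' => ?_⟩
  rw [uh_commute, sub_self]
  simp

/-- The sum `ν` of the roots occurring in a monomial lifts its degree to `X` and gives its weight,
so degree and weight have a common source. -/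
lemma list_prod_mem_uWt [Infinite K] [Module.Free ℤ X] (l : List (S.R ⊕ Cartan K X)) :
    ∃ ν : X, S.cls I ν = (l.map (S.genDeg I)).sum ∧
      (l.map (S.gen χ)).prod ∈ S.uWt χ I (S.cls I ν) (dchar ν) := by
  induction l with
  | nil =>
    refine ⟨0, by simp, ?_⟩
    rw [dchar_zero]
    exact S.one_mem_uWt χ I
  | cons i l ih =>
    obtain ⟨ν, h1, h2⟩ := ih
    rcases i with α | h
    · refine ⟨α.1 + ν, ?_, ?_⟩
      · rw [List.map_cons, List.sum_cons, ← h1, cls_add]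
        rfl
      · rw [List.map_cons, List.prod_cons, dchar_add, cls_add]
        exact S.mul_mem_uWt χ I (S.ue_mem_uWt χ I α) h2
    · refine ⟨ν, ?_, ?_⟩
      · rw [List.map_cons, List.sum_cons, ← h1]
        exact (zero_add (S.cls I ν)).symm
      · rw [List.map_cons, List.prod_cons]
        have := S.mul_mem_uWt χ I (S.uh_mem_uWt χ I h) h2
        rwa [zero_add, zero_add] at this

/-- `U⁰` acts on a weight vector through a shift. -/
lemma u0_mul_of_mem_uWt {σ : S.XI I} {ν : X} {y : S.U χ} (hy : y ∈ S.uWt χ I σ (dchar ν))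
    (s : U0 K X) : S.u0 χ s * y = y * S.u0 χ (tilde ν s) := by
  let B : Subalgebra K (U0 K X) :=
    { carrier := {s | S.u0 χ s * y = y * S.u0 χ (tilde ν s)}
      mul_mem' := fun {a b} ha hb => by
        change S.u0 χ (a * b) * y = y * S.u0 χ (tilde ν (a * b))
        change S.u0 χ a * y = y * S.u0 χ (tilde ν a) at ha
        change S.u0 χ b * y = y * S.u0 χ (tilde ν b) at hb
        rw [map_mul, map_mul, map_mul, mul_assoc, hb, ← mul_assoc, ha, mul_assoc]
      add_mem' := fun {a b} ha hb => by
        change S.u0 χ (a + b) * y = y * S.u0 χ (tilde ν (a + b))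
        change S.u0 χ a * y = y * S.u0 χ (tilde ν a) at ha
        change S.u0 χ b * y = y * S.u0 χ (tilde ν b) at hb
        rw [map_add, map_add, map_add, add_mul, mul_add, ha, hb]
      algebraMap_mem' := fun c => by
        change S.u0 χ _ * y = y * S.u0 χ (tilde ν _)
        rw [AlgHom.commutes, AlgHom.commutes, AlgHom.commutes, Algebra.commutes] }
  have hB : B = ⊤ := subalgebra_eq_top_of_ι_mem B fun h => by
    change S.uh χ h * y = y * S.u0 χ (tilde ν _)
    have h1 : S.uh χ h * y = dchar ν h • y + y * S.uh χ h := sub_eq_iff_eq_add.mp (hy.2 h)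
    have h2 : tilde ν (UniversalEnvelopingAlgebra.ι K h) =
        UniversalEnvelopingAlgebra.ι K h + algebraMap K (U0 K X) (dchar ν h) := by
      rw [tilde, UniversalEnvelopingAlgebra.lift_ι_apply]
      rfl
    rw [h2, map_add, AlgHom.commutes, mul_add, ← Algebra.commutes, ← Algebra.smul_def, h1, add_comm]
    rfl
  have hs : s ∈ B := by rw [hB]; trivial
  exact hs

end Setting

/-! ### Composition of shifts of `U⁰`, and independence of simultaneous eigenspaces. -/

lemma tilde_ι {K : Type u} [Field K] {X : Type w} [AddCommGroup X] (ν : X) (h : Cartan K X) :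
    tilde ν (UniversalEnvelopingAlgebra.ι K h) =
      UniversalEnvelopingAlgebra.ι K h + algebraMap K (U0 K X) (dchar ν h) := by
  rw [tilde, UniversalEnvelopingAlgebra.lift_ι_apply]
  rfl

lemma tilde_tilde {K : Type u} [Field K] {X : Type w} [AddCommGroup X] (μ ν : X) (s : U0 K X) :
    tilde μ (tilde ν s) = tilde (μ + ν) s := by
  have h : (tilde μ).comp (tilde ν) = (tilde (μ + ν) : U0 K X →ₐ[K] U0 K X) := by
    apply UniversalEnvelopingAlgebra.hom_ext
    refine LieHom.ext fun h => ?_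
    change tilde μ (tilde ν (UniversalEnvelopingAlgebra.ι K h)) =
      tilde (μ + ν) (UniversalEnvelopingAlgebra.ι K h)
    rw [tilde_ι, tilde_ι, map_add, tilde_ι, AlgHom.commutes, dchar_add, LinearMap.add_apply,
      map_add, add_assoc]
  exact AlgHom.congr_fun h s

/-- Simultaneous eigenvectors for distinct systems of eigenvalues which sum to zero are zero. -/
lemma eq_zero_of_sum_eigen {K : Type u} [Field K] {V : Type v} [AddCommGroup V] [Module K V]
    {H : Type w} {ι : Type x} (f : H → Module.End K V) (c : ι → H → K) (hc : Function.Injective c)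
    (s : Finset ι) (m : ι → V) (hm : ∀ i ∈ s, ∀ h, f h (m i) = c i h • m i)
    (h0 : ∑ i ∈ s, m i = 0) : ∀ i ∈ s, m i = 0 := by
  classical
  induction s using Finset.induction_on generalizing m with
  | empty => simp
  | insert a s ha ih =>
    rw [Finset.sum_insert ha] at h0
    have hs : ∀ i ∈ s, m i = 0 := by
      intro i hi
      have hne : c i ≠ c a := fun h => ha (hc h ▸ hi)
      obtain ⟨h, hh⟩ := Function.ne_iff.mp hne
      -- Applying `f h - c a h` to the relation removes the term at `a` and keeps a non-zero
      -- coefficient at `i`.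
      have h1 : ∑ j ∈ s, (c j h - c a h) • m j = 0 := by
        have h2 := congrArg (f h) h0
        rw [map_add, map_sum, map_zero, hm a (Finset.mem_insert_self a s) h,
          Finset.sum_congr rfl fun j hj => hm j (Finset.mem_insert_of_mem hj) h] at h2
        have h3 := congrArg (c a h • ·) h0
        simp only [smul_add, Finset.smul_sum, smul_zero] at h3
        simp only [sub_smul, Finset.sum_sub_distrib]
        rw [← sub_eq_zero] at h2
        rw [eq_neg_of_add_eq_zero_right h3, sub_neg_eq_add, add_comm]
        simpa using h2
      have h2 := ih (fun j => (c j h - c a h) • m j) (fun j hj h' => by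
        rw [map_smul, hm j (Finset.mem_insert_of_mem hj) h', smul_comm]) h1 i hi
      exact (smul_eq_zero.mp h2).resolve_left (sub_ne_zero.mpr hh)
    intro i hi
    rcases Finset.mem_insert.mp hi with rfl | hi
    · rwa [Finset.sum_eq_zero hs, add_zero] at h0
    · exact hs i hi

lemma addSubgroup_iSupIndep_iff {V : Type v} [AddCommGroup V] {ι : Type x} (E : ι → AddSubgroup V) :
    iSupIndep E ↔ ∀ (s : Finset ι) (m : ι → V), (∀ i ∈ s, m i ∈ E i) → ∑ i ∈ s, m i = 0 →
      ∀ i ∈ s, m i = 0 := by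
  rw [← iSupIndep_map_orderIso_iff (AddSubgroup.toIntSubmodule (M := V)),
    iSupIndep_iff_finsetSum_eq_zero_imp_eq_zero]
  rfl

lemma addSubgroup_mem_iSup_iff {V : Type v} [AddCommGroup V] {ι : Type x} (E : ι → AddSubgroup V)
    (v : V) : v ∈ ⨆ i, E i ↔ ∃ (s : Finset ι) (m : ι → V), (∀ i, m i ∈ E i) ∧ ∑ i ∈ s, m i = v := by
  classical
  constructor
  · intro hv
    induction hv using AddSubgroup.iSup_induction' with
    | hp i x hx =>
      refine ⟨{i}, Function.update 0 i x, fun j => ?_, by simp⟩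
      by_cases h : j = i
      · subst h; simpa using hx
      · simp [h]
    | h1 => exact ⟨∅, 0, by simp, by simp⟩
    | hadd x y _ _ ihx ihy =>
      obtain ⟨s, m, hm, rfl⟩ := ihx
      obtain ⟨t, n, hn, rfl⟩ := ihy
      refine ⟨s ∪ t, fun i => (if i ∈ s then m i else 0) + (if i ∈ t then n i else 0),
        fun i => ?_, ?_⟩
      · refine add_mem ?_ ?_
        · split_ifs
          · exact hm i
          · exact zero_mem _
        · split_ifs
          · exact hn i
          · exact zero_mem _
      · rw [Finset.sum_add_distrib, Finset.sum_ite_mem, Finset.sum_ite_mem,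
          Finset.union_inter_cancel_left, Finset.union_inter_cancel_right]
  · rintro ⟨s, m, hm, rfl⟩
    exact AddSubgroup.sum_mem _ fun i _ => AddSubgroup.mem_iSup_of_mem i (hm i)

/-- Simultaneous eigenspaces are independent. -/
lemma iSupIndep_of_eigen {K : Type u} [Field K] {V : Type v} [AddCommGroup V] [Module K V]
    {H : Type w} {ι : Type x} (f : H → Module.End K V) (c : ι → H → K) (hc : Function.Injective c)
    (E : ι → AddSubgroup V) (hE : ∀ i, ∀ m ∈ E i, ∀ h, f h m = c i h • m) : iSupIndep E :=
  (addSubgroup_iSupIndep_iff E).mpr fun s m hm h0 =>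
    eq_zero_of_sum_eigen f c hc s m (fun i hi => hE i _ (hm i hi)) h0

end

/-! ### Nilpotency of the algebra generated by the shifted negative root vectors. -/

section

/-- The product of a list does not depend on the order if all commutators of adjacent entries
vanish in context. -/
lemma prod_map_perm_of_commutator {A : Type u} [Ring A] {ι : Type v} (f : ι → A) {l l' : List ι}
    (h : l.Perm l') (u : List ι)
    (H : ∀ (a b : List ι) (x y : ι), (a ++ x :: y :: b).Perm (u ++ l) →
      (a.map f).prod * (f x * f y - f y * f x) * (b.map f).prod = 0) :
    ((u ++ l).map f).prod = ((u ++ l').map f).prod := by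
  induction h generalizing u with
  | nil => rfl
  | cons x _ ih =>
    have := ih (u ++ [x]) (by simpa using H)
    simpa using this
  | swap x y l =>
    have := H u l y x (List.Perm.refl _)
    rw [← sub_eq_zero]
    simp only [List.map_append, List.map_cons, List.prod_append, List.prod_cons]
    rw [← this]
    noncomm_ring
  | trans h1 _ ih1 ih2 =>
    exact (ih1 u H).trans (ih2 u fun a b x y hp => H a b x y (hp.trans (h1.symm.append_left u)))

namespace Setting

variable {K : Type u} [Field K] {p : ℕ} {O : Type v} [CommRing O] [HopfAlgebra K O]
variable {X : Type w} [AddCommGroup X] (S : Setting K p O X)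
variable (χ : Module.Dual K (lieAlg K O)) (I : Set X)

/-- The negative roots. -/
abbrev Neg : Type w := {α : S.R // α.1 ∉ S.pos}

/-- The element `e_α - χ(e_α)` of `U_χ`. -/
def uy (α : S.Neg) : S.U χ := S.ue χ α.1 - algebraMap K _ (χ (S.e α.1))

/-- Products of the elements `e_α - χ(e_α)`. -/
def word (l : List S.Neg) : S.U χ := (l.map (S.uy χ)).prod

lemma word_nil : S.word χ [] = 1 := rfl

lemma word_cons (α : S.Neg) (l : List S.Neg) :
    S.word χ (α :: l) = S.uy χ α * S.word χ l := by simp [word]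

lemma word_append (l m : List S.Neg) : S.word χ (l ++ m) = S.word χ l * S.word χ m := by
  simp [word]

lemma toUι_mul_uy (x : lieAlg K O) (α : S.Neg) :
    S.toUι χ x * S.uy χ α = S.uy χ α * S.toUι χ x + S.toUι χ ⁅x, S.e α.1⁆ := by
  rw [toUι_lie, toUι_e, uy, mul_sub, sub_mul, Algebra.commutes]
  abel

lemma uy_commutator (α β : S.Neg) :
    S.uy χ α * S.uy χ β - S.uy χ β * S.uy χ α = S.toUι χ ⁅S.e α.1, S.e β.1⁆ := by
  have h := S.toUι_mul_uy χ (S.e α.1) β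
  rw [toUι_e] at h
  have h2 : S.uy χ α = S.ue χ α.1 - algebraMap K _ (χ (S.e α.1)) := rfl
  rw [h2, sub_mul, mul_sub, h, Algebra.commutes]
  abel

/-- This is the point of the shift by the scalar: `p`-th powers are additive on commuting elements,
and the relation of `U_χ` cancels the two terms. -/
lemma uy_pow [Fact p.Prime] [CharP K p] (α : S.Neg) : S.uy χ α ^ p = 0 := by
  rw [uy, sub_pow_char_of_algebra K p (Algebra.commute_algebraMap_right _ _), ue_pow, map_pow,
    sub_self]

variable {χ I}

lemma ht_neg (α : S.Neg) : 1 ≤ -S.ht α.1.1 := by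
  linarith [S.ht_le_neg_one α.1.2 α.2]

lemma lie_e_neg [Infinite K] [Module.Free ℤ X] (α β : S.Neg) : ⁅S.e α.1, S.e β.1⁆ = 0 ∨
    ∃ (γ : S.Neg) (c : K), S.ht γ.1.1 = S.ht α.1.1 + S.ht β.1.1 ∧
      ⁅S.e α.1, S.e β.1⁆ = c • S.e γ.1 := by
  have hm := lie_mem_weightSpace _ (S.e_mem α.1) (S.e_mem β.1)
  have h1 := S.ht_neg α
  have h2 := S.ht_neg β
  have hadd : S.ht (α.1.1 + β.1.1) = S.ht α.1.1 + S.ht β.1.1 := map_add _ _ _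
  by_cases hR : α.1.1 + β.1.1 ∈ S.R
  · right
    refine ⟨⟨⟨_, hR⟩, fun h => ?_⟩, _, hadd, S.eq_smul_e (α := ⟨_, hR⟩) hm⟩
    have := S.one_le_ht h
    linarith
  · left
    refine S.eq_zero_of_not_root (fun h => ?_) hR hm
    rw [h, map_zero] at hadd
    linarith

/-- By its height `γ` cannot be the negative of a simple root. Consequently `χ` is a character of
`𝔫⁻`. -/
lemma chi_e_eq_zero_of_ht [Infinite K] [Module.Free ℤ X] (hχ : S.IsStandardLevi χ I) {γ : S.R}
    (h : S.ht γ.1 < -1) : χ (S.e γ) = 0 := by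
  refine S.chi_e_eq_zero hχ fun hI => ?_
  have := S.ht_simple (hχ.subset hI)
  rw [map_neg] at this
  linarith

/-- A bracket of negative root vectors has height at most `-2`, where `χ` vanishes; there `e_γ` and
`e_γ - χ(e_γ)` coincide. -/
lemma uy_commutator_eq [Infinite K] [Module.Free ℤ X] (hχ : S.IsStandardLevi χ I) (α β : S.Neg) :
    S.uy χ α * S.uy χ β - S.uy χ β * S.uy χ α = 0 ∨
      ∃ (γ : S.Neg) (c : K), S.ht γ.1.1 = S.ht α.1.1 + S.ht β.1.1 ∧
        S.uy χ α * S.uy χ β - S.uy χ β * S.uy χ α = c • S.uy χ γ := by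
  rw [uy_commutator]
  rcases S.lie_e_neg α β with h | ⟨γ, c, h1, h2⟩
  · left
    rw [h, map_zero]
  · right
    refine ⟨γ, c, h1, ?_⟩
    have h3 : χ (S.e γ.1) = 0 := S.chi_e_eq_zero_of_ht hχ (by
      linarith [S.ht_neg α, S.ht_neg β])
    rw [h2, map_smul, toUι_e, uy, h3, map_zero, sub_zero]

/-- The elements `e_α - χ(e_α)`, for negative `α`, generate a nilpotent algebra. -/
lemma exists_word_eq_zero [Infinite K] [Module.Free ℤ X] [Fact p.Prime] [CharP K p] [Finite S.R]
    (hχ : S.IsStandardLevi χ I) : ∃ k, ∀ l : List S.Neg, k ≤ l.length → S.word χ l = 0 := by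
  classical
  have := Fintype.ofFinite S.Neg
  obtain ⟨M, hM⟩ : ∃ M : ℕ, ∀ α : S.Neg, -S.ht α.1.1 ≤ M := by
    obtain ⟨B, hB⟩ := (Set.finite_range fun α : S.Neg => -S.ht α.1.1).bddAbove
    obtain ⟨M, hM⟩ := exists_nat_ge B
    exact ⟨M, fun α => (hB ⟨α, rfl⟩).trans hM⟩
  let tot : List S.Neg → ℚ := fun l => (l.map fun α => -S.ht α.1.1).sum
  have tot_le : ∀ l, tot l ≤ l.length * M := by
    intro l
    have := List.sum_le_card_nsmul (l.map fun α : S.Neg => -S.ht α.1.1) (M : ℚ) (by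
      intro x hx
      obtain ⟨α, -, rfl⟩ := List.mem_map.mp hx
      exact hM α)
    simpa using this
  have le_tot : ∀ l, (l.length : ℚ) ≤ tot l := by
    intro l
    have := List.card_nsmul_le_sum (l.map fun α : S.Neg => -S.ht α.1.1) (1 : ℚ) (by
      intro x hx
      obtain ⟨α, -, rfl⟩ := List.mem_map.mp hx
      exact S.ht_neg α)
    simpa using this
  -- A word with more than `C` letters contains some letter at least `p` times.
  let C := Fintype.card S.Neg * (p - 1)
  -- Induction on the length, with the total height kept fixed. Each letter has height at most `M`,
  -- so a total above `C * M` forces more than `C` letters. Exchanging neighbours costs a word with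
  -- one letter fewer and the same total, which is zero by induction; so `p` equal letters may be
  -- brought to the front.
  have main : ∀ n, ∀ l : List S.Neg, l.length = n → ((C * M : ℕ) : ℚ) < tot l →
      S.word χ l = 0 := by
    intro n
    induction n with
    | zero =>
      intro l hl h
      rw [List.length_eq_zero_iff] at hl
      subst hl
      have : (0 : ℚ) ≤ ((C * M : ℕ) : ℚ) := Nat.cast_nonneg _
      simp only [tot, List.map_nil, List.sum_nil] at h
      linarith
    | succ n ih =>
      intro l hl h
      have hlen : C < l.length := by
        by_contra! hle
        have h1 := tot_le l
        have h2 : (l.length : ℚ) * M ≤ ((C * M : ℕ) : ℚ) := by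
          exact_mod_cast Nat.mul_le_mul_right M hle
        linarith
      obtain ⟨α, hα⟩ : ∃ α, p ≤ l.count α := by
        by_contra! hc
        have h1 : ∑ α : S.Neg, (l : Multiset S.Neg).count α = l.length := by
          rw [Multiset.sum_count_eq_card (fun a _ => Finset.mem_univ a)]
          rfl
        have h2 : ∑ α : S.Neg, (l : Multiset S.Neg).count α ≤ C := by
          refine (Finset.sum_le_card_nsmul _ _ (p - 1) fun α _ => ?_).trans (by simp [C])
          rw [Multiset.coe_count]
          refine le_trans (le_of_eq ?_) (Nat.le_sub_one_of_lt (hc α))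
          congr!
        omega
      obtain ⟨m, hm⟩ := (List.replicate_sublist_iff.mpr hα).exists_perm_append
      have := prod_map_perm_of_commutator (S.uy χ) hm [] (by
        intro a b x y hp
        rw [List.nil_append] at hp
        rcases S.uy_commutator_eq hχ x y with h0 | ⟨γ, c, hγ, h0⟩
        · rw [h0, mul_zero, zero_mul]
        · rw [h0, mul_smul_comm, smul_mul_assoc]
          have hw : S.word χ (a ++ γ :: b) = 0 := by
            have hp' := hp.length_eq
            apply ih
            · simp at hp' ⊢
              omega
            · have ht : tot (a ++ γ :: b) = tot (a ++ x :: y :: b) := by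
                simp only [tot, List.map_append, List.map_cons, List.sum_append, List.sum_cons, hγ]
                ring
              rw [ht, show tot (a ++ x :: y :: b) = tot l from (hp.map _).sum_eq]
              exact h
          rw [word_append, word_cons, ← mul_assoc] at hw
          change c • (S.word χ a * _ * S.word χ b) = 0
          rw [hw, smul_zero])
      change S.word χ ([] ++ l) = 0
      refine this.trans ?_
      change S.word χ (List.replicate p α ++ m) = 0
      rw [word_append, word, List.map_replicate, List.prod_replicate, uy_pow, zero_mul]
  -- Each letter contributes at least `1` to the total height.
  refine ⟨C * M + 1, fun l hl => main _ l rfl ?_⟩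
  refine lt_of_lt_of_le ?_ (le_tot l)
  exact_mod_cast hl

/-- The scalar can be non-zero only when `α` has degree zero, so the shift does not destroy
homogeneity. -/
lemma uy_mem_uGr [Infinite K] [Module.Free ℤ X] (hχ : S.IsStandardLevi χ I) (α : S.Neg) :
    S.uy χ α ∈ S.uGr χ I (S.cls I α.1.1) := by
  refine Submodule.sub_mem _ (S.ue_mem_uGr χ I α.1) ?_
  rcases S.chi_e_eq_zero_or_cls hχ α.1 with h | h
  · rw [h, map_zero]
    exact Submodule.zero_mem _
  · rw [h, Algebra.algebraMap_eq_smul_one]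
    exact Submodule.smul_mem _ _ (S.one_mem_uGr χ I)

lemma word_mem_uGr [Infinite K] [Module.Free ℤ X] (hχ : S.IsStandardLevi χ I) (l : List S.Neg) :
    S.word χ l ∈ S.uGr χ I (l.map fun α => S.cls I α.1.1).sum := by
  induction l with
  | nil => exact S.one_mem_uGr χ I
  | cons α l ih =>
    rw [word_cons, List.map_cons, List.sum_cons]
    exact S.mul_mem_uGr χ I (S.uy_mem_uGr hχ α) ih

end Setting

end

section

namespace Setting

variable {K : Type u} [Field K] {p : ℕ} {O : Type v} [CommRing O] [HopfAlgebra K O]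
variable {X : Type w} [AddCommGroup X] (S : Setting K p O X)
variable (χ : Module.Dual K (lieAlg K O)) (I : Set X)
variable (A : Type x) [CommRing A] [Algebra K A] (π : U0 K X →ₐ[K] A) (lam : X)

/-! ### Baby Verma modules -/

/-- The module underlying a baby Verma module. -/
abbrev Ver : Type (max u v x) := (S.U χ ⊗[K] A) ⧸ S.verRel χ A π lam

variable {A}

/-- The class of `y ⊗ a` in a baby Verma module. -/
def verMk (y : S.U χ) (a : A) : S.Ver χ A π lam := Submodule.Quotient.mk (y ⊗ₜ[K] a)

lemma smul_verMk (y z : S.U χ) (a b : A) :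
    (y ⊗ₜ[K] a) • S.verMk χ π lam z b = S.verMk χ π lam (y * z) (a * b) := by
  rw [verMk, ← Submodule.Quotient.mk_smul, smul_eq_mul, Algebra.TensorProduct.tmul_mul_tmul]
  rfl

lemma one_smul_verMk (z : S.U χ) (a b : A) :
    ((1 : S.U χ) ⊗ₜ[K] a) • S.verMk χ π lam z b = S.verMk χ π lam z (a * b) := by
  rw [smul_verMk, one_mul]

lemma smul_one_verMk (y z : S.U χ) (b : A) :
    (y ⊗ₜ[K] (1 : A)) • S.verMk χ π lam z b = S.verMk χ π lam (y * z) b := by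
  rw [smul_verMk, one_mul]

lemma verMk_add (y z : S.U χ) (a : A) :
    S.verMk χ π lam (y + z) a = S.verMk χ π lam y a + S.verMk χ π lam z a := by
  rw [verMk, TensorProduct.add_tmul]
  rfl

lemma verMk_zero (a : A) : S.verMk χ π lam 0 a = 0 := by
  rw [verMk, TensorProduct.zero_tmul]
  rfl

lemma verMk_smul (c : K) (y : S.U χ) (a : A) :
    S.verMk χ π lam (c • y) a = S.verMk χ π lam y (c • a) := by
  rw [verMk, TensorProduct.smul_tmul]
  rfl

lemma verMk_mul_ue {α : S.R} (hα : α.1 ∈ S.pos) (y : S.U χ) (a : A) :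
    S.verMk χ π lam (y * S.ue χ α) a = 0 := by
  rw [verMk, Submodule.Quotient.mk_eq_zero]
  exact Submodule.subset_span (Or.inl ⟨y, α, a, hα, rfl⟩)

lemma verMk_mul_u0 (y : S.U χ) (s : U0 K X) (a : A) :
    S.verMk χ π lam (y * S.u0 χ s) a = S.verMk χ π lam y (a * π (tilde lam s)) := by
  rw [verMk, verMk, Submodule.Quotient.eq]
  exact Submodule.subset_span (Or.inr ⟨y, s, a, rfl⟩)

lemma ver_induction {P : S.Ver χ A π lam → Prop} (h0 : P 0)
    (hadd : ∀ z z', P z → P z' → P (z + z')) (hmk : ∀ y a, P (S.verMk χ π lam y a)) (z) : P z := by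
  obtain ⟨t, rfl⟩ := Submodule.Quotient.mk_surjective _ z
  induction t using TensorProduct.induction_on with
  | zero => exact h0
  | tmul y a => exact hmk y a
  | add a b ha hb => exact hadd _ _ ha hb

/-- The spanning half of a Poincaré-Birkhoff-Witt argument. An element of `𝔤` is moved to the right
through the letters, each commutator lying in `𝔤` again, until it reaches the generator. There
positive root vectors give zero, `𝔥` a scalar, and a negative root vector a letter plus a scalar. -/
lemma closure_word_eq_top :
    AddSubgroup.closure {z | ∃ l a, z = S.verMk χ π lam (S.word χ l) a} = ⊤ := by
  set V := AddSubgroup.closure {z | ∃ l a, z = S.verMk χ π lam (S.word χ l) a}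
  have hw : ∀ l a, S.verMk χ π lam (S.word χ l) a ∈ V := fun l a =>
    AddSubgroup.subset_closure ⟨l, a, rfl⟩
  have stable : ∀ y : S.U χ, (∀ l a, S.verMk χ π lam (y * S.word χ l) a ∈ V) →
      ∀ z ∈ V, (y ⊗ₜ[K] (1 : A)) • z ∈ V := by
    intro y hy z hz
    induction hz using AddSubgroup.closure_induction with
    | mem z hz =>
      obtain ⟨l, a, rfl⟩ := hz
      rw [smul_one_verMk]
      exact hy l a
    | zero => rw [smul_zero]; exact V.zero_mem
    | add _ _ _ _ h1 h2 => rw [smul_add]; exact V.add_mem h1 h2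
    | neg _ _ h => rw [smul_neg]; exact V.neg_mem h
  have huy : ∀ β, ∀ z ∈ V, (S.uy χ β ⊗ₜ[K] (1 : A)) • z ∈ V := fun β =>
    stable _ fun l a => by rw [← word_cons]; exact hw _ a
  have hx : ∀ (l) (x : lieAlg K O) (a), S.verMk χ π lam (S.toUι χ x * S.word χ l) a ∈ V := by
    intro l
    induction l with
    | nil =>
      intro x
      let N : Submodule K (lieAlg K O) :=
        { carrier := {x | ∀ a, S.verMk χ π lam (S.toUι χ x * S.word χ []) a ∈ V}
          add_mem' := fun {x y} hx hy a => by
            rw [map_add, add_mul, verMk_add]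
            exact V.add_mem (hx a) (hy a)
          zero_mem' := fun a => by
            rw [map_zero, zero_mul, verMk_zero]
            exact V.zero_mem
          smul_mem' := fun c x hx a => by
            rw [map_smul, smul_mul_assoc, verMk_smul]
            exact hx _ }
      have hN : N = ⊤ := by
        rw [eq_top_iff, ← S.basis.span_eq, Submodule.span_le]
        rintro _ ⟨b, rfl⟩ a
        rw [word_nil, mul_one]
        rcases b with α | i
        · change S.verMk χ π lam (S.ue χ α) a ∈ V
          by_cases hα : α.1 ∈ S.pos
          · rw [← one_mul (S.ue χ α), S.verMk_mul_ue χ π lam hα]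
            exact V.zero_mem
          · have : S.ue χ α = S.word χ [⟨α, hα⟩] + χ (S.e α) • S.word χ [] := by
              rw [word_cons, word_nil, mul_one, uy, ← Algebra.algebraMap_eq_smul_one]
              abel
            rw [this, verMk_add, verMk_smul]
            exact V.add_mem (hw _ _) (hw _ _)
        · obtain ⟨h, hh⟩ := S.basis_cartan i
          rw [hh, toUι_lieMap, uh, ← one_mul (S.u0 χ _), verMk_mul_u0]
          exact hw [] _
      have : x ∈ N := by rw [hN]; trivial
      exact this
    | cons β l ih =>
      intro x a
      rw [word_cons, ← mul_assoc, toUι_mul_uy, add_mul, verMk_add, mul_assoc,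
        ← S.smul_one_verMk χ π lam (S.uy χ β)]
      exact V.add_mem (huy β _ (ih x a)) (ih _ a)
  have hgen : ∀ i, ∀ z ∈ V, (S.gen χ i ⊗ₜ[K] (1 : A)) • z ∈ V := by
    intro i
    apply stable
    rcases i with α | h
    · exact fun l a => hx l (S.e α) a
    · intro l a
      have := hx l (lieMap S.torus h) a
      rw [toUι_lieMap] at this
      exact this
  rw [eq_top_iff]
  intro z _
  refine S.ver_induction χ π lam V.zero_mem (fun _ _ => V.add_mem) (fun y a => ?_) z
  have hy : y ∈ Submodule.span K (Set.range fun l : List (S.R ⊕ Cartan K X) =>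
    (l.map (S.gen χ)).prod) := by rw [span_gen_list]; trivial
  induction hy using Submodule.span_induction generalizing a with
  | mem y hy =>
    obtain ⟨l, rfl⟩ := hy
    change S.verMk χ π lam (l.map (S.gen χ)).prod a ∈ V
    induction l with
    | nil => exact hw [] a
    | cons i l ih =>
      rw [List.map_cons, List.prod_cons, ← smul_one_verMk]
      exact hgen i _ ih
  | zero => rw [verMk_zero]; exact V.zero_mem
  | add y z _ _ h1 h2 => rw [verMk_add]; exact V.add_mem (h1 a) (h2 a)
  | smul c y _ h => rw [verMk_smul]; exact h _

/-- Left multiplication by a pure tensor maps each generating relation to a relation of the same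
type, so additive combinations of the generators suffice. -/
lemma mem_verRel_induction {P : S.U χ ⊗[K] A → Prop} (h0 : P 0)
    (hadd : ∀ z z', P z → P z' → P (z + z'))
    (hpos : ∀ y (α : S.R) a, α.1 ∈ S.pos → P ((y * S.ue χ α) ⊗ₜ[K] a))
    (hcart : ∀ y s a, P ((y * S.u0 χ s) ⊗ₜ[K] a - y ⊗ₜ[K] (a * π (tilde lam s))))
    {z} (hz : z ∈ S.verRel χ A π lam) : P z := by
  rw [verRel] at hz
  induction hz using Submodule.closure_induction with
  | zero => exact h0
  | add x y _ _ hx hy => exact hadd _ _ hx hy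
  | smul_mem r x hx =>
    induction r using TensorProduct.induction_on with
    | zero => rw [zero_smul]; exact h0
    | add r s hr hs => rw [add_smul]; exact hadd _ _ hr hs
    | tmul u b =>
      rw [smul_eq_mul]
      rcases hx with ⟨y, α, a, hα, rfl⟩ | ⟨y, s, a, rfl⟩
      · rw [Algebra.TensorProduct.tmul_mul_tmul, ← mul_assoc]
        exact hpos _ _ _ hα
      · rw [mul_sub, Algebra.TensorProduct.tmul_mul_tmul, Algebra.TensorProduct.tmul_mul_tmul,
          ← mul_assoc, ← mul_assoc]
        exact hcart _ _ _

variable {χ I}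

/-- The projection of a baby Verma module to a homogeneous component. -/
def verProj [Infinite K] [Module.Free ℤ X] (hχ : S.IsStandardLevi χ I) (σ : S.XI I) :
    S.Ver χ A π lam →ₗ[K] S.Ver χ A π lam :=
  (Submodule.Quotient.restrictScalarsEquiv K (S.verRel χ A π lam)).toLinearMap ∘ₗ
    (Submodule.mapQ _ ((S.verRel χ A π lam).restrictScalars K) ((S.uProj hχ σ).rTensor A) (by
      intro z hz
      refine S.mem_verRel_induction χ π lam (P := fun z => (S.uProj hχ σ).rTensor A z ∈
        S.verRel χ A π lam) ?_ ?_ ?_ ?_ hz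
      · rw [map_zero]; exact Submodule.zero_mem _
      · intro z z' h1 h2
        rw [map_add]; exact Submodule.add_mem _ h1 h2
      · intro y α a hα
        rw [LinearMap.rTensor_tmul, uProj_mul_ue]
        exact Submodule.subset_span (Or.inl ⟨_, _, _, hα, rfl⟩)
      · intro y s a
        rw [map_sub, LinearMap.rTensor_tmul, LinearMap.rTensor_tmul, uProj_mul_u0]
        exact Submodule.subset_span (Or.inr ⟨_, _, _, rfl⟩))) ∘ₗ
    (Submodule.Quotient.restrictScalarsEquiv K (S.verRel χ A π lam)).symm.toLinearMap

lemma verProj_verMk [Infinite K] [Module.Free ℤ X] (hχ : S.IsStandardLevi χ I) (σ : S.XI I)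
    (y : S.U χ) (a : A) :
    S.verProj π lam hχ σ (S.verMk χ π lam y a) = S.verMk χ π lam (S.uProj hχ σ y) a := rfl

end Setting

end

/-! ### Grading, weights and finiteness of baby Verma modules. -/

section

namespace Setting

variable {K : Type u} [Field K] {p : ℕ} {O : Type v} [CommRing O] [HopfAlgebra K O]
variable {X : Type w} [AddCommGroup X] {S : Setting K p O X}
variable {χ : Module.Dual K (lieAlg K O)} {I : Set X}
variable {A : Type x} [CommRing A] [Algebra K A] {π : U0 K X →ₐ[K] A} {lam : X}

/-- Condition (D) on the action of `U⁰` implies the independence of the weight spaces. -/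
lemma GrMod.wt_indep_of_act (M : S.GrMod χ I A) (σ : S.XI I)
    (hbot : ∀ ξ ∉ S.weights I σ, M.wt σ ξ = ⊥)
    (hact : ∀ μ : X, dchar μ ∈ S.weights I σ → ∀ (s : U0 K X), ∀ m ∈ M.wt σ (dchar μ),
      (S.u0 χ s ⊗ₜ[K] (1 : A)) • m = ((1 : S.U χ) ⊗ₜ[K] π (tilde μ s)) • m) :
    iSupIndep (M.wt σ) := by
  let _ : Module K M.carrier := Module.compHom _ (algebraMap K (S.U χ ⊗[K] A))
  have : IsScalarTower K (S.U χ ⊗[K] A) M.carrier :=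
    IsScalarTower.of_algebraMap_smul fun _ _ => rfl
  -- On the weight space of `dchar μ` the element `h` acts as `π(h) + dchar μ h`. Subtracting the
  -- action of `π(h)` leaves an operator with eigenvalue in `K`, even though `A` is only a
  -- commutative ring.
  refine iSupIndep_of_eigen (fun h : Cartan K X => Algebra.lsmul K K M.carrier
    (S.uh χ h ⊗ₜ[K] (1 : A) - 1 ⊗ₜ[K] π (UniversalEnvelopingAlgebra.ι K h)))
    (fun ξ h => ξ h) DFunLike.coe_injective _ fun ξ m hm h => ?_
  by_cases hξ : ξ ∈ S.weights I σ
  · obtain ⟨μ, τ, h1, rfl⟩ := id hξ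
    rw [Algebra.lsmul_coe]
    change (_ - _ : S.U χ ⊗[K] A) • m = _
    rw [sub_smul, uh, hact μ hξ _ m hm, tilde_ι, map_add, AlgHom.commutes,
      TensorProduct.tmul_add, add_smul, add_sub_cancel_left]
    have h2 : (1 : S.U χ) ⊗ₜ[K] (algebraMap K A) (dchar μ h) =
        algebraMap K (S.U χ ⊗[K] A) (dchar μ h) := by
      rw [Algebra.algebraMap_eq_smul_one, Algebra.algebraMap_eq_smul_one, TensorProduct.tmul_smul]
      rfl
    rw [h2, algebraMap_smul]
  · rw [hbot ξ hξ, AddSubgroup.mem_bot] at hm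
    rw [hm, map_zero, smul_zero]

variable (S χ) in
/-- The weight spaces of the adjoint action of `𝔥` on `U_χ`. -/
def uEig (ξ : Module.Dual K (Cartan K X)) : Submodule K (S.U χ) where
  carrier := {y | ∀ h, S.uAd χ h y = ξ h • y}
  add_mem' := fun {a b} ha hb h => by rw [map_add, ha h, hb h, smul_add]
  zero_mem' := fun h => by rw [map_zero, smul_zero]
  smul_mem' := fun c a ha h => by rw [map_smul, ha h, smul_comm]

lemma iSupIndep_uEig : iSupIndep (S.uEig χ) := by
  rw [iSupIndep_iff_finsetSum_eq_zero_imp_eq_zero]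
  intro s m hm h0
  exact eq_zero_of_sum_eigen (S.uAd χ) (fun (ξ : Module.Dual K (Cartan K X)) h => ξ h)
    DFunLike.coe_injective s m (fun i hi => hm i hi) h0

/-- The component of degree `σ` is spanned by monomials of weights `dchar ν` with `ν` in the coset
`σ`; any other eigenspace is independent of their sum. -/
lemma eq_zero_of_mem_uWt [Infinite K] [Module.Free ℤ X] {σ : S.XI I}
    {ξ : Module.Dual K (Cartan K X)} (hξ : ∀ ν, S.cls I ν = σ → dchar ν ≠ ξ) {y : S.U χ}
    (hy : y ∈ S.uWt χ I σ ξ) : y = 0 := by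
  have h1 : S.uGr χ I σ ≤ ⨆ (η) (_ : η ≠ ξ), S.uEig χ η := by
    rw [uGr, Submodule.span_le]
    rintro _ ⟨l, hl, rfl⟩
    obtain ⟨ν, h1, h2⟩ := S.list_prod_mem_uWt χ I l
    refine Submodule.mem_iSup_of_mem (dchar ν) (Submodule.mem_iSup_of_mem ?_ h2.2)
    exact hξ ν (h1.trans hl)
  exact Submodule.disjoint_def.mp (iSupIndep_uEig ξ) y hy.2 (h1 hy.1)

lemma verMk_mem_gr {σ : S.XI I} {y : S.U χ} (hy : y ∈ S.uGr χ I (σ - S.cls I lam)) (a : A) :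
    S.verMk χ π lam y a ∈ (S.babyVerma χ I A π lam).gr σ :=
  AddSubgroup.subset_closure ⟨y, hy, a, rfl⟩

lemma verMk_mem_wt {σ : S.XI I} {ξ : Module.Dual K (Cartan K X)} {y : S.U χ}
    (hy : y ∈ S.uWt χ I (σ - S.cls I lam) (ξ - dchar lam)) (a : A) :
    S.verMk χ π lam y a ∈ (S.babyVerma χ I A π lam).wt σ ξ :=
  AddSubgroup.subset_closure ⟨y, hy, a, rfl⟩

lemma gr_induction {σ : S.XI I} {P : S.Ver χ A π lam → Prop} (h0 : P 0)
    (hadd : ∀ z z', P z → P z' → P (z + z')) (hneg : ∀ z, P z → P (-z))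
    (hmk : ∀ y ∈ S.uGr χ I (σ - S.cls I lam), ∀ a, P (S.verMk χ π lam y a))
    {z : S.Ver χ A π lam} (hz : z ∈ (S.babyVerma χ I A π lam).gr σ) : P z := by
  refine AddSubgroup.closure_induction (p := fun z _ => P z) ?_ h0 (fun z z' _ _ => hadd z z')
    (fun z _ => hneg z) hz
  rintro _ ⟨y, hy, a, rfl⟩
  exact hmk y hy a

lemma wt_induction {σ : S.XI I} {ξ : Module.Dual K (Cartan K X)} {P : S.Ver χ A π lam → Prop}
    (h0 : P 0)
    (hadd : ∀ z z', P z → P z' → P (z + z')) (hneg : ∀ z, P z → P (-z))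
    (hmk : ∀ y ∈ S.uWt χ I (σ - S.cls I lam) (ξ - dchar lam), ∀ a, P (S.verMk χ π lam y a))
    {z : S.Ver χ A π lam} (hz : z ∈ (S.babyVerma χ I A π lam).wt σ ξ) : P z := by
  refine AddSubgroup.closure_induction (p := fun z _ => P z) ?_ h0 (fun z z' _ _ => hadd z z')
    (fun z _ => hneg z) hz
  rintro _ ⟨y, hy, a, rfl⟩
  exact hmk y hy a

lemma verProj_of_mem [Infinite K] [Module.Free ℤ X] (hχ : S.IsStandardLevi χ I) {σ : S.XI I}
    {z : S.Ver χ A π lam} (hz : z ∈ (S.babyVerma χ I A π lam).gr σ) :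
    S.verProj π lam hχ (σ - S.cls I lam) z = z := by
  refine gr_induction (P := fun z => S.verProj π lam hχ (σ - S.cls I lam) z = z) (map_zero _)
    (fun z z' h h' => ?_) (fun z h => ?_) (fun y hy a => ?_) hz
  · rw [map_add, h, h']
  · rw [map_neg, h]
  · rw [verProj_verMk, uProj_of_mem _ hχ hy]

lemma verProj_of_mem_of_ne [Infinite K] [Module.Free ℤ X] (hχ : S.IsStandardLevi χ I)
    {σ τ : S.XI I} (hne : τ ≠ σ) {z : S.Ver χ A π lam}
    (hz : z ∈ (S.babyVerma χ I A π lam).gr τ) :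
    S.verProj π lam hχ (σ - S.cls I lam) z = 0 := by
  refine gr_induction (P := fun z => S.verProj π lam hχ (σ - S.cls I lam) z = 0) (map_zero _)
    (fun z z' h h' => ?_) (fun z h => ?_) (fun y hy a => ?_) hz
  · rw [map_add, h, h', add_zero]
  · rw [map_neg, h, neg_zero]
  · rw [verProj_verMk, uProj_of_mem_of_ne _ hχ (fun h => hne (sub_left_injective h)) hy, verMk_zero]

variable (S χ I π lam) in
lemma babyVerma_gr_indep [Infinite K] [Module.Free ℤ X] (hχ : S.IsStandardLevi χ I) :
    iSupIndep (S.babyVerma χ I A π lam).gr := by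
  classical
  refine (addSubgroup_iSupIndep_iff (V := S.Ver χ A π lam) _).mpr ?_
  intro s m hm h0 σ hσ
  have h1 : ∀ τ ∈ s, S.verProj π lam hχ (σ - S.cls I lam) (m τ) =
      if τ = σ then m σ else 0 := by
    intro τ hτ
    split_ifs with h
    · subst h
      exact verProj_of_mem hχ (hm _ hτ)
    · exact verProj_of_mem_of_ne hχ h (hm τ hτ)
  have h2 := congrArg (S.verProj π lam hχ (σ - S.cls I lam)) h0
  rw [map_sum, map_zero, Finset.sum_congr rfl h1, Finset.sum_ite_eq' s σ, if_pos hσ] at h2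
  exact h2

/-- The projection of every element to a homogeneous component is a combination of short words. -/
lemma verProj_mem_closure [Infinite K] [Module.Free ℤ X] (hχ : S.IsStandardLevi χ I) {k : ℕ}
    (hk : ∀ l : List S.Neg, k ≤ l.length → S.word χ l = 0) (σ : S.XI I) (z : S.Ver χ A π lam) :
    S.verProj π lam hχ σ z ∈ AddSubgroup.closure {m | ∃ (a : A) (l : List S.Neg), l.length < k ∧
      (l.map fun α => S.cls I α.1.1).sum = σ ∧ m = S.verMk χ π lam (S.word χ l) a} := by
  have hz : z ∈ AddSubgroup.closure {z | ∃ l a, z = S.verMk χ π lam (S.word χ l) a} := by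
    rw [closure_word_eq_top]; trivial
  induction hz using AddSubgroup.closure_induction with
  | mem z hz =>
    obtain ⟨l, a, rfl⟩ := hz
    rw [verProj_verMk]
    by_cases hl : k ≤ l.length
    · rw [hk l hl, map_zero, verMk_zero]
      exact AddSubgroup.zero_mem _
    by_cases hσ : (l.map fun α => S.cls I α.1.1).sum = σ
    · rw [uProj_of_mem _ hχ (hσ ▸ S.word_mem_uGr hχ l)]
      exact AddSubgroup.subset_closure ⟨a, l, not_le.mp hl, hσ, rfl⟩
    · rw [uProj_of_mem_of_ne _ hχ hσ (S.word_mem_uGr hχ l), verMk_zero]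
      exact AddSubgroup.zero_mem _
  | zero => rw [map_zero]; exact AddSubgroup.zero_mem _
  | add _ _ _ _ h1 h2 => rw [map_add]; exact AddSubgroup.add_mem _ h1 h2
  | neg _ _ h => rw [map_neg]; exact AddSubgroup.neg_mem _ h

variable (S χ I π lam) in
-- Words of length at least `k` vanish, and there are finitely many shorter ones because `R` is
-- finite.
lemma babyVerma_gr_fg [Infinite K] [Module.Free ℤ X] [Finite S.R]
    (hχ : S.IsStandardLevi χ I) {k : ℕ}
    (hk : ∀ l : List S.Neg, k ≤ l.length → S.word χ l = 0) (σ : S.XI I) :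
    ∃ s : Finset (S.Ver χ A π lam), (S.babyVerma χ I A π lam).gr σ =
      AddSubgroup.closure {m | ∃ a : A, ∃ y ∈ s, m = ((1 : S.U χ) ⊗ₜ[K] a) • y} := by
  classical
  have hfin : {l : List S.Neg | l.length < k}.Finite := List.finite_length_lt _ _
  refine ⟨((hfin.subset (Set.sep_subset _ fun l =>
    (l.map fun α => S.cls I α.1.1).sum = σ - S.cls I lam)).image fun l =>
      S.verMk χ π lam (S.word χ l) 1).toFinset, le_antisymm ?_ ?_⟩
  · intro (z : S.Ver χ A π lam) hz
    have h1 := verProj_mem_closure hχ hk (σ - S.cls I lam) z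
    rw [verProj_of_mem hχ hz] at h1
    refine AddSubgroup.closure_mono ?_ h1
    rintro _ ⟨a, l, hl, hd, rfl⟩
    refine ⟨a, S.verMk χ π lam (S.word χ l) 1, ?_, ?_⟩
    · rw [Set.Finite.mem_toFinset]
      exact ⟨l, ⟨hl, hd⟩, rfl⟩
    · rw [one_smul_verMk, mul_one]
  · refine (AddSubgroup.closure_le (G := S.Ver χ A π lam) _).mpr ?_
    rintro _ ⟨a, y, hy, rfl⟩
    rw [Set.Finite.mem_toFinset] at hy
    obtain ⟨l, ⟨hl, hd⟩, rfl⟩ := hy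
    rw [one_smul_verMk]
    exact verMk_mem_gr (hd ▸ S.word_mem_uGr hχ l) _

variable (S χ I π lam) in
/-- Baby Verma modules are objects of the category. -/
theorem babyVerma_isObject [Infinite K] [Module.Free ℤ X] [Fact p.Prime] [CharP K p] [Finite S.R]
    (hχ : S.IsStandardLevi χ I) : (S.babyVerma χ I A π lam).IsObject π := by
  obtain ⟨k, hk⟩ := S.exists_word_eq_zero hχ
  have hbot : ∀ σ, ∀ ξ ∉ S.weights I σ, (S.babyVerma χ I A π lam).wt σ ξ = ⊥ := by
    intro σ ξ hξ
    rw [eq_bot_iff]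
    intro z hz
    refine wt_induction (P := fun z => z ∈ (⊥ : AddSubgroup (S.Ver χ A π lam)))
      (AddSubgroup.zero_mem _) (fun _ _ => AddSubgroup.add_mem _) (fun _ => AddSubgroup.neg_mem _)
      (fun y hy a => ?_) hz
    rw [eq_zero_of_mem_uWt (fun ν hν hd => hξ ?_) hy, verMk_zero]
    · exact AddSubgroup.zero_mem _
    -- The class of `ν + lam` is already `σ`, so no element of `pX` is needed.
    · refine ⟨ν + lam, 0, ?_, ?_⟩
      · rw [smul_zero, sub_zero, cls_add, hν, sub_add_cancel]
      · rw [dchar_add, hd, sub_add_cancel]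
  have hact : ∀ (σ : S.XI I) (μ : X), dchar μ ∈ S.weights I σ → ∀ (s : U0 K X),
      ∀ m ∈ (S.babyVerma χ I A π lam).wt σ (dchar μ),
      (S.u0 χ s ⊗ₜ[K] (1 : A)) • m = ((1 : S.U χ) ⊗ₜ[K] π (tilde μ s)) • m := by
    intro σ μ _ s m hm
    refine wt_induction (P := fun m : S.Ver χ A π lam => (S.u0 χ s ⊗ₜ[K] (1 : A)) • m =
      ((1 : S.U χ) ⊗ₜ[K] π (tilde μ s)) • m) ?_ (fun _ _ h h' => ?_) (fun _ h => ?_)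
      (fun y hy a => ?_) hm
    · rw [smul_zero, smul_zero]
    · rw [smul_add, smul_add, h, h']
    · rw [smul_neg, smul_neg, h]
    · rw [← dchar_sub] at hy
      -- Passing `s` through a vector of weight `d(μ - lam)` shifts by `μ - lam`, and the generator
      -- shifts by `lam`; the shifts compose to `μ`.
      rw [smul_one_verMk, one_smul_verMk, S.u0_mul_of_mem_uWt χ I hy, verMk_mul_u0, tilde_tilde,
        add_sub_cancel, mul_comm]
  have hle : ∀ σ ξ, (S.babyVerma χ I A π lam).wt σ ξ ≤ (S.babyVerma χ I A π lam).gr σ := by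
    intro σ ξ
    refine AddSubgroup.closure_mono ?_
    rintro _ ⟨y, hy, a, rfl⟩
    exact ⟨y, hy.1, a, rfl⟩
  have hfin : {l : List S.Neg | l.length < k}.Finite := List.finite_length_lt _ _
  refine
    { gr_indep := babyVerma_gr_indep S χ I π lam hχ
      gr_top := ?_
      gr_smul := ?_
      gr_finite := ?_
      gr_fg := ?_
      gr_mul := ?_
      wt_indep := fun σ => GrMod.wt_indep_of_act _ σ (hbot σ) (hact σ)
      wt_sum := ?_
      wt_bot := hbot
      wt_act := hact
      wt_root := ?_
      wt_smul := ?_ }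
  · rw [eq_top_iff]
    intro z _
    refine S.ver_induction χ π lam (AddSubgroup.zero_mem _) (fun _ _ => AddSubgroup.add_mem _)
      (fun y a => ?_) z
    have hy : y ∈ ⨆ σ, S.uGr χ I σ := by rw [iSup_uGr]; trivial
    induction hy using Submodule.iSup_induction' with
    | mem σ y hy =>
      refine AddSubgroup.mem_iSup_of_mem (σ + S.cls I lam) (verMk_mem_gr ?_ a)
      rwa [add_sub_cancel_right]
    | zero => rw [verMk_zero]; exact AddSubgroup.zero_mem _
    | add y z _ _ h1 h2 => rw [verMk_add]; exact AddSubgroup.add_mem _ h1 h2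
  · intro σ b m hm
    refine gr_induction (P := fun m : S.Ver χ A π lam => ((1 : S.U χ) ⊗ₜ[K] b) • m ∈
      (S.babyVerma χ I A π lam).gr σ) ?_ (fun _ _ h h' => ?_) (fun _ h => ?_) (fun y hy a => ?_) hm
    · rw [smul_zero]; exact AddSubgroup.zero_mem _
    · rw [smul_add]; exact AddSubgroup.add_mem _ h h'
    · rw [smul_neg]; exact AddSubgroup.neg_mem _ h
    · rw [one_smul_verMk]; exact verMk_mem_gr hy _
  -- Only degrees of words shorter than `k`, translated by `lam`, can occur.
  · refine (hfin.image fun l => (l.map fun α => S.cls I α.1.1).sum + S.cls I lam).subset ?_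
    intro σ hσ
    by_contra hn
    apply hσ
    rw [eq_bot_iff]
    intro z hz
    have h1 := verProj_mem_closure hχ hk (σ - S.cls I lam) z
    rw [verProj_of_mem hχ hz] at h1
    refine (AddSubgroup.closure_le _).mpr ?_ h1
    rintro _ ⟨a, l, hl, hd, rfl⟩
    exact (hn ⟨l, hl, by simp only [hd, sub_add_cancel]⟩).elim
  · exact babyVerma_gr_fg S χ I π lam hχ hk
  · intro σ τ u hu m hm
    refine gr_induction (P := fun m : S.Ver χ A π lam => (u ⊗ₜ[K] (1 : A)) • m ∈
      (S.babyVerma χ I A π lam).gr (σ + τ)) ?_ (fun _ _ h h' => ?_) (fun _ h => ?_)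
      (fun y hy a => ?_) hm
    · rw [smul_zero]; exact AddSubgroup.zero_mem _
    · rw [smul_add]; exact AddSubgroup.add_mem _ h h'
    · rw [smul_neg]; exact AddSubgroup.neg_mem _ h
    · rw [smul_one_verMk]
      refine verMk_mem_gr ?_ _
      rw [add_sub_assoc]
      exact S.mul_mem_uGr χ I hu hy
  · intro σ
    refine le_antisymm (iSup_le (hle σ)) ?_
    intro z hz
    refine gr_induction (P := fun m => m ∈ ⨆ ξ, (S.babyVerma χ I A π lam).wt σ ξ)
      (AddSubgroup.zero_mem _) (fun _ _ => AddSubgroup.add_mem _) (fun _ => AddSubgroup.neg_mem _)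
      (fun y hy a => ?_) hz
    rw [uGr] at hy
    induction hy using Submodule.span_induction generalizing a with
    | mem y hy =>
      obtain ⟨l, hl, rfl⟩ := hy
      obtain ⟨ν, h1, h2⟩ := S.list_prod_mem_uWt χ I l
      refine AddSubgroup.mem_iSup_of_mem (dchar ν + dchar lam) (verMk_mem_wt ?_ a)
      rw [add_sub_cancel_right, ← hl, ← h1]
      exact h2
    | zero => rw [verMk_zero]; exact AddSubgroup.zero_mem _
    | add y z _ _ h1 h2 => rw [verMk_add]; exact AddSubgroup.add_mem _ (h1 a) (h2 a)
    | smul c y _ h => rw [verMk_smul]; exact h _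
  · intro σ μ α _ m hm
    refine wt_induction (P := fun m : S.Ver χ A π lam => (S.ue χ α ⊗ₜ[K] (1 : A)) • m ∈
      (S.babyVerma χ I A π lam).wt (S.cls I α.1 + σ) (dchar (μ + α.1))) ?_ (fun _ _ h h' => ?_)
      (fun _ h => ?_) (fun y hy a => ?_) hm
    · rw [smul_zero]; exact AddSubgroup.zero_mem _
    · rw [smul_add]; exact AddSubgroup.add_mem _ h h'
    · rw [smul_neg]; exact AddSubgroup.neg_mem _ h
    · rw [smul_one_verMk]
      refine verMk_mem_wt ?_ _
      rw [add_sub_assoc, add_comm μ, dchar_add, add_sub_assoc]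
      exact S.mul_mem_uWt χ I (S.ue_mem_uWt χ I α) hy
  · intro σ ξ b m hm
    refine wt_induction (P := fun m : S.Ver χ A π lam => ((1 : S.U χ) ⊗ₜ[K] b) • m ∈
      (S.babyVerma χ I A π lam).wt σ ξ) ?_ (fun _ _ h h' => ?_) (fun _ h => ?_)
      (fun y hy a => ?_) hm
    · rw [smul_zero]; exact AddSubgroup.zero_mem _
    · rw [smul_add]; exact AddSubgroup.add_mem _ h h'
    · rw [smul_neg]; exact AddSubgroup.neg_mem _ h
    · rw [one_smul_verMk]; exact verMk_mem_wt hy _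

end Setting

end

section

namespace Setting

variable {K : Type u} [Field K] {p : ℕ} {O : Type v} [CommRing O] [HopfAlgebra K O]
variable {X : Type w} [AddCommGroup X] {S : Setting K p O X}
variable {χ : Module.Dual K (lieAlg K O)} {I : Set X}

/-! ### Baby Verma modules are non-zero -/

variable (S) in
/-- The subspace of elements whose coefficients outside the negative root vectors vanish. -/
def negSub : Submodule K (lieAlg K O) where
  carrier := {x | ∀ b, (∀ α : S.Neg, b ≠ Sum.inl α.1) → S.basis.repr x b = 0}
  add_mem' := fun {x y} hx hy b hb => by
    rw [map_add, Finsupp.add_apply, hx b hb, hy b hb, add_zero]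
  zero_mem' := fun b _ => by rw [map_zero, Finsupp.zero_apply]
  smul_mem' := fun c x hx b hb => by
    rw [map_smul, Finsupp.smul_apply, hx b hb, smul_zero]

lemma e_mem_negSub (α : S.Neg) : S.e α.1 ∈ S.negSub := by
  intro b hb
  simp [e, (hb α).symm]

/-- To prove a linear statement on `𝔫⁻` it suffices to check it on the negative root vectors. -/
lemma negSub_eq_span : S.negSub = Submodule.span K (Set.range fun α : S.Neg => S.e α.1) := by
  refine le_antisymm (fun x hx => ?_) ?_
  · rw [← S.basis.linearCombination_repr x, Finsupp.linearCombination_apply]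
    refine Submodule.sum_mem _ fun b _ => ?_
    by_cases hb : ∀ α : S.Neg, b ≠ Sum.inl α.1
    · change S.basis.repr x b • _ ∈ _
      rw [hx b hb, zero_smul]
      exact Submodule.zero_mem _
    · push Not at hb
      obtain ⟨α, rfl⟩ := hb
      exact Submodule.smul_mem _ _ (Submodule.subset_span ⟨α, rfl⟩)
  · rw [Submodule.span_le]
    rintro _ ⟨α, rfl⟩
    exact e_mem_negSub α

lemma lie_mem_of_span {L : Type v} [LieRing L] [LieAlgebra K L] {s t : Set L} {N : Submodule K L}
    (h : ∀ x ∈ s, ∀ y ∈ t, ⁅x, y⁆ ∈ N) {x y : L} (hx : x ∈ Submodule.span K s)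
    (hy : y ∈ Submodule.span K t) : ⁅x, y⁆ ∈ N := by
  induction hx using Submodule.span_induction with
  | mem x hx =>
    induction hy using Submodule.span_induction with
    | mem y hy => exact h x hx y hy
    | zero => rw [lie_zero]; exact N.zero_mem
    | add _ _ _ _ h1 h2 => rw [lie_add]; exact N.add_mem h1 h2
    | smul c _ _ h => rw [lie_smul]; exact N.smul_mem c h
  | zero => rw [zero_lie]; exact N.zero_mem
  | add _ _ _ _ h1 h2 => rw [add_lie]; exact N.add_mem h1 h2
  | smul c _ _ h => rw [smul_lie]; exact N.smul_mem c h

variable (S) in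
/-- The Lie algebra `𝔫⁻` spanned by the negative root vectors. -/
def negLie [Infinite K] [Module.Free ℤ X] : LieSubalgebra K (lieAlg K O) :=
  { S.negSub with
    lie_mem' := by
      intro x y hx hy
      change ⁅x, y⁆ ∈ S.negSub
      have hx : x ∈ S.negSub := hx
      have hy : y ∈ S.negSub := hy
      rw [negSub_eq_span] at hx hy
      refine lie_mem_of_span ?_ hx hy
      rintro _ ⟨α, rfl⟩ _ ⟨β, rfl⟩
      rcases S.lie_e_neg α β with h | ⟨γ, c, -, h⟩
      · simp only [h]
        exact Submodule.zero_mem _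
      · simp only [h]
        exact Submodule.smul_mem _ _ (e_mem_negSub γ) }

open Classical in
variable (S) in
/-- The projection `𝔤 → 𝔫⁻`. -/
def negProj [Infinite K] [Module.Free ℤ X] : lieAlg K O →ₗ[K] S.negLie :=
  S.basis.constr K (Sum.elim
    (fun α => if h : α.1 ∈ S.pos then 0 else ⟨S.e α, e_mem_negSub ⟨α, h⟩⟩) fun _ => 0)

lemma negProj_e_neg [Infinite K] [Module.Free ℤ X] (α : S.Neg) :
    (S.negProj (S.e α.1) : lieAlg K O) = S.e α.1 := by
  rw [negProj, e, Module.Basis.constr_basis, Sum.elim_inl, dif_neg α.2]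
  rfl

lemma negProj_e_pos [Infinite K] [Module.Free ℤ X] {α : S.R} (hα : α.1 ∈ S.pos) :
    S.negProj (S.e α) = 0 := by
  rw [negProj, e, Module.Basis.constr_basis, Sum.elim_inl, dif_pos hα]

lemma negProj_lieMap [Infinite K] [Module.Free ℤ X] (h : Cartan K X) :
    S.negProj (lieMap S.torus h) = 0 := by
  rw [negProj, Module.Basis.constr_apply]
  refine Finset.sum_eq_zero fun b _ => ?_
  rcases b with α | i
  · change S.basis.repr _ _ • _ = _
    rw [S.repr_eq_zero (lieMap_mem_weightSpace S.torus h) (b := Sum.inl α) α.2.1, zero_smul]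
  · exact smul_zero _

lemma negProj_coe [Infinite K] [Module.Free ℤ X] (x : S.negLie) : S.negProj x = x := by
  have hx : (x : lieAlg K O) ∈ S.negSub := x.2
  apply Subtype.ext
  rw [negSub_eq_span] at hx
  generalize (x : lieAlg K O) = y at hx
  induction hx using Submodule.span_induction with
  | mem y hy =>
    obtain ⟨α, rfl⟩ := hy
    exact negProj_e_neg α
  | zero => rw [map_zero]; rfl
  | add y z _ _ h1 h2 =>
    rw [map_add]
    exact congrArg₂ (· + ·) h1 h2
  | smul c y _ h =>
    rw [map_smul]
    exact congrArg (c • ·) h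

variable (S) in
/-- The basis vectors of `𝔤` which span `𝔟`. -/
def borelVecs : Set (lieAlg K O) :=
  {x | (∃ α : S.R, α.1 ∈ S.pos ∧ x = S.e α) ∨ ∃ h, x = lieMap S.torus h}

lemma coproj_mem_span [Infinite K] [Module.Free ℤ X] (x : lieAlg K O) :
    coproj S.negLie S.negProj x ∈ Submodule.span K S.borelVecs := by
  rw [← S.basis.linearCombination_repr x, Finsupp.linearCombination_apply, map_finsuppSum]
  refine Submodule.sum_mem _ fun b _ => ?_
  change coproj S.negLie S.negProj (_ • _) ∈ _
  rw [map_smul]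
  refine Submodule.smul_mem _ _ ?_
  rcases b with α | i
  · change coproj S.negLie S.negProj (S.e α) ∈ _
    rw [coproj_apply]
    by_cases hα : α.1 ∈ S.pos
    · rw [negProj_e_pos hα]
      refine Submodule.subset_span (Or.inl ⟨α, hα, ?_⟩)
      simp
    · rw [negProj_e_neg ⟨α, hα⟩, sub_self]
      exact Submodule.zero_mem _
  · obtain ⟨h, hh⟩ := S.basis_cartan i
    rw [hh, coproj_apply, negProj_lieMap]
    refine Submodule.subset_span (Or.inr ⟨h, ?_⟩)
    simp

lemma lie_e_pos [Infinite K] [Module.Free ℤ X] {α β : S.R} (hα : α.1 ∈ S.pos) (hβ : β.1 ∈ S.pos) :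
    ⁅S.e α, S.e β⁆ = 0 ∨ ∃ (γ : S.R) (c : K), γ.1 ∈ S.pos ∧ ⁅S.e α, S.e β⁆ = c • S.e γ := by
  have hm := lie_mem_weightSpace _ (S.e_mem α) (S.e_mem β)
  have h1 := S.one_le_ht hα
  have h2 := S.one_le_ht hβ
  have hadd : S.ht (α.1 + β.1) = S.ht α.1 + S.ht β.1 := map_add _ _ _
  by_cases hR : α.1 + β.1 ∈ S.R
  · exact Or.inr ⟨⟨_, hR⟩, _, (S.mem_pos_iff hR).mpr (by linarith), S.eq_smul_e (α := ⟨_, hR⟩) hm⟩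
  · left
    refine S.eq_zero_of_not_root (fun h => ?_) hR hm
    rw [h, map_zero] at hadd
    linarith

/-- A bracket of two elements of `𝔟` lies in the span of the positive root vectors. -/
lemma lie_coproj_mem [Infinite K] [Module.Free ℤ X] (x y : lieAlg K O) :
    ⁅coproj S.negLie S.negProj x, coproj S.negLie S.negProj y⁆ ∈
      Submodule.span K {x | ∃ α : S.R, α.1 ∈ S.pos ∧ x = S.e α} := by
  refine lie_mem_of_span ?_ (coproj_mem_span x) (coproj_mem_span y)
  have he : ∀ α : S.R, α.1 ∈ S.pos → S.e α ∈
      Submodule.span K {x | ∃ α : S.R, α.1 ∈ S.pos ∧ x = S.e α} := fun α hα =>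
    Submodule.subset_span ⟨α, hα, rfl⟩
  rintro _ (⟨α, hα, rfl⟩ | ⟨h, rfl⟩) _ (⟨β, hβ, rfl⟩ | ⟨h', rfl⟩)
  · rcases lie_e_pos hα hβ with h | ⟨γ, c, hγ, h⟩
    · rw [h]; exact Submodule.zero_mem _
    · rw [h]; exact Submodule.smul_mem _ _ (he γ hγ)
  · rw [← lie_skew, lie_weightSpace _ (S.e_mem α)]
    exact Submodule.neg_mem _ (Submodule.smul_mem _ _ (he α hα))
  · rw [lie_weightSpace _ (S.e_mem β)]
    exact Submodule.smul_mem _ _ (he β hβ)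
  · rw [← LieHom.map_lie, cartan_lie, map_zero (lieMap S.torus)]
    exact Submodule.zero_mem _

variable {F : Type x} [Field F] [Algebra K F] (π : U0 K X →ₐ[K] F) (lam : X)

variable (S) in
/-- The character of `𝔟` on the highest weight vector, extended to `𝔤`. -/
def borelChar : lieAlg K O →ₗ[K] F :=
  S.basis.constr K (Sum.elim (fun _ => 0)
    fun i => π (tilde lam (UniversalEnvelopingAlgebra.ι K (S.basis_cartan i).choose)))

lemma borelChar_e (α : S.R) : S.borelChar π lam (S.e α) = 0 := by
  rw [borelChar, e, Module.Basis.constr_basis, Sum.elim_inl]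

/-- `borelChar` is prescribed through chosen preimages of the basis vectors in `𝔥`. These vectors
span the image of `𝔥`, and injectivity of `lieMap` makes the choice harmless. -/
lemma borelChar_lieMap [Infinite K] [Module.Free ℤ X] (h : Cartan K X) :
    S.borelChar π lam (lieMap S.torus h) = π (tilde lam (UniversalEnvelopingAlgebra.ι K h)) := by
  let f : Cartan K X →ₗ[K] F := π.toLinearMap ∘ₗ (tilde lam).toLinearMap ∘ₗ
    (UniversalEnvelopingAlgebra.ι K : Cartan K X →ₗ⁅K⁆ _).toLinearMap
  change _ = f h
  let T : Cartan K X →ₗ[K] lieAlg K O := lieMap S.torus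
  have h1 : T h ∈ Submodule.map T (LinearMap.eqLocus (S.borelChar π lam ∘ₗ T) f) := by
    rw [← S.basis.linearCombination_repr (T h), Finsupp.linearCombination_apply]
    refine Submodule.sum_mem _ fun b _ => ?_
    rcases b with α | i
    · change S.basis.repr (lieMap S.torus h) _ • _ ∈ _
      rw [S.repr_eq_zero (lieMap_mem_weightSpace S.torus h) (b := Sum.inl α) α.2.1, zero_smul]
      exact Submodule.zero_mem _
    · refine Submodule.smul_mem _ _ ⟨(S.basis_cartan i).choose, ?_,
        (S.basis_cartan i).choose_spec.symm⟩
      change S.borelChar π lam (lieMap S.torus _) = _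
      rw [← (S.basis_cartan i).choose_spec, borelChar, Module.Basis.constr_basis]
      rfl
  obtain ⟨h', hh', he⟩ := h1
  rw [← lieMap_injective S.torus S.torus_max.1 he]
  exact hh'

/-- There is a functional on `U(𝔤)` which is `χ`-equivariant for `𝔫⁻` and `lam`-equivariant
for `𝔟`. -/
lemma exists_functional [Infinite K] [Module.Free ℤ X] (hχ : S.IsStandardLevi χ I) :
    ∃ θ : UniversalEnvelopingAlgebra K (lieAlg K O) →ₗ[K] F, θ 1 = 1 ∧
      (∀ (α : S.Neg) u, θ (UniversalEnvelopingAlgebra.ι K (S.e α.1) * u) =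
        algebraMap K F (χ (S.e α.1)) * θ u) ∧
      (∀ (α : S.R) u, α.1 ∈ S.pos → θ (u * UniversalEnvelopingAlgebra.ι K (S.e α)) = 0) ∧
      ∀ h u, θ (u * UniversalEnvelopingAlgebra.ι K (lieMap S.torus h)) =
        θ u * π (tilde lam (UniversalEnvelopingAlgebra.ι K h)) := by
  have hspan : ∀ x ∈ Submodule.span K {x | ∃ α : S.R, α.1 ∈ S.pos ∧ x = S.e α},
      S.negProj x = 0 ∧ S.borelChar π lam x = 0 := by
    intro x hx
    induction hx using Submodule.span_induction with
    | mem x hx =>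
      obtain ⟨α, hα, rfl⟩ := hx
      exact ⟨negProj_e_pos hα, borelChar_e π lam α⟩
    | zero => exact ⟨map_zero _, map_zero _⟩
    | add x y _ _ h1 h2 =>
      exact ⟨by rw [map_add, h1.1, h2.1, add_zero], by rw [map_add, h1.2, h2.2, add_zero]⟩
    | smul c x _ h => exact ⟨by rw [map_smul, h.1, smul_zero], by rw [map_smul, h.2, smul_zero]⟩
  obtain ⟨θ, h1, h2, h3⟩ := exists_whittaker_functional S.negLie (pn := S.negProj) negProj_coe
    (S.borelChar π lam) (fun x y => (hspan _ (lie_coproj_mem x y)).1)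
    (fun x y => (hspan _ (lie_coproj_mem x y)).2) (χ ∘ₗ S.negLie.toSubmodule.subtype) (by
      intro x y
      change ⁅(x : lieAlg K O), (y : lieAlg K O)⁆ ∈ LinearMap.ker χ
      have hx : (x : lieAlg K O) ∈ S.negSub := x.2
      have hy : (y : lieAlg K O) ∈ S.negSub := y.2
      rw [negSub_eq_span] at hx hy
      refine lie_mem_of_span ?_ hx hy
      rintro _ ⟨α, rfl⟩ _ ⟨β, rfl⟩
      rcases S.lie_e_neg α β with h | ⟨γ, c, hγ, h⟩
      · simp only [h]
        exact Submodule.zero_mem _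
      · simp only [h, LinearMap.mem_ker, map_smul]
        rw [S.chi_e_eq_zero_of_ht hχ (by linarith [S.ht_neg α, S.ht_neg β]), smul_zero])
  refine ⟨θ, h1, fun α u => h2 ⟨S.e α.1, e_mem_negSub α⟩ u, fun α u hα => ?_, fun h u => ?_⟩
  · rw [h3 u _ (negProj_e_pos hα), borelChar_e, mul_zero]
  · rw [h3 u _ (negProj_lieMap h), borelChar_lieMap]

/-- The functional descends to `U_χ`. -/
lemma exists_functional_U [Infinite K] [Module.Free ℤ X] [Fact p.Prime] [CharP K p]
    (hp : S.IsGood) (hχ : S.IsStandardLevi χ I) :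
    ∃ θ : S.U χ →ₗ[K] F, θ 1 = 1 ∧ (∀ (α : S.R) u, α.1 ∈ S.pos → θ (u * S.ue χ α) = 0) ∧
      ∀ s u, θ (u * S.u0 χ s) = θ u * π (tilde lam s) := by
  obtain ⟨θ, h1, h2, h3, h4⟩ := exists_functional (F := F) π lam hχ
  have hpos : 0 < p := (Fact.out : p.Prime).pos
  have hneg : ∀ (α : S.Neg) (n : ℕ) u, θ (UniversalEnvelopingAlgebra.ι K (S.e α.1) ^ n * u) =
      algebraMap K F (χ (S.e α.1) ^ n) * θ u := by
    intro α n u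
    induction n with
    | zero => simp
    | succ n ih =>
      rw [pow_succ', mul_assoc, h2, ih, pow_succ', map_mul, mul_assoc]
  -- The congruence of elements that `θ` cannot distinguish inside any product. It is two-sided, so
  -- `θ` descends once the defining relations of `U_χ` belong to it.
  let c : RingCon (UniversalEnvelopingAlgebra K (lieAlg K O)) :=
    { r := fun a b => ∀ u v, θ (u * a * v) = θ (u * b * v)
      iseqv := ⟨fun _ _ _ => rfl, fun h u v => (h u v).symm,
        fun h h' u v => (h u v).trans (h' u v)⟩
      mul' := fun {a b a' b'} h h' u v => by
        have e1 := h u (a' * v)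
        have e2 := h' (u * b) v
        simp only [mul_assoc] at e1 e2 ⊢
        rw [e1, e2]
      add' := fun {a b a' b'} h h' u v => by
        rw [mul_add, mul_add, add_mul, add_mul, map_add, map_add, h u v, h' u v] }
  have hrel : ∀ ⦃a b⦄, S.uRel χ a b → c.mk' a = c.mk' b := by
    rintro _ _ ⟨α, rfl, rfl⟩
    refine (RingCon.eq c).mpr fun u v => ?_
    -- By centrality `e_α ^ p` can be placed at either end of a product: on the right for positive
    -- `α`, where `θ` vanishes, and on the left for negative `α`, where `θ` is `χ`-equivariant.
    rw [← (S.commute_ι_e_pow hp α u).eq]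
    by_cases hα : α.1 ∈ S.pos
    · rw [hχ.borel _ (S.e_mem_borel hα), zero_pow hpos.ne', map_zero, mul_zero, zero_mul, map_zero,
        mul_assoc, (S.commute_ι_e_pow hp α (u * v)).eq]
      obtain ⟨n, hn⟩ := Nat.exists_eq_succ_of_ne_zero hpos.ne'
      rw [show UniversalEnvelopingAlgebra.ι K (S.e α) ^ p =
        UniversalEnvelopingAlgebra.ι K (S.e α) ^ n * UniversalEnvelopingAlgebra.ι K (S.e α) from by
          rw [← pow_succ]; exact congrArg _ hn, ← mul_assoc, h3 α _ hα]
    · rw [mul_assoc, hneg ⟨α, hα⟩, ← Algebra.smul_def, ← Algebra.commutes, mul_assoc,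
        ← Algebra.smul_def, map_smul]
  have hker : LinearMap.ker (S.toU χ).toLinearMap ≤ LinearMap.ker θ := by
    intro z hz
    rw [LinearMap.mem_ker] at hz ⊢
    have e1 : (RingQuot.lift ⟨c.mk', hrel⟩) (RingQuot.mkRingHom (S.uRel χ) z) = c.mk' z :=
      RingQuot.lift_mkRingHom_apply _ _ _
    have e2 : RingQuot.mkRingHom (S.uRel χ) z = 0 := by
      rw [← RingQuot.mkAlgHom_coe K]
      exact hz
    rw [e2, map_zero, ← map_zero c.mk'] at e1
    have := (RingCon.eq c).mp e1 1 1
    simpa using this.symm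
  let θU : S.U χ →ₗ[K] F := (LinearMap.ker (S.toU χ).toLinearMap).liftQ θ hker ∘ₗ
    ((S.toU χ).toLinearMap.quotKerEquivOfSurjective (S.toU_surjective χ)).symm.toLinearMap
  have hθU : ∀ z, θU (S.toU χ z) = θ z := by
    intro z
    have : ((S.toU χ).toLinearMap.quotKerEquivOfSurjective (S.toU_surjective χ)).symm
        (S.toU χ z) = Submodule.Quotient.mk z := by
      rw [LinearEquiv.symm_apply_eq]
      rfl
    change (LinearMap.ker (S.toU χ).toLinearMap).liftQ θ hker (LinearEquiv.symm _ _) = _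
    rw [this]
    rfl
  refine ⟨θU, ?_, ?_, ?_⟩
  · rw [← map_one (S.toU χ), hθU, h1]
  · intro α u hα
    obtain ⟨u, rfl⟩ := S.toU_surjective χ u
    rw [ue, ← map_mul, hθU, h3 α u hα]
  · let B : Subalgebra K (U0 K X) :=
      { carrier := {s | ∀ u, θU (u * S.u0 χ s) = θU u * π (tilde lam s)}
        mul_mem' := fun {a b} ha hb u => by
          rw [map_mul (S.u0 χ), ← mul_assoc, hb, ha, map_mul, map_mul, mul_assoc]
        add_mem' := fun {a b} ha hb u => by
          rw [map_add (S.u0 χ), mul_add, map_add, ha, hb, map_add, map_add, mul_add]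
        algebraMap_mem' := fun c u => by
          rw [AlgHom.commutes, AlgHom.commutes, AlgHom.commutes, ← Algebra.commutes,
            ← Algebra.smul_def, map_smul, Algebra.smul_def, mul_comm] }
    have hB : B = ⊤ := subalgebra_eq_top_of_ι_mem B fun h u => by
      obtain ⟨u, rfl⟩ := S.toU_surjective χ u
      change θU (_ * S.uh χ h) = _
      rw [← toUι_lieMap, toUι_apply, ← map_mul, hθU, hθU, h4]
    intro s u
    have hs : s ∈ B := by rw [hB]; trivial
    exact hs u

variable (S χ) in
/-- The canonical generator of a baby Verma module is non-zero. -/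
theorem verMk_one_ne_zero [Infinite K] [Module.Free ℤ X] [Fact p.Prime] [CharP K p]
    (hp : S.IsGood) (hχ : S.IsStandardLevi χ I) : S.verMk χ π lam 1 1 ≠ 0 := by
  obtain ⟨θ, h1, h2, h3⟩ := exists_functional_U π lam hp hχ
  let Θ : S.U χ ⊗[K] F →ₗ[K] F := TensorProduct.lift ((LinearMap.mul K F).comp θ)
  have hΘ : ∀ y a, Θ (y ⊗ₜ a) = θ y * a := fun y a => rfl
  intro h0
  have hmem : (1 : S.U χ) ⊗ₜ[K] (1 : F) ∈ S.verRel χ F π lam :=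
    (Submodule.Quotient.mk_eq_zero _).mp h0
  have hz : Θ ((1 : S.U χ) ⊗ₜ[K] (1 : F)) = 0 := by
    refine S.mem_verRel_induction χ π lam (P := fun z => Θ z = 0) (map_zero _) ?_ ?_ ?_ hmem
    · intro z z' h h'
      rw [map_add, h, h', add_zero]
    · intro y α a hα
      rw [hΘ, h2 α y hα, zero_mul]
    · intro y s a
      rw [map_sub, hΘ, hΘ, h3]
      ring
  rw [hΘ, h1, one_mul] at hz
  exact one_ne_zero hz

/-! ### Proper submodules of a baby Verma module -/

variable (S χ) in
/-- The span of the images of the elements `e_α - χ(e_α)`, for negative `α`. -/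
def verRad : AddSubgroup (S.Ver χ F π lam) :=
  AddSubgroup.closure {z | ∃ (α : S.Neg) (z' : S.Ver χ F π lam), z = (S.uy χ α ⊗ₜ[K] (1 : F)) • z'}

lemma smul_mem_verRad (a : F) {z : S.Ver χ F π lam} (hz : z ∈ S.verRad χ π lam) :
    ((1 : S.U χ) ⊗ₜ[K] a) • z ∈ S.verRad χ π lam := by
  refine AddSubgroup.closure_induction (p := fun z _ => ((1 : S.U χ) ⊗ₜ[K] a) • z ∈
    S.verRad χ π lam) ?_ ?_ (fun _ _ _ _ h1 h2 => ?_) (fun _ _ h => ?_) hz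
  · rintro _ ⟨α, z, rfl⟩
    rw [smul_smul, Algebra.TensorProduct.tmul_mul_tmul, one_mul, mul_one]
    refine AddSubgroup.subset_closure ⟨α, ((1 : S.U χ) ⊗ₜ[K] a) • z, ?_⟩
    rw [smul_smul, Algebra.TensorProduct.tmul_mul_tmul, one_mul, mul_one]
  · rw [smul_zero]; exact AddSubgroup.zero_mem _
  · rw [smul_add]; exact AddSubgroup.add_mem _ h1 h2
  · rw [smul_neg]; exact AddSubgroup.neg_mem _ h

/-- The radical together with the generator spans a baby Verma module. -/
lemma exists_eq_add_verRad (z : S.Ver χ F π lam) :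
    ∃ a, ∃ j ∈ S.verRad χ π lam, z = S.verMk χ π lam 1 a + j := by
  have hz : z ∈ AddSubgroup.closure {z | ∃ l a, z = S.verMk χ π lam (S.word χ l) a} := by
    rw [closure_word_eq_top]; trivial
  have hmk : ∀ a b : F, S.verMk χ π lam 1 (a + b) = S.verMk χ π lam 1 a + S.verMk χ π lam 1 b := by
    intro a b
    rw [verMk, TensorProduct.tmul_add]
    rfl
  have hmk0 : S.verMk χ π lam 1 0 = 0 := by
    rw [verMk, TensorProduct.tmul_zero]
    rfl
  have hmkn : ∀ a : F, S.verMk χ π lam 1 (-a) = -S.verMk χ π lam 1 a := by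
    intro a
    rw [eq_neg_iff_add_eq_zero, ← hmk, neg_add_cancel, hmk0]
  induction hz using AddSubgroup.closure_induction with
  | mem z hz =>
    obtain ⟨l, a, rfl⟩ := hz
    rcases l with _ | ⟨α, l⟩
    · exact ⟨a, 0, AddSubgroup.zero_mem _, by rw [word_nil, add_zero]⟩
    · refine ⟨0, _, AddSubgroup.subset_closure ⟨α, S.verMk χ π lam (S.word χ l) a, rfl⟩, ?_⟩
      rw [hmk0, zero_add, smul_one_verMk, word_cons]
  | zero => exact ⟨0, 0, AddSubgroup.zero_mem _, by rw [hmk0, add_zero]⟩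
  | add z z' _ _ h h' =>
    obtain ⟨a, j, hj, rfl⟩ := h
    obtain ⟨b, j', hj', rfl⟩ := h'
    exact ⟨a + b, j + j', AddSubgroup.add_mem _ hj hj', by rw [hmk]; abel⟩
  | neg z _ h =>
    obtain ⟨a, j, hj, rfl⟩ := h
    exact ⟨-a, -j, AddSubgroup.neg_mem _ hj, by rw [hmkn]; abel⟩

/-- Nakayama's lemma for the nilpotent action of the elements `e_α - χ(e_α)`. -/
lemma eq_top_of_add_verRad [Infinite K] [Module.Free ℤ X] [Fact p.Prime] [CharP K p] [Finite S.R]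
    (hχ : S.IsStandardLevi χ I) (N : Submodule (S.U χ ⊗[K] F) (S.Ver χ F π lam))
    (hN : ∀ z, ∃ n ∈ N, ∃ j ∈ S.verRad χ π lam, z = n + j) : N = ⊤ := by
  obtain ⟨k, hk⟩ := S.exists_word_eq_zero hχ
  -- Descending induction on the length of `l`: writing `z = n + j`, the part `n` stays in `N`, and
  -- `j` lengthens the word by one letter. Words of length `k` are zero.
  have main : ∀ m, ∀ l : List S.Neg, k ≤ l.length + m → ∀ z : S.Ver χ F π lam,
      (S.word χ l ⊗ₜ[K] (1 : F)) • z ∈ N := by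
    intro m
    induction m with
    | zero =>
      intro l hl z
      rw [hk l hl, TensorProduct.zero_tmul, zero_smul]
      exact N.zero_mem
    | succ m ih =>
      intro l hl z
      obtain ⟨n, hn, j, hj, rfl⟩ := hN z
      rw [smul_add]
      refine N.add_mem (N.smul_mem _ hn) ?_
      refine AddSubgroup.closure_induction (p := fun z _ => (S.word χ l ⊗ₜ[K] (1 : F)) • z ∈ N)
        ?_ ?_ (fun _ _ _ _ h1 h2 => ?_) (fun _ _ h => ?_) hj
      · rintro _ ⟨α, z, rfl⟩
        have := ih (l ++ [α]) (by simp; omega) z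
        rw [word_append, word_cons, word_nil, mul_one] at this
        rwa [smul_smul, Algebra.TensorProduct.tmul_mul_tmul, mul_one]
      · rw [smul_zero]; exact N.zero_mem
      · rw [smul_add]; exact N.add_mem h1 h2
      · rw [smul_neg]; exact N.neg_mem h
  rw [eq_top_iff]
  intro z _
  have := main k [] (by simp) z
  rwa [word_nil, ← Algebra.TensorProduct.one_def, one_smul] at this

/-- Every proper submodule is contained in the radical. -/
lemma le_verRad [Infinite K] [Module.Free ℤ X] [Fact p.Prime] [CharP K p] [Finite S.R]
    (hχ : S.IsStandardLevi χ I) {N : Submodule (S.U χ ⊗[K] F) (S.Ver χ F π lam)} (hN : N ≠ ⊤) :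
    N.toAddSubgroup ≤ S.verRad χ π lam := by
  intro n hn
  by_contra hj
  obtain ⟨a, j, hj', hnj⟩ := exists_eq_add_verRad π lam n
  have ha : a ≠ 0 := by
    rintro rfl
    apply hj
    rw [hnj, verMk, TensorProduct.tmul_zero, Submodule.Quotient.mk_zero, zero_add]
    exact hj'
  apply hN
  apply eq_top_of_add_verRad π lam hχ
  intro z
  obtain ⟨b, i, hi, rfl⟩ := exists_eq_add_verRad π lam z
  -- Since `a` is invertible in `F`, this multiple of `n` has the same coefficient at the generator
  -- as `z`, hence agrees with it modulo the radical.
  refine ⟨((1 : S.U χ) ⊗ₜ[K] (b * a⁻¹)) • n, N.smul_mem _ hn,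
    i - ((1 : S.U χ) ⊗ₜ[K] (b * a⁻¹)) • j,
    AddSubgroup.sub_mem _ hi (smul_mem_verRad π lam _ hj'), ?_⟩
  rw [hnj, smul_add, one_smul_verMk, inv_mul_cancel_right₀ ha]
  abel

lemma verRad_ne_top [Infinite K] [Module.Free ℤ X] [Fact p.Prime] [CharP K p] [Finite S.R]
    (hp : S.IsGood) (hχ : S.IsStandardLevi χ I) : S.verRad χ π lam ≠ ⊤ := by
  intro h
  -- If the radical were everything, Nakayama's lemma for the zero submodule would annihilate the
  -- whole module.
  have hbot := eq_top_of_add_verRad π lam hχ ⊥ fun z =>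
    ⟨0, Submodule.zero_mem _, z, by rw [h]; trivial, (zero_add z).symm⟩
  refine verMk_one_ne_zero S χ π lam hp hχ ?_
  have : S.verMk χ π lam 1 1 ∈ (⊥ : Submodule (S.U χ ⊗[K] F) (S.Ver χ F π lam)) := by
    rw [hbot]; trivial
  exact this

end Setting

end

section

/-! ### Graded subgroups -/

/-- Components of an element of a graded subgroup lie in the subgroup. -/
lemma mem_of_sum_mem {V : Type u} [AddCommGroup V] {ι : Type v} {E : ι → AddSubgroup V}
    (hE : iSupIndep E) {N : AddSubgroup V} (hN : N ≤ ⨆ i, N ⊓ E i) {s : Finset ι} {f : ι → V}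
    (hf : ∀ i ∈ s, f i ∈ E i) (h : ∑ i ∈ s, f i ∈ N) : ∀ i ∈ s, f i ∈ N := by
  classical
  obtain ⟨t, g, hg, hgs⟩ := (addSubgroup_mem_iSup_iff _ _).mp (hN h)
  -- Compare the given sum with a decomposition inside `N`; independence makes them equal term by
  -- term.
  have h0 : ∑ i ∈ s ∪ t, ((if i ∈ s then f i else 0) - (if i ∈ t then g i else 0)) = 0 := by
    rw [Finset.sum_sub_distrib, Finset.sum_ite_mem, Finset.sum_ite_mem,
      Finset.union_inter_cancel_left, Finset.union_inter_cancel_right, hgs, sub_self]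
  intro i hi
  have h1 := (addSubgroup_iSupIndep_iff E).mp hE _ _ (fun j _ => ?_) h0 i
    (Finset.mem_union_left _ hi)
  · rw [if_pos hi, sub_eq_zero] at h1
    rw [h1]
    split_ifs
    · exact (hg i).1
    · exact N.zero_mem
  · refine sub_mem ?_ ?_
    · split_ifs with hj
      · exact hf j hj
      · exact zero_mem _
    · split_ifs
      · exact (hg j).2
      · exact zero_mem _

namespace Setting

variable {K : Type u} [Field K] {p : ℕ} {O : Type v} [CommRing O] [HopfAlgebra K O]
variable {X : Type w} [AddCommGroup X] {S : Setting K p O X}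
variable {χ : Module.Dual K (lieAlg K O)} {I : Set X}
variable {A : Type x} [CommRing A] [Algebra K A] {π : U0 K X →ₐ[K] A}

/-- The weight spaces of all degrees are independent. -/
lemma GrMod.IsObject.wt_indep_prod {M : S.GrMod χ I A} (hM : M.IsObject π) :
    iSupIndep fun q : S.XI I × Module.Dual K (Cartan K X) => M.wt q.1 q.2 := by
  classical
  rw [addSubgroup_iSupIndep_iff]
  intro s m hm h0
  have hle : ∀ σ ξ, M.wt σ ξ ≤ M.gr σ := fun σ ξ => hM.wt_sum σ ▸ le_iSup (M.wt σ) ξ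
  rw [← Finset.sum_fiberwise_of_maps_to (g := Prod.fst) (t := s.image Prod.fst)
    (fun q hq => Finset.mem_image_of_mem _ hq)] at h0
  have h1 := (addSubgroup_iSupIndep_iff _).mp hM.gr_indep _ _ (fun σ _ =>
    AddSubgroup.sum_mem _ fun q hq => by
      rw [Finset.mem_filter] at hq
      rw [← hq.2]
      exact hle _ _ (hm q hq.1)) h0
  rintro ⟨σ, ξ⟩ hq
  have h2 := h1 σ (Finset.mem_image_of_mem Prod.fst hq)
  let s' : Finset (Module.Dual K (Cartan K X)) := (s.filter fun q => q.1 = σ).image Prod.snd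
  have h3 : ∑ ξ ∈ s', m (σ, ξ) = 0 := by
    rw [← h2, Finset.sum_image]
    · refine Finset.sum_congr rfl fun q hq => ?_
      rw [← (Finset.mem_filter.mp hq).2]
    · intro q hq q' hq' h
      rw [Finset.mem_coe, Finset.mem_filter] at hq hq'
      exact Prod.ext (hq.2.trans hq'.2.symm) h
  refine (addSubgroup_iSupIndep_iff _).mp (hM.wt_indep σ) s' (fun ξ => m (σ, ξ)) ?_ h3 ξ
    (Finset.mem_image.mpr ⟨(σ, ξ), Finset.mem_filter.mpr ⟨hq, rfl⟩, rfl⟩)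
  intro η hη
  obtain ⟨q, hq, rfl⟩ := Finset.mem_image.mp hη
  obtain ⟨hq1, hq2⟩ := Finset.mem_filter.mp hq
  rw [← hq2]
  exact hm q hq1

lemma GrMod.IsObject.exists_sum_eq {M : S.GrMod χ I A} (hM : M.IsObject π) (m : M.carrier) :
    ∃ (s : Finset (S.XI I × Module.Dual K (Cartan K X))) (f : _ → M.carrier),
      (∀ q, f q ∈ M.wt q.1 q.2) ∧ ∑ q ∈ s, f q = m := by
  rw [← addSubgroup_mem_iSup_iff fun q : S.XI I × Module.Dual K (Cartan K X) => M.wt q.1 q.2,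
    iSup_prod]
  simp only [hM.wt_sum, hM.gr_top]
  trivial

/-! ### Subobjects, quotients and the unique irreducible quotient. -/

namespace Cat

variable {M L : S.Cat χ I A π}

lemma isSubobject_iff {N : Submodule (S.U χ ⊗[K] A) M.obj.carrier} : M.IsSubobject N ↔
    N.toAddSubgroup ≤ ⨆ q : S.XI I × Module.Dual K (Cartan K X),
      N.toAddSubgroup ⊓ M.obj.wt q.1 q.2 := by
  rw [iSup_prod]
  rfl

lemma isSubobject_of_sum {N : Submodule (S.U χ ⊗[K] A) M.obj.carrier}
    (h : ∀ n ∈ N, ∃ (s : Finset (S.XI I × Module.Dual K (Cartan K X))) (f : _ → M.obj.carrier),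
      (∀ q ∈ s, f q ∈ N ∧ f q ∈ M.obj.wt q.1 q.2) ∧ ∑ q ∈ s, f q = n) : M.IsSubobject N := by
  rw [isSubobject_iff]
  intro n hn
  obtain ⟨s, f, hf, rfl⟩ := h n hn
  exact AddSubgroup.sum_mem _ fun q hq => AddSubgroup.mem_iSup_of_mem q (hf q hq)

lemma IsSubobject.exists_sum {N : Submodule (S.U χ ⊗[K] A) M.obj.carrier} (hN : M.IsSubobject N)
    {n : M.obj.carrier} (hn : n ∈ N) :
    ∃ (s : Finset (S.XI I × Module.Dual K (Cartan K X))) (f : _ → M.obj.carrier),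
      (∀ q, f q ∈ N ∧ f q ∈ M.obj.wt q.1 q.2) ∧ ∑ q ∈ s, f q = n :=
  (addSubgroup_mem_iSup_iff _ _).mp (isSubobject_iff.mp hN hn)

lemma isSubobject_sSup (T : Set (Submodule (S.U χ ⊗[K] A) M.obj.carrier))
    (hT : ∀ N ∈ T, M.IsSubobject N) : M.IsSubobject (sSup T) := by
  intro n hn
  have hn' : n ∈ ⨆ N : T, N.1 := by rwa [← sSup_eq_iSup']
  refine Submodule.iSup_induction (fun N : T => N.1)
    (motive := fun n => n ∈ ⨆ (σ) (ξ), (sSup T).toAddSubgroup ⊓ M.obj.wt σ ξ) hn' ?_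
    (AddSubgroup.zero_mem _) fun _ _ => AddSubgroup.add_mem _
  intro N m hm
  have hmono : (⨆ (σ) (ξ), N.1.toAddSubgroup ⊓ M.obj.wt σ ξ) ≤
      ⨆ (σ) (ξ), (sSup T).toAddSubgroup ⊓ M.obj.wt σ ξ :=
    iSup₂_mono fun σ ξ => inf_le_inf_right _ (Submodule.toAddSubgroup_mono (le_sSup N.2))
  exact hmono (hT N.1 N.2 hm)

lemma Hom.map_mem_wt (f : Hom M L) {σ : S.XI I} {ξ : Module.Dual K (Cartan K X)}
    {m : M.obj.carrier} (hm : m ∈ M.obj.wt σ ξ) : f.map m ∈ L.obj.wt σ ξ := by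
  by_cases hξ : ξ ∈ S.weights I σ
  · exact f.map_wt σ ξ hξ m hm
  · rw [M.isObject.wt_bot σ ξ hξ, AddSubgroup.mem_bot] at hm
    rw [hm, map_zero]
    exact AddSubgroup.zero_mem _

/-- The weight components of a kernel element have images in independent weight spaces with sum
zero, so each image vanishes. -/
lemma Hom.isSubobject_ker (f : Hom M L) : M.IsSubobject (LinearMap.ker f.map) := by
  apply isSubobject_of_sum
  intro n hn
  obtain ⟨s, g, hg, rfl⟩ := M.isObject.exists_sum_eq n
  rw [LinearMap.mem_ker, map_sum] at hn
  have h := (addSubgroup_iSupIndep_iff _).mp L.isObject.wt_indep_prod s _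
    (fun q _ => f.map_mem_wt (hg q)) hn
  exact ⟨s, g, fun q hq => ⟨h q hq, hg q⟩, rfl⟩

lemma Hom.isSubobject_map (f : Hom M L) {N : Submodule (S.U χ ⊗[K] A) M.obj.carrier}
    (hN : M.IsSubobject N) : L.IsSubobject (N.map f.map) := by
  apply isSubobject_of_sum
  rintro _ ⟨n, hn, rfl⟩
  obtain ⟨s, g, hg, rfl⟩ := hN.exists_sum hn
  exact ⟨s, fun q => f.map (g q), fun q _ => ⟨⟨g q, (hg q).1, rfl⟩, f.map_mem_wt (hg q).2⟩,
    (map_sum f.map _ _).symm⟩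

/-- A surjective morphism is surjective on weight spaces. -/
lemma Hom.exists_mem_wt (f : Hom M L) (hf : Function.Surjective f.map) {σ : S.XI I}
    {ξ : Module.Dual K (Cartan K X)} {y : L.obj.carrier} (hy : y ∈ L.obj.wt σ ξ) :
    ∃ m ∈ M.obj.wt σ ξ, f.map m = y := by
  classical
  obtain ⟨m, rfl⟩ := hf y
  obtain ⟨s, g, hg, rfl⟩ := M.isObject.exists_sum_eq m
  let q₀ : S.XI I × Module.Dual K (Cartan K X) := (σ, ξ)
  by_cases hq₀ : q₀ ∈ s
  · refine ⟨g q₀, hg q₀, ?_⟩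
    have h0 : ∑ q ∈ s, (f.map (g q) - if q = q₀ then f.map (∑ q ∈ s, g q) else 0) = 0 := by
      rw [Finset.sum_sub_distrib, Finset.sum_ite_eq' s q₀, if_pos hq₀, map_sum, sub_self]
    have h1 := (addSubgroup_iSupIndep_iff _).mp L.isObject.wt_indep_prod s _
      (fun q _ => AddSubgroup.sub_mem _ (f.map_mem_wt (hg q)) (by
        split_ifs with h
        · subst h; exact hy
        · exact AddSubgroup.zero_mem _)) h0 q₀ hq₀
    rw [if_pos rfl, sub_eq_zero] at h1
    exact h1
  -- Here `y` is a sum of vectors of other weights, so by independence it is zero.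
  · refine ⟨0, AddSubgroup.zero_mem _, ?_⟩
    have h0 : ∑ q ∈ insert q₀ s, (if q = q₀ then -f.map (∑ q ∈ s, g q) else f.map (g q)) = 0 := by
      rw [Finset.sum_insert hq₀, if_pos rfl, map_sum, neg_add_eq_zero]
      refine Finset.sum_congr rfl fun q hq => ?_
      rw [if_neg fun h : q = q₀ => hq₀ (h ▸ hq)]
    have h1 := (addSubgroup_iSupIndep_iff _).mp L.isObject.wt_indep_prod _ _ (fun q _ => by
      split_ifs with h
      · subst h; exact AddSubgroup.neg_mem _ hy
      · exact f.map_mem_wt (hg q)) h0 q₀ (Finset.mem_insert_self _ _)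
    rw [if_pos rfl, neg_eq_zero] at h1
    rw [map_zero, h1]

/-- The quotient of an object by a subobject, with the induced grading. -/
def quotGrMod (M : S.Cat χ I A π) (N : Submodule (S.U χ ⊗[K] A) M.obj.carrier) :
    S.GrMod χ I A where
  carrier := M.obj.carrier ⧸ N
  gr σ := (M.obj.gr σ).map N.mkQ.toAddMonoidHom
  wt σ ξ := (M.obj.wt σ ξ).map N.mkQ.toAddMonoidHom

lemma quotGrMod_gr_indep {N : Submodule (S.U χ ⊗[K] A) M.obj.carrier} (hN : M.IsSubobject N) :
    iSupIndep (M.quotGrMod N).gr := by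
  classical
  have hN' : N.toAddSubgroup ≤ ⨆ σ, N.toAddSubgroup ⊓ M.obj.gr σ := by
    refine le_trans hN (iSup_mono fun σ => iSup_le fun ξ => inf_le_inf_left _ ?_)
    rw [← M.isObject.wt_sum σ]
    exact le_iSup _ ξ
  refine (addSubgroup_iSupIndep_iff (V := M.obj.carrier ⧸ N) _).mpr ?_
  intro s m hm h0 σ hσ
  have hex : ∀ σ, ∃ g : M.obj.carrier, σ ∈ s → g ∈ M.obj.gr σ ∧ N.mkQ g = m σ := by
    intro σ
    by_cases h : σ ∈ s
    · obtain ⟨g, hg, hgm⟩ := hm σ h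
      exact ⟨g, fun _ => ⟨hg, hgm⟩⟩
    · exact ⟨0, fun h' => (h h').elim⟩
  choose g hg using hex
  have hsum : ∑ σ ∈ s, g σ ∈ N.toAddSubgroup := by
    change _ ∈ N
    rw [← Submodule.ker_mkQ N, LinearMap.mem_ker, map_sum,
      Finset.sum_congr rfl fun σ hσ => (hg σ hσ).2, h0]
  have := mem_of_sum_mem M.isObject.gr_indep hN' (fun σ hσ => (hg σ hσ).1) hsum σ hσ
  rw [← (hg σ hσ).2]
  exact (Submodule.Quotient.mk_eq_zero N).mpr this

/-- Only independence of the degrees needs `N` to be a subobject; independence of the weights in a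
quotient is automatic from the action of `U⁰`. -/
lemma quotGrMod_isObject {N : Submodule (S.U χ ⊗[K] A) M.obj.carrier} (hN : M.IsSubobject N) :
    (M.quotGrMod N).IsObject π := by
  classical
  have hM := M.isObject
  have hbot : ∀ σ, ∀ ξ ∉ S.weights I σ, (M.quotGrMod N).wt σ ξ = ⊥ := by
    intro σ ξ hξ
    change (M.obj.wt σ ξ).map _ = ⊥
    rw [hM.wt_bot σ ξ hξ, AddSubgroup.map_bot]
  have hact : ∀ (σ : S.XI I) (μ : X), dchar μ ∈ S.weights I σ → ∀ (s : U0 K X),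
      ∀ m ∈ (M.quotGrMod N).wt σ (dchar μ),
      (S.u0 χ s ⊗ₜ[K] (1 : A)) • m = ((1 : S.U χ) ⊗ₜ[K] π (tilde μ s)) • m := by
    rintro σ μ hμ s _ ⟨m, hm, rfl⟩
    exact congrArg N.mkQ (hM.wt_act σ μ hμ s m hm)
  exact
    { gr_indep := quotGrMod_gr_indep hN
      gr_top := by
        change ⨆ σ, (M.obj.gr σ).map N.mkQ.toAddMonoidHom = ⊤
        rw [← AddSubgroup.map_iSup, hM.gr_top]
        exact AddSubgroup.map_top_of_surjective _ N.mkQ_surjective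
      gr_smul := by
        rintro σ a _ ⟨m, hm, rfl⟩
        exact ⟨_, hM.gr_smul σ a m hm, rfl⟩
      gr_finite := hM.gr_finite.subset fun σ hσ h => hσ (by
        change (M.obj.gr σ).map _ = ⊥
        rw [h, AddSubgroup.map_bot])
      gr_fg := by
        intro σ
        obtain ⟨s, hs⟩ := hM.gr_fg σ
        refine ⟨s.image N.mkQ, ?_⟩
        change (M.obj.gr σ).map _ = _
        rw [hs, AddMonoidHom.map_closure]
        congr 1
        ext m
        constructor
        · rintro ⟨_, ⟨a, y, hy, rfl⟩, rfl⟩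
          exact ⟨a, N.mkQ y, Finset.mem_image_of_mem _ hy, rfl⟩
        · rintro ⟨a, y, hy, rfl⟩
          obtain ⟨z, hz, rfl⟩ := Finset.mem_image.mp hy
          exact ⟨_, ⟨a, z, hz, rfl⟩, rfl⟩
      gr_mul := by
        rintro σ τ y hy _ ⟨m, hm, rfl⟩
        exact ⟨_, hM.gr_mul σ τ y hy m hm, rfl⟩
      wt_indep := fun σ => GrMod.wt_indep_of_act _ σ (hbot σ) (hact σ)
      wt_sum := by
        intro σ
        change ⨆ ξ, (M.obj.wt σ ξ).map N.mkQ.toAddMonoidHom = (M.obj.gr σ).map _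
        rw [← AddSubgroup.map_iSup, hM.wt_sum]
      wt_bot := hbot
      wt_act := hact
      wt_root := by
        rintro σ μ α hμ _ ⟨m, hm, rfl⟩
        exact ⟨_, hM.wt_root σ μ α hμ m hm, rfl⟩
      wt_smul := by
        rintro σ ξ a _ ⟨m, hm, rfl⟩
        exact ⟨_, hM.wt_smul σ ξ a m hm, rfl⟩ }

/-- The quotient of an object by a subobject. -/
def quot (M : S.Cat χ I A π) {N : Submodule (S.U χ ⊗[K] A) M.obj.carrier} (hN : M.IsSubobject N) :
    S.Cat χ I A π :=
  ⟨M.quotGrMod N, quotGrMod_isObject hN⟩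

/-- The quotient morphism. -/
def quotHom (M : S.Cat χ I A π) {N : Submodule (S.U χ ⊗[K] A) M.obj.carrier}
    (hN : M.IsSubobject N) : Hom M (M.quot hN) where
  map := N.mkQ
  map_wt _ _ _ m hm := ⟨m, hm, rfl⟩

lemma quotHom_surjective {N : Submodule (S.U χ ⊗[K] A) M.obj.carrier} (hN : M.IsSubobject N) :
    Function.Surjective (M.quotHom hN).map := N.mkQ_surjective

lemma ker_quotHom {N : Submodule (S.U χ ⊗[K] A) M.obj.carrier} (hN : M.IsSubobject N) :
    LinearMap.ker (M.quotHom hN).map = N := N.ker_mkQ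

/-- Preimages of subobjects under surjective morphisms are subobjects. -/
lemma Hom.isSubobject_comap (f : Hom M L) (hf : Function.Surjective f.map)
    {N : Submodule (S.U χ ⊗[K] A) L.obj.carrier} (hN : L.IsSubobject N) :
    M.IsSubobject (N.comap f.map) := by
  intro m hm
  obtain ⟨s, g, hg, hgs⟩ := hN.exists_sum (show f.map m ∈ N from hm)
  choose k hk hkg using fun q : S.XI I × Module.Dual K (Cartan K X) =>
    f.exists_mem_wt hf (hg q).2
  -- Weight components of `f m` lift to weight vectors in the preimage; what remains lies in the
  -- kernel, a subobject contained in the preimage.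
  have h1 : m - ∑ q ∈ s, k q ∈ LinearMap.ker f.map := by
    rw [LinearMap.mem_ker, map_sub, map_sum, Finset.sum_congr rfl fun q _ => hkg q, hgs, sub_self]
  have h2 := f.isSubobject_ker h1
  rw [← sub_add_cancel m (∑ q ∈ s, k q)]
  refine AddSubgroup.add_mem _ ?_ (AddSubgroup.sum_mem _ fun q _ => ?_)
  · have hmono : (⨆ (σ) (ξ), (LinearMap.ker f.map).toAddSubgroup ⊓ M.obj.wt σ ξ) ≤
        ⨆ (σ) (ξ), (N.comap f.map).toAddSubgroup ⊓ M.obj.wt σ ξ :=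
      iSup₂_mono fun σ ξ =>
        inf_le_inf_right _ (Submodule.toAddSubgroup_mono (LinearMap.ker_le_comap f.map))
    exact hmono h2
  · refine AddSubgroup.mem_iSup_of_mem q.1 (AddSubgroup.mem_iSup_of_mem q.2 ⟨?_, hk q⟩)
    change f.map (k q) ∈ N
    rw [hkg q]
    exact (hg q).1

/-- Two surjective morphisms with the same kernel differ by an isomorphism. -/
lemma exists_iso_of_ker_eq {L' : S.Cat χ I A π} (f : M ⟶ L) (g : M ⟶ L')
    (hf : Function.Surjective (Hom.map f)) (hg : Function.Surjective (Hom.map g))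
    (h : LinearMap.ker (Hom.map f) = LinearMap.ker (Hom.map g)) :
    ∃ φ : L ≅ L', CategoryTheory.CategoryStruct.comp f φ.hom = g := by
  let e : L.obj.carrier ≃ₗ[S.U χ ⊗[K] A] L'.obj.carrier :=
    (LinearMap.quotKerEquivOfSurjective (Hom.map f) hf).symm.trans
      ((Submodule.quotEquivOfEq _ _ h).trans (LinearMap.quotKerEquivOfSurjective (Hom.map g) hg))
  have he : ∀ m, e (Hom.map f m) = Hom.map g m := by
    intro m
    have h1 : (LinearMap.quotKerEquivOfSurjective (Hom.map f) hf).symm (Hom.map f m) =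
        Submodule.Quotient.mk m := by
      rw [LinearEquiv.symm_apply_eq]
      rfl
    change LinearMap.quotKerEquivOfSurjective (Hom.map g) hg (Submodule.quotEquivOfEq _ _ h
      ((LinearMap.quotKerEquivOfSurjective (Hom.map f) hf).symm (Hom.map f m))) = _
    rw [h1]
    rfl
  let a : Hom L L' := ⟨e.toLinearMap, fun σ ξ _ y hy => by
    obtain ⟨m, hm, rfl⟩ := Hom.exists_mem_wt f hf hy
    change e (Hom.map f m) ∈ _
    rw [he]
    exact Hom.map_mem_wt g hm⟩
  let b : Hom L' L := ⟨e.symm.toLinearMap, fun σ ξ _ y hy => by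
    obtain ⟨m, hm, rfl⟩ := Hom.exists_mem_wt g hg hy
    change e.symm (Hom.map g m) ∈ _
    rw [← he, LinearEquiv.symm_apply_apply]
    exact Hom.map_mem_wt f hm⟩
  refine ⟨⟨a, b, ?_, ?_⟩, ?_⟩
  · exact Hom.ext (LinearMap.ext fun y => e.symm_apply_apply y)
  · exact Hom.ext (LinearMap.ext fun y => e.apply_symm_apply y)
  · exact Hom.ext (LinearMap.ext he)

/-- If all proper subobjects lie in a common proper subgroup, then there is a unique irreducible
quotient. -/
theorem exists_unique_irreducible_quotient (M : S.Cat χ I A π) (J : AddSubgroup M.obj.carrier)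
    (hJ : J ≠ ⊤) (hle : ∀ N, M.IsSubobject N → N ≠ ⊤ → N.toAddSubgroup ≤ J) :
    ∃ (L : S.Cat χ I A π) (q : M ⟶ L), Function.Surjective (Hom.map q) ∧ L.IsIrreducible ∧
      ∀ (L' : S.Cat χ I A π) (q' : M ⟶ L'), Function.Surjective (Hom.map q') → L'.IsIrreducible →
        ∃ φ : L ≅ L', CategoryTheory.CategoryStruct.comp q φ.hom = q' := by
  -- The sum of all proper subobjects stays inside `J`, hence is the largest proper subobject.
  let T : Set (Submodule (S.U χ ⊗[K] A) M.obj.carrier) := {N | M.IsSubobject N ∧ N ≠ ⊤}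
  have hsub : M.IsSubobject (sSup T) := isSubobject_sSup T fun N hN => hN.1
  have hmaxJ : (sSup T).toAddSubgroup ≤ J := by
    intro n hn
    have hn' : n ∈ ⨆ N : T, N.1 := by rwa [← sSup_eq_iSup']
    exact Submodule.iSup_induction (fun N : T => N.1) (motive := fun n => n ∈ J) hn'
      (fun N m hm => hle N.1 N.2.1 N.2.2 hm) J.zero_mem fun _ _ => J.add_mem
  have hne : sSup T ≠ ⊤ := by
    intro h
    apply hJ
    rw [eq_top_iff]
    intro n _
    exact hmaxJ (show n ∈ sSup T by rw [h]; trivial)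
  refine ⟨M.quot hsub, M.quotHom hsub, quotHom_surjective hsub, ⟨?_, ?_⟩, ?_⟩
  · exact Submodule.Quotient.nontrivial_iff.mpr hne
  · intro N hN
    have hs := quotHom_surjective hsub
    by_cases htop : N.comap (M.quotHom hsub).map = ⊤
    · right
      rw [← Submodule.map_comap_eq_of_surjective hs N, htop, Submodule.map_top,
        LinearMap.range_eq_top.mpr hs]
    · left
      have h1 : N.comap (M.quotHom hsub).map ≤ LinearMap.ker (M.quotHom hsub).map := by
        rw [ker_quotHom hsub]
        exact le_sSup ⟨(M.quotHom hsub).isSubobject_comap hs hN, htop⟩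
      rw [← Submodule.map_comap_eq_of_surjective hs N, eq_bot_iff, Submodule.map_le_iff_le_comap]
      exact h1
  · intro L' q' hq' hL'
    refine exists_iso_of_ker_eq (M.quotHom hsub) q' (quotHom_surjective hsub) hq' ?_
    rw [ker_quotHom hsub]
    have hker : LinearMap.ker (Hom.map q') ≤ sSup T := by
      refine le_sSup ⟨Hom.isSubobject_ker q', fun h => ?_⟩
      obtain ⟨y, hy⟩ := @exists_ne _ hL'.1 (0 : L'.obj.carrier)
      obtain ⟨m, rfl⟩ := hq' y
      exact hy (LinearMap.mem_ker.mp (h ▸ Submodule.mem_top))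
    refine le_antisymm ?_ hker
    -- If the image of the largest proper subobject were everything, that subobject together with
    -- the kernel it contains would fill `M`.
    rcases hL'.2 _ (Hom.isSubobject_map q' hsub) with h | h
    · exact Submodule.map_le_iff_le_comap.mp h.le
    · exfalso
      apply hne
      rw [eq_top_iff]
      intro m _
      have hm : Hom.map q' m ∈ (sSup T).map (Hom.map q') := by rw [h]; trivial
      obtain ⟨n, hn, hnm⟩ := hm
      have : m - n ∈ LinearMap.ker (Hom.map q') := by
        rw [LinearMap.mem_ker, map_sub, hnm, sub_self]
      rw [← sub_add_cancel m n]
      exact Submodule.add_mem _ (hker this) hn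

end Cat
end Setting

end

end BabyVerma

/-- Every baby Verma module over a field `F` is an object of the category and has a unique
irreducible quotient in it. -/
theorem mainTheorem5 {K O X F : Type*} [Field K] [IsAlgClosed K] (p : ℕ) [Fact p.Prime] [CharP K p]
    [CommRing O] [HopfAlgebra K O] (hG : BabyVerma.IsConnectedReductive K O)
    [AddCommGroup X] [Module.Free ℤ X] [Module.Finite ℤ X]
    (S : BabyVerma.Setting K p O X) (hp : S.IsGood)
    (χ : Module.Dual K (BabyVerma.lieAlg K O)) (I : Set X) (hχ : S.IsStandardLevi χ I)
    [Field F] [Algebra K F] (π : BabyVerma.U0 K X →ₐ[K] F) (lam : X) :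
    ∃ hZ : (S.babyVerma χ I F π lam).IsObject π,
      ∃ (L : S.Cat χ I F π) (q : (⟨S.babyVerma χ I F π lam, hZ⟩ : S.Cat χ I F π) ⟶ L),
        Function.Surjective q.map ∧ L.IsIrreducible ∧
        ∀ (L' : S.Cat χ I F π) (q' : (⟨S.babyVerma χ I F π lam, hZ⟩ : S.Cat χ I F π) ⟶ L'),
          Function.Surjective q'.map → L'.IsIrreducible →
          ∃ φ : L ≅ L', CategoryTheory.CategoryStruct.comp q φ.hom = q' := by
  have : Algebra.FiniteType K O := hG.finiteType
  have := BabyVerma.finite_lieAlg (K := K) (O := O)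
  have hfin := Module.Finite.finite_basis S.basis
  -- The roots index part of a basis of the finite-dimensional space `𝔤`.
  have : Finite S.R := @Finite.of_injective _ _ hfin Sum.inl Sum.inl_injective
  have hZ := BabyVerma.Setting.babyVerma_isObject S χ I π lam hχ
  exact ⟨hZ, BabyVerma.Setting.Cat.exists_unique_irreducible_quotient ⟨_, hZ⟩
    (S.verRad χ π lam) (BabyVerma.Setting.verRad_ne_top π lam hp hχ)
    fun N _ hN => BabyVerma.Setting.le_verRad π lam hχ hN⟩
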